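/- Let $n\ge 1$ and let $\mathbb H^n=\mathbb C^n\times\mathbb R$ be the Heisenberg group, with the law $(z,t)(z',t')=(z+z',\,t+t'+2\,\mathrm{Im}(z\cdot\overline{z'}))$, the homogeneous norm $|\xi|=(|z|^4+t^2)^{1/4}$ for $\xi=(z,t)$, the homogeneous dimension $Q=2n+2$, Lebesgue measure $d\eta$, and the left invariant fields $X_j=\partial_{x_j}+2y_j\partial_t$, $Y_j=\partial_{y_j}-2x_j\partial_t$ $(1\le j\le n)$, where $z_j=x_j+iy_j$. **Lipschitz spaces.** For $0<\beta<1$, $\Gamma_\beta$ is the space of bounded continuous $f:\mathbb H^n\to\mathbb R$ with $\sup_{\xi,\,\eta\ne0}|f(\xi\eta)-f(\xi)|/|\eta|^\beta<\infty$. $\Gamma_1$ is the space of bounded continuous $f$ with $\sup_{\xi,\,\eta\neq0}|f(\xi\eta)+f(\xi\eta^{-1})-2f(\xi)|/|\eta|<\infty$. For $\beta=k+\beta'$ with $k\ge1$ an integer and $0<\beta'\le1$, $\Gamma_\beta$ consists of those $f$ such that $f$ and all derivatives $L_{1}\cdots L_{j}f$ with $j\le k$ and $L_i\in\{X_1,\dots,X_n,Y_1,\dots,Y_n\}$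 exist and belong to $\Gamma_{\beta'}$. The classical Lipschitz space $C^\beta$ $(0<\beta<\infty)$ on $\mathbb R^{2n+1}$ is defined in the same way with Euclidean translations $\xi\pm\eta$, the Euclidean norm and the coordinate derivatives in place of the group translations, $|\cdot|$ and $X_j,Y_j$. For a bounded open set $\Omega$, $\Gamma^\beta(\overline\Omega)$ and $C^\beta(\overline\Omega)$ are the spaces of restrictions to $\overline\Omega$ of functions in $\Gamma_\beta$ and $C^\beta$. **Statement.** Let $0<\alpha<Q$, let $\Omega\subset\mathbb H^n$ be a bounded open set (for instance a smooth bounded domain), and let $1<q'<\frac{2Q}{Q-\alpha}$. If $g\in L^{q'}(\Omega)$ is positive in $\Omega$ and satisfies $$g(\xi)=\int_\Omega g^{q'-1}(\eta)\,|\eta^{-1}\xi|^{\alpha-Q}\,d\eta\qquad\text{for all }\xi\in\overline\Omega,$$ then $g$ is bounded on $\overline\Omega$ and $g\in\Gamma^\alpha(\overline\Omega)$. Moreover $\Gamma^\alpha(\overline\Omega)\subset C^{\alpha/2}(\overline\Omega)$. -/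

import Mathlib

open MeasureTheory Set
open scoped BigOperators ComplexConjugate

noncomputable section

namespace Heisenberg

/-- The underlying space `ℂⁿ × ℝ = ℝ²ⁿ⁺¹` of the Heisenberg group, in the real coordinates
`(x, y, t)`. As a real vector space it carries the Euclidean norm `‖·‖` and Lebesgue measure
`volume`; the group law is `mul` below. -/
abbrev Heis (n : ℕ) : Type := EuclideanSpace ℝ (Fin n ⊕ Fin n ⊕ Unit)

variable {n : ℕ}

/-- The complex coordinates `z_j = x_j + i y_j`. -/
def zc (ξ : Heis n) (j : Fin n) : ℂ := ⟨ξ (Sum.inl j), ξ (Sum.inr (Sum.inl j))⟩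

/-- The central coordinate `t`. -/
def tc (ξ : Heis n) : ℝ := ξ (Sum.inr (Sum.inr ()))

/-- The point `(z, t)`. -/
def point (z : Fin n → ℂ) (t : ℝ) : Heis n :=
  WithLp.toLp 2
    (Sum.elim (fun j => (z j).re) (Sum.elim (fun j => (z j).im) (fun _ => t)))

/-- The group law `(z, t)(z', t') = (z + z', t + t' + 2 Im (z · conj z'))`. -/
def mul (ξ η : Heis n) : Heis n :=
  point (fun j => zc ξ j + zc η j)
    (tc ξ + tc η + 2 * (∑ j, zc ξ j * conj (zc η j)).im)

/-- The group inverse `(z, t)⁻¹ = (-z, -t)`. -/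
def inv (ξ : Heis n) : Heis n := point (fun j => -zc ξ j) (-tc ξ)

/-- The homogeneous norm `|ξ| = (|z|⁴ + t²)^{1/4}`. -/
def gauge (ξ : Heis n) : ℝ :=
  ((∑ j, ‖zc ξ j‖ ^ 2) ^ 2 + tc ξ ^ 2) ^ (1 / 4 : ℝ)

/-- The homogeneous dimension `Q = 2n + 2`. -/
def homDim (n : ℕ) : ℝ := 2 * n + 2

/-- The coordinate vectors of `ℝ²ⁿ⁺¹`. -/
def coordVec (i : Fin n ⊕ Fin n ⊕ Unit) : Heis n := EuclideanSpace.single i (1 : ℝ)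

/-- The left invariant horizontal fields:
`inl j` is `X_j = ∂/∂x_j + 2 y_j ∂/∂t`, and `inr j` is `Y_j = ∂/∂y_j - 2 x_j ∂/∂t`. -/
def horiz : Fin n ⊕ Fin n → Heis n → Heis n
  | Sum.inl j, ξ =>
      coordVec (Sum.inl j) + (2 * (zc ξ j).im) • coordVec (Sum.inr (Sum.inr ()))
  | Sum.inr j, ξ =>
      coordVec (Sum.inr (Sum.inl j)) - (2 * (zc ξ j).re) • coordVec (Sum.inr (Sum.inr ()))

/-- `V f`, the derivative of `f` along the vector field `V`. -/
def fieldDeriv (V : Heis n → Heis n) (f : Heis n → ℝ) : Heis n → ℝ :=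
  fun ξ => lineDeriv ℝ f ξ (V ξ)

/-- The derivative of `f` along `V` exists at every point. -/
def FieldDifferentiable (V : Heis n → Heis n) (f : Heis n → ℝ) : Prop :=
  ∀ ξ, LineDifferentiableAt ℝ f ξ (V ξ)

/-- Continuous and bounded functions. -/
def BoundedCont (f : Heis n → ℝ) : Prop := Continuous f ∧ ∃ M : ℝ, ∀ ξ, |f ξ| ≤ M

/-- The space `Γ_b` for `0 < b ≤ 1`: first differences for `b < 1`, symmetric second differences
for `b = 1`. -/
def GammaBase (b : ℝ) (f : Heis n → ℝ) : Prop :=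
  BoundedCont f ∧
  (b < 1 → ∃ C : ℝ, ∀ ξ η, |f (mul ξ η) - f ξ| ≤ C * gauge η ^ b) ∧
  (b = 1 → ∃ C : ℝ, ∀ ξ η, |f (mul ξ η) + f (mul ξ (inv η)) - 2 * f ξ| ≤ C * gauge η)

/-- `D f ∈ Γ_b` for every composition `D` of at most `k` of the fields `X_j, Y_j`
(including the empty one). -/
def GammaIter (b : ℝ) : ℕ → (Heis n → ℝ) → Prop
  | 0, f => GammaBase b f
  | k + 1, f => GammaBase b f ∧
      ∀ a : Fin n ⊕ Fin n,
        FieldDifferentiable (horiz a) f ∧ GammaIter b k (fieldDeriv (horiz a) f)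

/-- The Folland-Stein Lipschitz space `Γ_β` on the Heisenberg group, `β = k + b > 0` with
`k ∈ ℕ` and `0 < b ≤ 1`. -/
def Gamma (n : ℕ) (β : ℝ) : Set (Heis n → ℝ) :=
  {f | ∃ (k : ℕ) (b : ℝ), 0 < b ∧ b ≤ 1 ∧ β = k + b ∧ GammaIter b k f}

/-- The classical Lipschitz space of order `0 < b ≤ 1` on `ℝ²ⁿ⁺¹`. -/
def LipBase (b : ℝ) (f : Heis n → ℝ) : Prop :=
  BoundedCont f ∧
  (b < 1 → ∃ C : ℝ, ∀ x h, |f (x + h) - f x| ≤ C * ‖h‖ ^ b) ∧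
  (b = 1 → ∃ C : ℝ, ∀ x h, |f (x + h) + f (x - h) - 2 * f x| ≤ C * ‖h‖)

/-- All partial derivatives of order at most `k` are in the classical Lipschitz space
of order `b`. -/
def LipIter (b : ℝ) : ℕ → (Heis n → ℝ) → Prop
  | 0, f => LipBase b f
  | k + 1, f => LipBase b f ∧
      ∀ i : Fin n ⊕ Fin n ⊕ Unit,
        FieldDifferentiable (fun _ => coordVec i) f ∧
          LipIter b k (fieldDeriv (fun _ => coordVec i) f)

/-- The classical (Euclidean) Lipschitz space `C^β` on `ℝ²ⁿ⁺¹`, `β = k + b > 0` with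
`k ∈ ℕ` and `0 < b ≤ 1`. -/
def Lip (n : ℕ) (β : ℝ) : Set (Heis n → ℝ) :=
  {f | ∃ (k : ℕ) (b : ℝ), 0 < b ∧ b ≤ 1 ∧ β = k + b ∧ LipIter b k f}

/-- `Γ^β(S)`: the functions that agree on `S` with an element of `Γ_β`. Only the values on `S`
matter. -/
def GammaOn (β : ℝ) (S : Set (Heis n)) : Set (Heis n → ℝ) :=
  {f | ∃ F ∈ Gamma n β, EqOn f F S}

/-- `C^β(S)`: the functions that agree on `S` with an element of the classical space `C^β`. -/
def LipOn (β : ℝ) (S : Set (Heis n)) : Set (Heis n → ℝ) :=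
  {f | ∃ F ∈ Lip n β, EqOn f F S}

/-- `g` is a positive solution of
`g(ξ) = ∫_Ω g(η)^{p-1} |η⁻¹ξ|^{α-Q} dη`, `ξ ∈ closure Ω` (the integral being finite). -/
def IsPositiveSolution (Ω : Set (Heis n)) (α p : ℝ) (g : Heis n → ℝ) : Prop :=
  (∀ ξ ∈ Ω, 0 < g ξ) ∧
  ∀ ξ ∈ closure Ω,
    IntegrableOn (fun η => g η ^ (p - 1) * gauge (mul (inv η) ξ) ^ (α - homDim n)) Ω volume ∧
    g ξ = ∫ η in Ω, g η ^ (p - 1) * gauge (mul (inv η) ξ) ^ (α - homDim n)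

end Heisenberg

end

open MeasureTheory Set
open scoped BigOperators ComplexConjugate
noncomputable section
namespace Heisenberg

variable {n : ℕ}

/-! The theorem joins a subcritical integrability bootstrap, a Folland–Stein gain of `α` derivatives
for convolution with `|·|^{α-Q}`, and a comparison of Heisenberg with Euclidean smoothness.

Boundedness. If `g ∈ L^r` then `g^{q'-1} ∈ L^{r/(q'-1)}`, and the kernel is uniformly in
`L^{1/(1-θ)}` for every `θ < α/Q`. Young's inequality puts `g` in `L^{r'}` with `1/r' = (q'-1)/r -
θ`. Subcriticality is exactly `1 - 2/q' < α/Q`, so `θ` can be chosen with `1/r' ≤ 1/r - δ` for a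
fixed `δ > 0`. After finitely many rounds Hölder's inequality applies and gives a uniform bound
(`lintegral_kernel_rpow_lt_top`, `bootstrap_bounded`).

Regularity. Now `g^{q'-1}` is a bounded density, and its convolution with the kernel is defined on
the whole group and extends `g`. Horizontal fields pass onto the kernel and lower its degree by one,
so everything reduces to kernels of degree `m + b - Q`, `0 < b ≤ 1`. Differences of such
convolutions are split at distance `2|v|`: nearby each term is integrated separately, far away the
kernel is Taylor expanded (`conv_first_diff`, `conv_second_diff`, `conv_gammaIter`). At `b = 1`, `m
= 0` the odd linear term cancels in the symmetric second difference, which removes the logarithm.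

Comparison. The central field is a commutator of horizontal fields, so one Euclidean derivative
costs at most two horizontal ones (`hasDerivAt_central`, `GammaIter.lipIter_cutoff`). For one
leftover horizontal derivative, two opposite commutator loops of side `s` are compared: they move
the centre by `O(s²)` and bound the central second difference by `O(s^{1+b})`, that is, central
order `(1+b)/2` (`symm_loop`). The coefficients of the fields are unbounded, so the Euclidean
estimates are local and a cutoff makes them global; this is why the set must be bounded. -/

/-- The central direction `∂/∂t`. -/
def central (n : ℕ) : Heis n := coordVec (Sum.inr (Sum.inr ()))

/-- The skew form `2 Im (z · conj z')`. -/
def skew (ξ η : Heis n) : ℝ :=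
  2 * ∑ j : Fin n, (ξ (Sum.inr (Sum.inl j)) * η (Sum.inl j) - ξ (Sum.inl j) * η (Sum.inr (Sum.inl j)))

/-- The squared Euclidean norm of the `z` coordinate. -/
def zsq (ξ : Heis n) : ℝ :=
  ∑ j : Fin n, (ξ (Sum.inl j) ^ 2 + ξ (Sum.inr (Sum.inl j)) ^ 2)

/-! ### The group law in real coordinates -/

@[simp] lemma central_inl (j : Fin n) : central n (Sum.inl j) = 0 := by simp [central, coordVec]
@[simp] lemma central_inr_inl (j : Fin n) : central n (Sum.inr (Sum.inl j)) = 0 := by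
  simp [central, coordVec]
@[simp] lemma central_inr_inr (u : Unit) : central n (Sum.inr (Sum.inr u)) = 1 := by
  simp [central, coordVec]

lemma heis_ext {ξ η : Heis n} (hx : ∀ j, ξ (Sum.inl j) = η (Sum.inl j))
    (hy : ∀ j, ξ (Sum.inr (Sum.inl j)) = η (Sum.inr (Sum.inl j))) (ht : tc ξ = tc η) : ξ = η := by
  ext i
  rcases i with j | j | u
  · exact hx j
  · exact hy j
  · exact ht

lemma mul_eq (ξ η : Heis n) : mul ξ η = ξ + η + skew ξ η • central n := by
  refine heis_ext (fun j => ?_) (fun j => ?_) ?_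
  · simp [mul, point, zc]
  · simp [mul, point, zc]
  · simp only [mul, point, tc, skew, zc, PiLp.add_apply, PiLp.smul_apply, Sum.elim_inr,
      central_inr_inr, smul_eq_mul, mul_one, Complex.im_sum]
    congr 2
    refine Finset.sum_congr rfl fun j _ => ?_
    simp [Complex.mul_im]
    ring

lemma inv_eq (ξ : Heis n) : inv ξ = -ξ := by
  refine heis_ext (fun j => ?_) (fun j => ?_) ?_ <;> simp [inv, point, zc, tc]

lemma skew_add_left (ξ ξ' η : Heis n) : skew (ξ + ξ') η = skew ξ η + skew ξ' η := by
  simp only [skew, PiLp.add_apply, ← mul_add, ← Finset.sum_add_distrib]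
  congr 1; refine Finset.sum_congr rfl fun j _ => ?_; ring

lemma skew_smul_left (c : ℝ) (ξ η : Heis n) : skew (c • ξ) η = c * skew ξ η := by
  simp only [skew, PiLp.smul_apply, Finset.mul_sum, smul_eq_mul]
  refine Finset.sum_congr rfl fun j _ => ?_; ring

lemma skew_swap (ξ η : Heis n) : skew ξ η = - skew η ξ := by
  simp only [skew, ← mul_neg, ← Finset.sum_neg_distrib]
  congr 1; refine Finset.sum_congr rfl fun j _ => ?_; ring

lemma skew_add_right (ξ η η' : Heis n) : skew ξ (η + η') = skew ξ η + skew ξ η' := by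
  rw [skew_swap, skew_add_left, skew_swap η, skew_swap η']; ring

lemma skew_smul_right (c : ℝ) (ξ η : Heis n) : skew ξ (c • η) = c * skew ξ η := by
  rw [skew_swap, skew_smul_left, skew_swap η]; ring

lemma skew_neg_left (ξ η : Heis n) : skew (-ξ) η = - skew ξ η := by
  rw [← neg_one_smul ℝ, skew_smul_left]; ring

lemma skew_neg_right (ξ η : Heis n) : skew ξ (-η) = - skew ξ η := by
  rw [← neg_one_smul ℝ, skew_smul_right]; ring

@[simp] lemma skew_self (ξ : Heis n) : skew ξ ξ = 0 := by
  have := skew_swap ξ ξ; linarith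

@[simp] lemma skew_central_left (η : Heis n) : skew (central n) η = 0 := by simp [skew]

@[simp] lemma skew_central_right (η : Heis n) : skew η (central n) = 0 := by simp [skew]

lemma mul_assoc' (ξ η ζ : Heis n) : mul (mul ξ η) ζ = mul ξ (mul η ζ) := by
  simp only [mul_eq, skew_add_left, skew_add_right, skew_smul_left, skew_smul_right,
    skew_central_left, skew_central_right]
  module

@[simp] lemma mul_zero' (ξ : Heis n) : mul ξ 0 = ξ := by simp [mul_eq, skew]

@[simp] lemma zero_mul' (ξ : Heis n) : mul 0 ξ = ξ := by simp [mul_eq, skew]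

@[simp] lemma mul_neg_self (ξ : Heis n) : mul ξ (-ξ) = 0 := by simp [mul_eq, skew_neg_right]

@[simp] lemma neg_mul_self (ξ : Heis n) : mul (-ξ) ξ = 0 := by simp [mul_eq, skew_neg_left]

lemma neg_mul' (ξ η : Heis n) : -mul ξ η = mul (-η) (-ξ) := by
  simp only [mul_eq, skew_neg_left, skew_neg_right, skew_swap η ξ]
  module

/-! ### The homogeneous norm and its comparison with the Euclidean norm -/

lemma norm_sq_eq (ξ : Heis n) : ‖ξ‖ ^ 2 = zsq ξ + tc ξ ^ 2 := by
  rw [EuclideanSpace.norm_sq_eq]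
  simp [zsq, tc, Fintype.sum_sum_type, Finset.sum_add_distrib, add_assoc]

lemma zsq_nonneg (ξ : Heis n) : 0 ≤ zsq ξ := Finset.sum_nonneg fun j _ => by positivity

lemma zsq_eq_sum (ξ : Heis n) : ∑ j, ‖zc ξ j‖ ^ 2 = zsq ξ := by
  refine Finset.sum_congr rfl fun j _ => ?_
  rw [Complex.sq_norm, Complex.normSq_apply]
  simp [zc]; ring

lemma gauge_eq (ξ : Heis n) : gauge ξ = (zsq ξ ^ 2 + tc ξ ^ 2) ^ (1 / 4 : ℝ) := by
  rw [gauge, zsq_eq_sum]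

lemma gauge_nonneg (ξ : Heis n) : 0 ≤ gauge ξ := by rw [gauge_eq]; positivity

lemma gauge_pow_four (ξ : Heis n) : gauge ξ ^ 4 = zsq ξ ^ 2 + tc ξ ^ 2 := by
  rw [gauge_eq, ← Real.rpow_natCast, ← Real.rpow_mul (by positivity)]
  norm_num

lemma zsq_le (ξ : Heis n) : zsq ξ ≤ gauge ξ ^ 2 := by
  have := gauge_pow_four ξ
  refine abs_le_of_sq_le_sq' ?_ (by positivity) |>.2
  nlinarith [sq_nonneg (tc ξ)]

lemma abs_tc_le (ξ : Heis n) : |tc ξ| ≤ gauge ξ ^ 2 := by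
  have := gauge_pow_four ξ
  refine abs_le_of_sq_le_sq ?_ (by positivity)
  nlinarith [sq_nonneg (zsq ξ)]

lemma gauge_le_of_pow {ξ : Heis n} {r : ℝ} (hr : 0 ≤ r) (h : zsq ξ ^ 2 + tc ξ ^ 2 ≤ r ^ 4) :
    gauge ξ ≤ r := by
  rw [← gauge_pow_four] at h
  exact le_of_pow_le_pow_left₀ (by norm_num) hr h

lemma norm_le_gauge (ξ : Heis n) : ‖ξ‖ ≤ gauge ξ + gauge ξ ^ 2 := by
  have h := norm_sq_eq ξ
  have h1 := zsq_le ξ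
  have h2 := abs_tc_le ξ
  have h0 := gauge_nonneg ξ
  have h3 : tc ξ ^ 2 ≤ (gauge ξ ^ 2) ^ 2 := sq_le_sq' (abs_le.1 h2).1 (abs_le.1 h2).2
  refine le_of_sq_le_sq ?_ (by positivity)
  nlinarith [pow_nonneg h0 3]

lemma zsq_le_norm (ξ : Heis n) : zsq ξ ≤ ‖ξ‖ ^ 2 := by
  rw [norm_sq_eq]; nlinarith [sq_nonneg (tc ξ)]

lemma abs_tc_le_norm (ξ : Heis n) : |tc ξ| ≤ ‖ξ‖ := by
  refine abs_le_of_sq_le_sq ?_ (norm_nonneg _)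
  rw [norm_sq_eq]; linarith [zsq_nonneg ξ]

lemma gauge_le_norm {ξ : Heis n} (h : ‖ξ‖ ≤ 1) : gauge ξ ≤ 2 * ‖ξ‖ ^ (1 / 2 : ℝ) := by
  refine gauge_le_of_pow (by positivity) ?_
  have e : (2 * ‖ξ‖ ^ (1 / 2 : ℝ)) ^ 4 = 16 * ‖ξ‖ ^ 2 := by
    rw [mul_pow, ← Real.rpow_natCast (_ ^ _), ← Real.rpow_mul (norm_nonneg _)]
    norm_num
  rw [e]
  have h1 := norm_sq_eq ξ
  have h2 := zsq_le_norm ξ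
  have h3 := zsq_nonneg ξ
  have : ‖ξ‖ ^ 2 ≤ 1 := by nlinarith [norm_nonneg ξ]
  nlinarith [norm_nonneg ξ]

@[simp] lemma gauge_neg (ξ : Heis n) : gauge (-ξ) = gauge ξ := by
  simp [gauge_eq, zsq, tc]

@[simp] lemma gauge_zero : gauge (0 : Heis n) = 0 := by
  simp [gauge_eq, zsq, tc]

lemma gauge_eq_zero {ξ : Heis n} : gauge ξ = 0 ↔ ξ = 0 := by
  constructor
  · intro h
    have := norm_le_gauge ξ
    rw [h] at this
    simpa using this
  · rintro rfl; simp

lemma gauge_pos {ξ : Heis n} (h : ξ ≠ 0) : 0 < gauge ξ :=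
  (gauge_nonneg ξ).lt_of_ne fun e => h (gauge_eq_zero.1 e.symm)

lemma gauge_sq_eq (ξ : Heis n) : gauge ξ ^ 2 = ‖(⟨zsq ξ, tc ξ⟩ : ℂ)‖ := by
  refine (pow_left_inj₀ (by positivity) (norm_nonneg _) two_ne_zero).1 ?_
  rw [Complex.sq_norm, Complex.normSq_apply, ← pow_mul, gauge_pow_four]
  simp; ring

/-- Cygan's triangle inequality. -/
lemma gauge_mul_le (ξ η : Heis n) : gauge (mul ξ η) ≤ gauge ξ + gauge η := by
  refine le_of_sq_le_sq ?_ (add_nonneg (gauge_nonneg _) (gauge_nonneg _))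
  -- Since `|ξ|²` is the modulus of `|z|² + it`, the group law becomes the complex identity `e`,
  -- with cross term `2w`; Cauchy–Schwarz bounds `w`.
  set w : ℂ := ∑ j, zc ξ j * conj (zc η j)
  have e : (⟨zsq (mul ξ η), tc (mul ξ η)⟩ : ℂ) = ⟨zsq ξ, tc ξ⟩ + ⟨zsq η, tc η⟩ + 2 * w := by
    apply Complex.ext
    · simp only [zsq, mul, point, zc, Complex.add_re, w, Complex.mul_re, Complex.re_sum,
        Complex.im_sum, Complex.re_ofNat, Complex.im_ofNat, zero_mul, sub_zero, Finset.mul_sum,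
        ← Finset.sum_add_distrib]
      refine Finset.sum_congr rfl fun j _ => ?_
      simp; ring
    · simp [mul, point, tc, w, Complex.mul_im]
  have hw : ‖w‖ ≤ gauge ξ * gauge η := by
    have h1 : ‖w‖ ≤ ∑ j, ‖zc ξ j‖ * ‖zc η j‖ := by
      refine (norm_sum_le _ _).trans (Finset.sum_le_sum fun j _ => ?_)
      simp
    have h2 := Finset.sum_mul_sq_le_sq_mul_sq Finset.univ (fun j => ‖zc ξ j‖) (fun j => ‖zc η j‖)
    rw [zsq_eq_sum, zsq_eq_sum] at h2
    refine h1.trans (le_of_sq_le_sq ?_ (mul_nonneg (gauge_nonneg _) (gauge_nonneg _)))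
    rw [mul_pow]
    exact h2.trans (mul_le_mul (zsq_le _) (zsq_le _) (zsq_nonneg _) (by positivity))
  rw [gauge_sq_eq, e]
  calc _ ≤ ‖(⟨zsq ξ, tc ξ⟩ : ℂ)‖ + ‖(⟨zsq η, tc η⟩ : ℂ)‖ + ‖2 * w‖ :=
        (norm_add_le _ _).trans (add_le_add (norm_add_le _ _) le_rfl)
    _ ≤ gauge ξ ^ 2 + gauge η ^ 2 + 2 * (gauge ξ * gauge η) := by
        rw [← gauge_sq_eq, ← gauge_sq_eq, norm_mul]
        simpa using hw
    _ = _ := by ring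

lemma gauge_le_mul_add (ξ η : Heis n) : gauge ξ ≤ gauge (mul ξ η) + gauge η := by
  have := gauge_mul_le (mul ξ η) (-η)
  rwa [mul_assoc', mul_neg_self, mul_zero', gauge_neg] at this

lemma continuous_tc : Continuous (tc : Heis n → ℝ) := by unfold tc; fun_prop

lemma continuous_zsq : Continuous (zsq : Heis n → ℝ) := by unfold zsq; fun_prop

lemma continuous_gauge : Continuous (gauge : Heis n → ℝ) := by
  have : (gauge : Heis n → ℝ) = fun ξ => (zsq ξ ^ 2 + tc ξ ^ 2) ^ (1 / 4 : ℝ) := funext gauge_eq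
  rw [this]
  exact ((continuous_zsq.pow 2).add (continuous_tc.pow 2)).rpow_const fun _ => Or.inr (by norm_num)

lemma continuous_skew : Continuous fun p : Heis n × Heis n => skew p.1 p.2 := by
  unfold skew; fun_prop

lemma continuous_mul : Continuous fun p : Heis n × Heis n => mul p.1 p.2 := by
  simp only [mul_eq]
  exact (continuous_fst.add continuous_snd).add (continuous_skew.smul continuous_const)

lemma norm_central : ‖central n‖ = 1 := by simp [central, coordVec]

lemma abs_skew_le (ξ η : Heis n) : |skew ξ η| ≤ 2 * ‖ξ‖ * ‖η‖ := by
  have h1 : |skew ξ η| ≤ 2 * Real.sqrt (zsq ξ) * Real.sqrt (zsq η) := by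
    rw [skew, abs_mul, abs_two, mul_assoc]
    refine mul_le_mul_of_nonneg_left ?_ zero_le_two
    have h2 := Finset.sum_mul_sq_le_sq_mul_sq Finset.univ (fun j => ‖zc ξ j‖) (fun j => ‖zc η j‖)
    rw [zsq_eq_sum, zsq_eq_sum] at h2
    rw [← Real.sqrt_mul (zsq_nonneg _)]
    refine le_trans ?_ (Real.le_sqrt_of_sq_le h2)
    refine (Finset.abs_sum_le_sum_abs _ _).trans (Finset.sum_le_sum fun j _ => ?_)
    have : ξ (Sum.inr (Sum.inl j)) * η (Sum.inl j) - ξ (Sum.inl j) * η (Sum.inr (Sum.inl j))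
        = (zc ξ j * conj (zc η j)).im := by simp [zc, Complex.mul_im]; ring
    rw [this]
    exact (Complex.abs_im_le_norm _).trans (by simp)
  refine h1.trans ?_
  have h : ∀ ζ : Heis n, Real.sqrt (zsq ζ) ≤ ‖ζ‖ := fun ζ =>
    Real.sqrt_le_iff.2 ⟨norm_nonneg _, zsq_le_norm ζ⟩
  gcongr
  · exact h ξ
  · exact h η

/-! ### Horizontal and central directions, dilations -/

/-- The horizontal coordinate vectors. -/
def hvec (a : Fin n ⊕ Fin n) : Heis n := coordVec (Sum.map id Sum.inl a)

lemma norm_hvec (a : Fin n ⊕ Fin n) : ‖hvec a‖ = 1 := by simp [hvec, coordVec]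

lemma tc_hvec (a : Fin n ⊕ Fin n) : tc (hvec a) = 0 := by
  rcases a with j | j <;> simp [hvec, coordVec, tc]

lemma horiz_eq (a : Fin n ⊕ Fin n) (ξ : Heis n) :
    horiz a ξ = hvec a + skew ξ (hvec a) • central n := by
  rcases a with j | j
  · have : skew ξ (hvec (Sum.inl j)) = 2 * (zc ξ j).im := by
      simp [skew, hvec, coordVec, zc]
    rw [this]; rfl
  · have : skew ξ (hvec (Sum.inr j)) = -(2 * (zc ξ j).re) := by
      simp [skew, hvec, coordVec, zc]
    rw [this, horiz, neg_smul, ← sub_eq_add_neg]; rfl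

lemma add_smul_horiz (a : Fin n ⊕ Fin n) (ξ : Heis n) (s : ℝ) :
    ξ + s • horiz a ξ = mul ξ (s • hvec a) := by
  rw [horiz_eq, mul_eq, skew_smul_right]; module

lemma mul_smul_central (ξ : Heis n) (s : ℝ) : mul ξ (s • central n) = ξ + s • central n := by
  rw [mul_eq, skew_smul_right]; simp

lemma gauge_smul_le (ξ : Heis n) {s : ℝ} (hs : |s| ≤ 1) : gauge (s • ξ) ≤ gauge ξ := by
  refine gauge_le_of_pow (gauge_nonneg _) ?_
  rw [gauge_pow_four]
  have e1 : zsq (s • ξ) = s ^ 2 * zsq ξ := by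
    simp only [zsq, Finset.mul_sum, PiLp.smul_apply, smul_eq_mul]
    exact Finset.sum_congr rfl fun j _ => by ring
  have e2 : tc (s • ξ) = s * tc ξ := by simp [tc]
  have h1 : s ^ 2 ≤ 1 := (sq_le_one_iff_abs_le_one s).2 hs
  rw [e1, e2, mul_pow, mul_pow]
  have h2 : (s ^ 2) ^ 2 ≤ 1 := pow_le_one₀ (sq_nonneg _) h1
  nlinarith [sq_nonneg (zsq ξ), sq_nonneg (tc ξ)]

lemma gauge_smul_hvec (a : Fin n ⊕ Fin n) (s : ℝ) : gauge (s • hvec a) = |s| := by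
  have h1 : zsq (s • hvec a) = s ^ 2 := by
    have h := norm_sq_eq (s • hvec a)
    have : tc (s • hvec a) = 0 := by
      have := tc_hvec a
      simp only [tc] at this ⊢; simp [this]
    rw [this, norm_smul, norm_hvec] at h
    simpa using h.symm
  have h2 : tc (s • hvec a) = 0 := by
    have := tc_hvec a
    simp only [tc] at this ⊢; simp [this]
  refine (pow_left_inj₀ (gauge_nonneg _) (abs_nonneg _) four_ne_zero).1 ?_
  rw [gauge_pow_four, h1, h2, ← abs_pow, abs_of_nonneg (by positivity)]; ring

lemma gauge_smul_central (s : ℝ) : gauge (s • central n) = |s| ^ (1 / 2 : ℝ) := by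
  refine (pow_left_inj₀ (gauge_nonneg _) (by positivity) four_ne_zero).1 ?_
  rw [gauge_pow_four, ← Real.rpow_natCast (_ ^ _), ← Real.rpow_mul (abs_nonneg _)]
  norm_num
  simp [zsq, tc]

/-- The automorphic dilation `(z, t) ↦ (r z, r² t)`. -/
def dil (r : ℝ) (ξ : Heis n) : Heis n := r • ξ + ((r ^ 2 - r) * tc ξ) • central n

@[simp] lemma tc_dil (r : ℝ) (ξ : Heis n) : tc (dil r ξ) = r ^ 2 * tc ξ := by
  simp [dil, tc]; ring

@[simp] lemma zsq_dil (r : ℝ) (ξ : Heis n) : zsq (dil r ξ) = r ^ 2 * zsq ξ := by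
  simp only [dil, zsq, Finset.mul_sum, PiLp.add_apply, PiLp.smul_apply, central_inl,
    central_inr_inl, smul_eq_mul, mul_zero, add_zero]
  exact Finset.sum_congr rfl fun j _ => by ring

lemma tc_add (ξ η : Heis n) : tc (ξ + η) = tc ξ + tc η := rfl
lemma tc_smul (c : ℝ) (ξ : Heis n) : tc (c • ξ) = c * tc ξ := rfl
@[simp] lemma tc_central : tc (central n) = 1 := by simp [tc]

lemma dil_mul (r : ℝ) (ξ η : Heis n) : dil r (mul ξ η) = mul (dil r ξ) (dil r η) := by
  simp only [dil, mul_eq, tc_add, tc_smul, skew_add_left, skew_add_right, skew_smul_left,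
    skew_smul_right, skew_central_left, skew_central_right, tc_central]
  module

lemma dil_dil (r s : ℝ) (ξ : Heis n) : dil r (dil s ξ) = dil (r * s) ξ := by
  simp only [dil, tc_add, tc_smul, tc_central]
  module

@[simp] lemma dil_one (ξ : Heis n) : dil 1 ξ = ξ := by simp [dil]

lemma dil_smul (r s : ℝ) (ξ : Heis n) : dil r (s • ξ) = s • dil r ξ := by
  simp only [dil, tc_smul]; module

lemma dil_hvec (r : ℝ) (a : Fin n ⊕ Fin n) : dil r (hvec a) = r • hvec a := by
  simp [dil, tc_hvec]

lemma gauge_dil {r : ℝ} (hr : 0 ≤ r) (ξ : Heis n) : gauge (dil r ξ) = r * gauge ξ := by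
  refine (pow_left_inj₀ (gauge_nonneg _) (mul_nonneg hr (gauge_nonneg _)) four_ne_zero).1 ?_
  rw [gauge_pow_four, mul_pow, gauge_pow_four, zsq_dil, tc_dil]; ring

lemma dil_ne_zero {r : ℝ} (hr : 0 < r) {ξ : Heis n} (h : ξ ≠ 0) : dil r ξ ≠ 0 := fun e => by
  have := gauge_dil hr.le ξ
  rw [e, gauge_zero] at this
  exact (mul_pos hr (gauge_pos h)).ne this

/-! ### From horizontal derivatives to central regularity -/

/-- For exponents below one, symmetric second differences control first differences. -/
lemma holder_of_symm {γ : ℝ} (hγ : 0 < γ) (hγ1 : γ < 1) {M C : ℝ} (hM : 0 ≤ M) (hC : 0 ≤ C)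
    {φ : ℝ → ℝ} (hb : ∀ x, |φ x| ≤ M)
    (h : ∀ x s, |s| ≤ 1 → |φ (x + s) + φ (x - s) - 2 * φ x| ≤ C * |s| ^ γ) (x s : ℝ) :
    |φ (x + s) - φ x| ≤ (2 * M + C / (2 - 2 ^ γ)) * |s| ^ γ := by
  have h2 : (2 : ℝ) ^ γ < 2 := by
    simpa using Real.rpow_lt_rpow_of_exponent_lt one_lt_two hγ1
  have h3 : 0 < 2 - (2 : ℝ) ^ γ := by linarith
  -- `K` satisfies `2^γ K + C ≤ 2K`, so the estimate at `2s` reproduces itself at `s`; the summand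
  -- `2M` covers `|s| ≥ 1`.
  set K := 2 * M + C / (2 - 2 ^ γ) with hK
  have hK0 : 0 ≤ K := by positivity
  have hKC : C ≤ K * (2 - 2 ^ γ) := by
    have : K * (2 - 2 ^ γ) = 2 * M * (2 - 2 ^ γ) + C := by rw [hK]; field_simp
    rw [this]; have : 0 ≤ 2 * M * (2 - 2 ^ γ) := by positivity
    linarith
  have hbig : ∀ s, 1 ≤ |s| → |φ (x + s) - φ x| ≤ K * |s| ^ γ := fun s hs => by
    have h1 : 1 ≤ |s| ^ γ := Real.one_le_rpow hs hγ.le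
    have h4 : |φ (x + s) - φ x| ≤ 2 * M := by
      have := abs_sub (φ (x + s)) (φ x); linarith [hb (x + s), hb x]
    have h5 : 2 * M ≤ K := by rw [hK]; have : 0 ≤ C / (2 - 2 ^ γ) := by positivity
                              linarith
    nlinarith
  have key : ∀ N : ℕ, ∀ s, (1 / 2 : ℝ) ^ N ≤ |s| → |φ (x + s) - φ x| ≤ K * |s| ^ γ := by
    intro N
    induction N with
    | zero => intro s hs; exact hbig s (by simpa using hs)
    | succ N ih =>
      intro s hs
      rcases le_or_gt 1 |s| with h1 | h1
      · exact hbig s h1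
      have e1 := ih (2 * s) (by rw [abs_mul, abs_two]; rw [pow_succ] at hs; linarith)
      have e2 := h (x + s) s h1.le
      rw [abs_mul, abs_two, Real.mul_rpow zero_le_two (abs_nonneg _)] at e1
      -- The second difference is centred at `x + s`, so its outer points are `x` and `x + 2s`.
      have e3 : 2 * (φ (x + s) - φ x) =
          (φ (x + 2 * s) - φ x) - (φ (x + s + s) + φ (x + s - s) - 2 * φ (x + s)) := by
        rw [add_sub_cancel_right, add_assoc, ← two_mul s]; ring
      have e4 : 2 * |φ (x + s) - φ x| ≤ K * (2 ^ γ * |s| ^ γ) + C * |s| ^ γ := by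
        rw [← abs_two, ← abs_mul, e3, abs_two]
        exact (abs_sub _ _).trans (add_le_add e1 e2)
      have : 0 ≤ |s| ^ γ := by positivity
      nlinarith
  rcases eq_or_ne s 0 with rfl | hs
  · simp [hγ.ne']
  · obtain ⟨N, hN⟩ := exists_pow_lt_of_lt_one (abs_pos.2 hs) (by norm_num : (1 / 2 : ℝ) < 1)
    exact key N s hN.le

lemma mul_add_smul (ξ v : Heis n) (s t : ℝ) :
    mul ξ ((s + t) • v) = mul (mul ξ (s • v)) (t • v) := by
  rw [mul_assoc', mul_eq (s • v), skew_smul_left, skew_smul_right, skew_self]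
  simp [add_smul]

/-- Bounded functions whose symmetric second differences are `O(|η|^b)`. -/
def SymmHolder (b : ℝ) (F : Heis n → ℝ) : Prop :=
  (∃ M : ℝ, ∀ ξ, |F ξ| ≤ M) ∧
  ∃ C : ℝ, ∀ ξ η, |F (mul ξ η) + F (mul ξ (-η)) - 2 * F ξ| ≤ C * gauge η ^ b

/-- This treats `b < 1` and `b = 1` uniformly: a symmetric second difference is a sum of two first
differences. -/
lemma GammaBase.symmHolder {b : ℝ} (hb : b ≤ 1) {F : Heis n → ℝ} (h : GammaBase b F) :
    SymmHolder b F := by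
  refine ⟨h.1.2, ?_⟩
  rcases hb.lt_or_eq with h1 | rfl
  · obtain ⟨C, hC⟩ := h.2.1 h1
    refine ⟨2 * C, fun ξ η => ?_⟩
    have e1 := hC ξ η
    have e2 := hC ξ (-η)
    rw [gauge_neg] at e2
    have : F (mul ξ η) + F (mul ξ (-η)) - 2 * F ξ
      = (F (mul ξ η) - F ξ) + (F (mul ξ (-η)) - F ξ) := by ring
    rw [this]
    exact (abs_add_le _ _).trans (by linarith)
  · obtain ⟨C, hC⟩ := h.2.2 rfl
    refine ⟨C, fun ξ η => ?_⟩
    simpa [inv_eq] using hC ξ η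

/-- In terms of the Euclidean norm the exponent halves, and `b/2 < 1` even when `b = 1`. Hence
`holder_of_symm`, applied along the one-parameter subgroup through `η`, recovers first differences
from second ones. -/
lemma SymmHolder.first_diff {b : ℝ} (hb0 : 0 < b) (hb : b ≤ 1) {F : Heis n → ℝ}
    (h : SymmHolder b F) :
    ∃ C : ℝ, 0 ≤ C ∧ ∀ ξ η, |F (mul ξ η) - F ξ| ≤ C * ‖η‖ ^ (b / 2) := by
  obtain ⟨⟨M, hM⟩, C, hC⟩ := h
  have hM0 : 0 ≤ M := (abs_nonneg _).trans (hM 0)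
  have h2 : (2 : ℝ) ^ (b / 2) < 2 := by
    simpa using Real.rpow_lt_rpow_of_exponent_lt one_lt_two (by linarith : b / 2 < 1)
  have h3 : 0 < 2 - (2 : ℝ) ^ (b / 2) := by linarith
  refine ⟨2 * M + (|C| * 2 ^ b) / (2 - 2 ^ (b / 2)), by positivity, fun ξ η => ?_⟩
  rcases eq_or_ne η 0 with rfl | hη
  · simp [hb0.ne']
  have hn : ‖η‖ ≠ 0 := norm_ne_zero_iff.2 hη
  have hv : ‖(‖η‖⁻¹ • η)‖ = 1 := by rw [norm_smul, norm_inv, norm_norm, inv_mul_cancel₀ hn]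
  set v := ‖η‖⁻¹ • η with hvd
  have := holder_of_symm (γ := b / 2) (by linarith) (by linarith) hM0
    (C := |C| * 2 ^ b) (by positivity) (φ := fun u => F (mul ξ (u • v))) (fun x => hM _)
    (fun x s hs => ?_) 0 ‖η‖
  · simpa [hvd, smul_smul, hn] using this
  · have e := hC (mul ξ (x • v)) (s • v)
    simp only [sub_eq_add_neg x s, mul_add_smul, neg_smul]
    refine e.trans ?_
    have hs1 : ‖s • v‖ = |s| := by rw [norm_smul, hv, mul_one, Real.norm_eq_abs]
    have e2 := gauge_le_norm (ξ := s • v) (by rw [hs1]; exact hs)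
    rw [hs1] at e2
    calc C * gauge (s • v) ^ b ≤ |C| * (2 * |s| ^ (1 / 2 : ℝ)) ^ b := by
          gcongr
          · exact Real.rpow_nonneg (gauge_nonneg _) _
          · exact le_abs_self C
          · exact gauge_nonneg _
      _ = _ := by
          rw [Real.mul_rpow zero_le_two (by positivity), ← Real.rpow_mul (abs_nonneg _)]
          rw [show 1 / 2 * b = b / 2 by ring]; ring

/-- The derivative along a horizontal one-parameter subgroup. -/
lemma hasDerivAt_horiz {a : Fin n ⊕ Fin n} {F : Heis n → ℝ}
    (h : FieldDifferentiable (horiz a) F) (p : Heis n) (s : ℝ) :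
    HasDerivAt (fun u : ℝ => F (mul p (u • hvec a)))
      (fieldDeriv (horiz a) F (mul p (s • hvec a))) s := by
  have h1 : HasDerivAt (fun t : ℝ => F (mul p (s • hvec a) + t • horiz a (mul p (s • hvec a))))
    (fieldDeriv (horiz a) F (mul p (s • hvec a))) 0 := (h (mul p (s • hvec a))).hasDerivAt
  simp only [add_smul_horiz, ← mul_add_smul] at h1
  have h2 : HasDerivAt (fun u : ℝ => u - s) 1 s := (hasDerivAt_id s).sub_const s
  have h3 : HasDerivAt (fun t : ℝ => F (mul p ((s + t) • hvec a)))
    (fieldDeriv (horiz a) F (mul p (s • hvec a))) (s - s) := by rwa [sub_self]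
  have h4 := HasDerivAt.comp (h₂ := fun t : ℝ => F (mul p ((s + t) • hvec a)))
    (h := fun u : ℝ => u - s) s h3 h2
  simpa [Function.comp_def] using h4

lemma hasDerivAt_horiz_mul {a : Fin n ⊕ Fin n} {F : Heis n → ℝ}
    (h : FieldDifferentiable (horiz a) F) (p : Heis n) (c u : ℝ) :
    HasDerivAt (fun u : ℝ => F (mul p ((c * u) • hvec a)))
      (c * fieldDeriv (horiz a) F (mul p ((c * u) • hvec a))) u := by
  have := (hasDerivAt_horiz h p (c * u)).comp u ((hasDerivAt_id u).const_mul c)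
  simpa [mul_comm, Function.comp_def] using this

lemma abs_sub_le_of_deriv {m m' : ℝ → ℝ} {K : ℝ} (h : ∀ u, HasDerivAt m (m' u) u)
    (hK : ∀ u ∈ Icc (0 : ℝ) 1, |m' u| ≤ K) : |m 1 - m 0| ≤ K := by
  have := Convex.norm_image_sub_le_of_norm_hasDerivWithin_le (f := m) (f' := m') (C := K)
    (s := Icc (0 : ℝ) 1) (x := 0) (y := 1) (fun x _ => (h x).hasDerivWithinAt)
    (fun x hx => by simpa using hK x hx) (convex_Icc 0 1) (by simp) (by simp)
  simpa using this

/-- Points of the subgroup generated by two horizontal directions. -/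
def pt (a b : Fin n ⊕ Fin n) (p q r : ℝ) : Heis n := p • hvec a + q • hvec b + r • central n

lemma pt_mul_left (a b : Fin n ⊕ Fin n) (p q r u : ℝ) :
    mul (pt a b p q r) (u • hvec a) =
      pt a b (p + u) q (r - skew (hvec a) (hvec b) * (q * u)) := by
  simp only [pt, mul_eq, skew_add_left, skew_smul_left, skew_smul_right, skew_central_left,
    skew_self, skew_swap (hvec b) (hvec a)]
  module

lemma pt_mul_right (a b : Fin n ⊕ Fin n) (p q r u : ℝ) :
    mul (pt a b p q r) (u • hvec b) =
      pt a b p (q + u) (r + skew (hvec a) (hvec b) * (p * u)) := by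
  simp only [pt, mul_eq, skew_add_left, skew_smul_left, skew_smul_right, skew_central_left,
    skew_self]
  module

lemma pt_zero (a b : Fin n ⊕ Fin n) : pt a b 0 0 0 = 0 := by simp [pt]

lemma abs_skew_hvec_le (a b : Fin n ⊕ Fin n) : |skew (hvec a) (hvec b)| ≤ 2 := by
  simpa [norm_hvec] using abs_skew_le (hvec a) (hvec b)

/-- The point is a product of two horizontal factors and a central one. Reordering changes the
central coordinate by at most `2s²`, and the three factors contribute `s`, `s` and `3s`. -/
lemma gauge_pt_le (a b : Fin n ⊕ Fin n) {p q r s : ℝ} (hs : 0 ≤ s) (hp : |p| ≤ s) (hq : |q| ≤ s)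
    (hr : |r| ≤ 6 * s ^ 2) : gauge (pt a b p q r) ≤ 5 * s := by
  set κ := skew (hvec a) (hvec b) with hκ
  have e : pt a b p q r = mul (mul (p • hvec a) (q • hvec b)) ((r - κ * (p * q)) • central n) := by
    rw [mul_smul_central, mul_eq, skew_smul_left, skew_smul_right, ← hκ, pt]; module
  have h1 : |r - κ * (p * q)| ≤ 9 * s ^ 2 := by
    have : |κ * (p * q)| ≤ 2 * (s * s) := by
      rw [abs_mul, abs_mul]
      gcongr
      exact abs_skew_hvec_le a b
    have := abs_sub r (κ * (p * q)); nlinarith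
  have h2 : |r - κ * (p * q)| ^ (1 / 2 : ℝ) ≤ 3 * s := by
    rw [← Real.sqrt_eq_rpow]
    refine Real.sqrt_le_iff.2 ⟨by positivity, h1.trans (by nlinarith)⟩
  rw [e]
  refine (gauge_mul_le _ _).trans ?_
  have := gauge_mul_le (p • hvec a) (q • hvec b)
  rw [gauge_smul_hvec, gauge_smul_hvec] at this
  rw [gauge_smul_central]
  linarith

/-- The two central coordinates need not be opposite: correcting them is a central shift of size at
most `12s²`, which costs only `s^b` by `first_diff`. -/
lemma SymmHolder.pt_bound {b : ℝ} (hb0 : 0 < b) (hb : b ≤ 1) {G : Heis n → ℝ}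
    (h : SymmHolder b G) (i j : Fin n ⊕ Fin n) :
    ∃ C : ℝ, 0 ≤ C ∧ ∀ ξ p q r r' s, 0 ≤ s → |p| ≤ s → |q| ≤ s → |r| ≤ 6 * s ^ 2 →
      |r'| ≤ 6 * s ^ 2 →
      |G (mul ξ (pt i j p q r)) + G (mul ξ (pt i j (-p) (-q) r')) - 2 * G ξ| ≤ C * s ^ b := by
  obtain ⟨C₁, hC₁, H₁⟩ := h.first_diff hb0 hb
  obtain ⟨C₂, H₂⟩ := h.2
  refine ⟨|C₂| * 5 ^ b + C₁ * 12 ^ (b / 2), by positivity, ?_⟩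
  intro ξ p q r r' s hs hp hq hr hr'
  have e : mul ξ (pt i j (-p) (-q) r') =
      mul (mul ξ (-pt i j p q r)) ((r + r') • central n) := by
    rw [mul_assoc', mul_smul_central]; congr 1; simp only [pt]; module
  have e1 := H₁ (mul ξ (-pt i j p q r)) ((r + r') • central n)
  have e2 := H₂ ξ (pt i j p q r)
  rw [← e, norm_smul, norm_central, mul_one, Real.norm_eq_abs] at e1
  have e3 : |r + r'| ^ (b / 2) ≤ 12 ^ (b / 2) * s ^ b := by
    calc |r + r'| ^ (b / 2) ≤ (12 * s ^ 2) ^ (b / 2) := by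
          gcongr; exact (abs_add_le _ _).trans (by linarith)
      _ = _ := by
          rw [Real.mul_rpow (by norm_num) (by positivity), ← Real.rpow_natCast, ← Real.rpow_mul hs]
          congr 2; push_cast; ring
  have e4 : gauge (pt i j p q r) ^ b ≤ 5 ^ b * s ^ b := by
    rw [← Real.mul_rpow (by norm_num) hs]
    exact Real.rpow_le_rpow (gauge_nonneg _) (gauge_pt_le i j hs hp hq hr) hb0.le
  have e5 : G (mul ξ (pt i j p q r)) + G (mul ξ (pt i j (-p) (-q) r')) - 2 * G ξ =
    (G (mul ξ (pt i j p q r)) + G (mul ξ (-pt i j p q r)) - 2 * G ξ) +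
    (G (mul ξ (pt i j (-p) (-q) r')) - G (mul ξ (-pt i j p q r))) := by ring
  rw [e5]
  refine (abs_add_le _ _).trans ?_
  have e6 : C₂ * gauge (pt i j p q r) ^ b ≤ |C₂| * (5 ^ b * s ^ b) :=
    mul_le_mul (le_abs_self _) e4 (Real.rpow_nonneg (gauge_nonneg _) _) (abs_nonneg _)
  have e7 := mul_le_mul_of_nonneg_left e3 hC₁
  calc _ ≤ |C₂| * (5 ^ b * s ^ b) + C₁ * (12 ^ (b / 2) * s ^ b) := by linarith
    _ = _ := by ring

/-- The two opposite commutator loops through `ξ`, compared side by side. -/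
lemma symm_loop {b : ℝ} (hb0 : 0 < b) (hb : b ≤ 1) {F : Heis n → ℝ} {i j : Fin n ⊕ Fin n}
    (hi : FieldDifferentiable (horiz i) F) (hj : FieldDifferentiable (horiz j) F)
    (hGi : SymmHolder b (fieldDeriv (horiz i) F)) (hGj : SymmHolder b (fieldDeriv (horiz j) F)) :
    ∃ C : ℝ, 0 ≤ C ∧ ∀ ξ s, 0 ≤ s →
      |F (ξ + (2 * skew (hvec i) (hvec j) * s ^ 2) • central n) +
        F (ξ - (2 * skew (hvec i) (hvec j) * s ^ 2) • central n) - 2 * F ξ| ≤ C * s ^ (1 + b) := by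
  obtain ⟨C₁, hC₁, H₁⟩ := hGi.pt_bound hb0 hb i j
  obtain ⟨C₂, hC₂, H₂⟩ := hGj.pt_bound hb0 hb i j
  refine ⟨2 * C₁ + 2 * C₂, by positivity, fun ξ s hs => ?_⟩
  have hκ := abs_skew_hvec_le i j
  set κ := skew (hvec i) (hvec j) with hκd
  set G := fieldDeriv (horiz i) F with hG
  set H := fieldDeriv (horiz j) F with hH
  have DX : ∀ p q r c u, HasDerivAt
      (fun u : ℝ => F (mul ξ (pt i j (p + c * u) q (r - κ * (q * (c * u))))))
      (c * G (mul ξ (pt i j (p + c * u) q (r - κ * (q * (c * u)))))) u := fun p q r c u => by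
    have := hasDerivAt_horiz_mul hi (mul ξ (pt i j p q r)) c u
    simpa only [mul_assoc', pt_mul_left] using this
  have DY : ∀ p q r c u, HasDerivAt
      (fun u : ℝ => F (mul ξ (pt i j p (q + c * u) (r + κ * (p * (c * u))))))
      (c * H (mul ξ (pt i j p (q + c * u) (r + κ * (p * (c * u)))))) u := fun p q r c u => by
    have := hasDerivAt_horiz_mul hj (mul ξ (pt i j p q r)) c u
    simpa only [mul_assoc', pt_mul_right] using this
  -- The first four legs run from `ξ` to `ξ + 2κs²T`, with `T` the central direction; the four
  -- subtracted ones run from `ξ - 2κs²T` back to `ξ`. Parametrised by the same `u`, corresponding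
  -- legs sit at opposite horizontal coordinates, so their derivatives pair into symmetric second
  -- differences of `G` and `H`.
  have D := fun u => ((((((((DX 0 0 0 s u).add (DX s s (κ * s ^ 2) (-s) u)).add
    (DY s 0 0 s u)).add (DY 0 s (2 * κ * s ^ 2) (-s) u)).sub
    (DX 0 0 (-(2 * κ * s ^ 2)) (-s) u)).sub (DX (-s) (-s) (-(κ * s ^ 2)) s u)).sub
    (DY 0 (-s) 0 s u)).sub (DY (-s) 0 (-(2 * κ * s ^ 2)) (-s) u))
  have key := abs_sub_le_of_deriv (K := (2 * C₁ + 2 * C₂) * s ^ (1 + b)) D ?_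
  · refine le_of_eq_of_le ?_ key
    congr 1
    have e1 : ξ + (2 * κ * s ^ 2) • central n = mul ξ (pt i j 0 0 (2 * κ * s ^ 2)) := by
      rw [pt, zero_smul, zero_smul, zero_add, zero_add, mul_smul_central]
    have e2 : ξ - (2 * κ * s ^ 2) • central n = mul ξ (pt i j 0 0 (-(2 * κ * s ^ 2))) := by
      rw [pt, zero_smul, zero_smul, zero_add, zero_add, mul_smul_central, neg_smul, sub_eq_add_neg]
    have e3 : F ξ = F (mul ξ (pt i j 0 0 0)) := by rw [pt_zero, mul_zero']
    rw [e1, e2, e3]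
    simp only [Pi.add_apply, Pi.sub_apply]
    ring_nf
  · intro u hu
    have hu1 : |u * s| ≤ s := by
      rw [abs_mul, abs_of_nonneg hu.1, abs_of_nonneg hs]; nlinarith [hu.2]
    have hu2 : |s - u * s| ≤ s := by
      rw [abs_of_nonneg (by nlinarith [hu.2])]; nlinarith [hu.1]
    have hs' : |s| ≤ s := (abs_of_nonneg hs).le
    have h0 : |(0 : ℝ)| ≤ s := by simpa using hs
    have hr : ∀ c : ℝ, |c| ≤ 3 → |κ * c * s ^ 2| ≤ 6 * s ^ 2 := fun c hc => by
      rw [abs_mul, abs_mul, abs_of_nonneg (sq_nonneg s)]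
      have : |κ| * |c| ≤ 2 * 3 := by gcongr
      nlinarith [sq_nonneg s]
    have hu3 : |1 + u| ≤ 3 := by rw [abs_le]; constructor <;> linarith [hu.1, hu.2]
    have hu4 : |-(1 + u)| ≤ 3 := by rw [abs_neg]; exact hu3
    have hu5 : |u| ≤ 3 := by rw [abs_le]; constructor <;> linarith [hu.1, hu.2]
    have hu6 : |-(2 - u)| ≤ 3 := by rw [abs_le]; constructor <;> linarith [hu.1, hu.2]
    have hu7 : |(2 : ℝ)| ≤ 3 := by norm_num
    have hu8 : |(-2 : ℝ)| ≤ 3 := by norm_num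
    have hu9 : |(0 : ℝ)| ≤ 3 := by norm_num
    have b1 := H₁ ξ (u * s) 0 (κ * 0 * s ^ 2) (κ * (-2) * s ^ 2) s hs hu1 h0 (hr 0 hu9) (hr _ hu8)
    have b2 := H₁ ξ (s - u * s) s (κ * (1 + u) * s ^ 2) (κ * (-(1 - u)) * s ^ 2) s hs hu2 hs'
      (hr _ hu3) (hr _ (by rw [abs_le]; constructor <;> linarith [hu.1, hu.2]))
    have b3 := H₂ ξ s (u * s) (κ * u * s ^ 2) (κ * (-(2 - u)) * s ^ 2) s hs hs' hu1 (hr _ hu5)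
      (hr _ hu6)
    have b4 := H₂ ξ 0 (s - u * s) (κ * 2 * s ^ 2) (κ * 0 * s ^ 2) s hs h0 hu2 (hr _ hu7) (hr _ hu9)
    have e : s ^ (1 + b) = s * s ^ b := Real.rpow_one_add' hs (by linarith)
    rw [e]
    -- In `A - B + A' - B'` the terms `2 * G ξ` and `2 * H ξ` cancel, so subtracting them in each
    -- symmetric difference is free.
    set A := G (mul ξ (pt i j (u * s) 0 (κ * 0 * s ^ 2))) +
      G (mul ξ (pt i j (-(u * s)) (-0) (κ * (-2) * s ^ 2))) - 2 * G ξ with hA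
    set B := G (mul ξ (pt i j (s - u * s) s (κ * (1 + u) * s ^ 2))) +
      G (mul ξ (pt i j (-(s - u * s)) (-s) (κ * (-(1 - u)) * s ^ 2))) - 2 * G ξ with hB
    set A' := H (mul ξ (pt i j s (u * s) (κ * u * s ^ 2))) +
      H (mul ξ (pt i j (-s) (-(u * s)) (κ * (-(2 - u)) * s ^ 2))) - 2 * H ξ with hA'
    set B' := H (mul ξ (pt i j 0 (s - u * s) (κ * 2 * s ^ 2))) +
      H (mul ξ (pt i j (-0) (-(s - u * s)) (κ * 0 * s ^ 2))) - 2 * H ξ with hB'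
    have hs2 := abs_of_nonneg hs
    have : |s * (A - B + A' - B')| ≤ s * ((2 * C₁ + 2 * C₂) * s ^ b) := by
      rw [abs_mul, hs2]
      refine mul_le_mul_of_nonneg_left ?_ hs
      have t1 := abs_sub (A - B + A') B'
      have t2 := abs_add_le (A - B) A'
      have t3 := abs_sub A B
      linarith
    refine le_trans (le_of_eq ?_) (this.trans (le_of_eq (by ring)))
    congr 1
    rw [hA, hB, hA', hB']
    ring_nf

lemma skew_hvec (j : Fin n) :
    skew (hvec (Sum.inl j)) (hvec (Sum.inr j) : Heis n) = -2 := by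
  simp [skew, hvec, coordVec]

lemma GammaIter.base {b : ℝ} {k : ℕ} {F : Heis n → ℝ} (h : GammaIter b k F) : GammaBase b F := by
  cases k with
  | zero => exact h
  | succ k => exact h.1

/-- A loop in the directions `X_j, Y_j` of side `√|τ|/2` moves the centre by exactly `|τ|`, up to a
sign that does not matter because the second difference is even in `τ`. -/
lemma central_symm_diff (hn : 1 ≤ n) {b : ℝ} (hb0 : 0 < b) (hb : b ≤ 1) {F : Heis n → ℝ}
    (hF : GammaIter b 1 F) :
    ∃ C : ℝ, 0 ≤ C ∧ ∀ ξ τ, |F (ξ + τ • central n) + F (ξ - τ • central n) - 2 * F ξ|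
      ≤ C * |τ| ^ ((1 + b) / 2) := by
  let j : Fin n := ⟨0, hn⟩
  obtain ⟨C, hC, H⟩ := symm_loop hb0 hb (hF.2 (Sum.inl j)).1 (hF.2 (Sum.inr j)).1
    ((hF.2 (Sum.inl j)).2.symmHolder hb) ((hF.2 (Sum.inr j)).2.symmHolder hb)
  refine ⟨C, hC, fun ξ τ => ?_⟩
  have h1 := H ξ (Real.sqrt |τ| / 2) (by positivity)
  have e : 2 * skew (hvec (Sum.inl j)) (hvec (Sum.inr j) : Heis n) * (Real.sqrt |τ| / 2) ^ 2 = -|τ| := by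
    rw [skew_hvec, div_pow, Real.sq_sqrt (abs_nonneg _)]; ring
  rw [e] at h1
  have h2 : |F (ξ + τ • central n) + F (ξ - τ • central n) - 2 * F ξ| =
      |F (ξ + (-|τ|) • central n) + F (ξ - (-|τ|) • central n) - 2 * F ξ| := by
    rcases le_total 0 τ with h | h
    · rw [abs_of_nonneg h, neg_smul, sub_neg_eq_add, ← sub_eq_add_neg, add_comm (F _) (F _)]
    · rw [abs_of_nonpos h, neg_neg]
  rw [h2]
  refine h1.trans (mul_le_mul_of_nonneg_left ?_ hC)
  calc (Real.sqrt |τ| / 2) ^ (1 + b) ≤ (Real.sqrt |τ|) ^ (1 + b) := by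
        gcongr; exact half_le_self (Real.sqrt_nonneg _)
    _ = _ := by
        rw [Real.sqrt_eq_rpow, ← Real.rpow_mul (abs_nonneg _)]; congr 1; ring

/-- For `b < 1` the exponent `(1+b)/2` is below one, so second differences suffice. -/
lemma central_first_diff (hn : 1 ≤ n) {b : ℝ} (hb0 : 0 < b) (hb : b < 1) {F : Heis n → ℝ}
    (hF : GammaIter b 1 F) :
    ∃ C : ℝ, 0 ≤ C ∧ ∀ ξ τ, |F (ξ + τ • central n) - F ξ| ≤ C * |τ| ^ ((1 + b) / 2) := by
  obtain ⟨C, hC, H⟩ := central_symm_diff hn hb0 hb.le hF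
  obtain ⟨M, hM⟩ := hF.1.1.2
  have hM0 : 0 ≤ M := (abs_nonneg _).trans (hM 0)
  have h2 : (2 : ℝ) ^ ((1 + b) / 2) < 2 := by
    simpa using Real.rpow_lt_rpow_of_exponent_lt one_lt_two (by linarith : (1 + b) / 2 < 1)
  have h3 : 0 < 2 - (2 : ℝ) ^ ((1 + b) / 2) := by linarith
  refine ⟨2 * M + C / (2 - 2 ^ ((1 + b) / 2)), by positivity, fun ξ τ => ?_⟩
  have := holder_of_symm (γ := (1 + b) / 2) (by linarith) (by linarith) hM0 hC
    (φ := fun u => F (ξ + u • central n)) (fun _ => hM _) (fun x s _ => ?_) 0 τ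
  · simpa using this
  · have := H (ξ + x • central n) s
    simp only [add_smul, sub_smul]
    rwa [add_assoc ξ, add_sub_assoc ξ] at this

/-- The increment is made one coordinate at a time, each step being Lipschitz by the mean value
theorem. Reordering the factors produces a central error quadratic in the increment, so Hölder
exponent `1/2` in the centre is exactly enough. -/
lemma horizontal_lipschitz {F : Heis n → ℝ} (hd : ∀ a, FieldDifferentiable (horiz a) F)
    (hM : ∀ a, ∃ M : ℝ, ∀ ξ, |fieldDeriv (horiz a) F ξ| ≤ M)
    (hc : ∃ C : ℝ, 0 ≤ C ∧ ∀ ξ τ, |F (ξ + τ • central n) - F ξ| ≤ C * |τ| ^ (1 / 2 : ℝ)) :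
    ∃ C : ℝ, 0 ≤ C ∧ ∀ ξ v, tc v = 0 → |F (mul ξ v) - F ξ| ≤ C * ‖v‖ := by
  choose M hM using hM
  obtain ⟨C₀, hC₀, H₀⟩ := hc
  have hM0 : ∀ a, 0 ≤ M a := fun a => (abs_nonneg _).trans (hM a 0)
  have step : ∀ a ξ s, |F (mul ξ (s • hvec a)) - F ξ| ≤ M a * |s| := fun a ξ s => by
    have := abs_sub_le_of_deriv (K := |s| * M a) (fun u => hasDerivAt_horiz_mul (hd a) ξ s u)
      (fun u _ => by rw [abs_mul]; gcongr; exact hM a _)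
    simpa [mul_comm] using this
  have key : ∀ S : Finset (Fin n ⊕ Fin n), ∃ C : ℝ, 0 ≤ C ∧ ∀ ξ (w : Fin n ⊕ Fin n → ℝ) (N : ℝ),
      (∀ a, |w a| ≤ N) → |F (mul ξ (∑ a ∈ S, w a • hvec a)) - F ξ| ≤ C * N := by
    intro S
    induction S using Finset.induction_on with
    | empty => exact ⟨0, le_rfl, fun ξ w N _ => by simp⟩
    | insert a S ha ih =>
      obtain ⟨C, hC, H⟩ := ih
      refine ⟨C + M a + C₀ * (2 * S.card) ^ (1 / 2 : ℝ), by have := hM0 a; positivity, ?_⟩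
      intro ξ w N hN
      have hN0 : 0 ≤ N := (abs_nonneg _).trans (hN a)
      rw [Finset.sum_insert ha]
      set v := ∑ a ∈ S, w a • hvec a with hv
      have hvn : ‖v‖ ≤ S.card * N := by
        refine (norm_sum_le _ _).trans ?_
        rw [← nsmul_eq_mul]
        refine Finset.sum_le_card_nsmul _ _ _ fun c _ => ?_
        rw [norm_smul, norm_hvec, mul_one]; exact hN c
      set c := -skew v (w a • hvec a) with hcd
      have hcb : |c| ≤ 2 * S.card * N ^ 2 := by
        rw [hcd, abs_neg]
        refine (abs_skew_le _ _).trans ?_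
        rw [norm_smul, norm_hvec, mul_one]
        calc 2 * ‖v‖ * ‖w a‖ ≤ 2 * (S.card * N) * N := by gcongr; exact hN a
          _ = _ := by ring
      have e : mul ξ (w a • hvec a + v) = mul (mul ξ v) (w a • hvec a) + c • central n := by
        rw [mul_assoc', hcd]
        simp only [mul_eq, skew_add_right, skew_smul_right, skew_central_right]
        module
      have h1 := H ξ w N hN
      have h2 := step a (mul ξ v) (w a)
      have h3 := H₀ (mul (mul ξ v) (w a • hvec a)) c
      have h4 : |c| ^ (1 / 2 : ℝ) ≤ (2 * S.card) ^ (1 / 2 : ℝ) * N := by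
        calc |c| ^ (1 / 2 : ℝ) ≤ (2 * S.card * N ^ 2) ^ (1 / 2 : ℝ) := by gcongr
          _ = _ := by
            rw [Real.mul_rpow (by positivity) (by positivity), ← Real.sqrt_eq_rpow (N ^ 2),
              Real.sqrt_sq hN0]
      have h5 := mul_le_mul_of_nonneg_left h4 hC₀
      have h6 := mul_le_mul_of_nonneg_left (hN a) (hM0 a)
      rw [e]
      have t := abs_add_three (F (mul (mul ξ v) (w a • hvec a) + c • central n) -
        F (mul (mul ξ v) (w a • hvec a))) (F (mul (mul ξ v) (w a • hvec a)) - F (mul ξ v))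
        (F (mul ξ v) - F ξ)
      rw [show F (mul (mul ξ v) (w a • hvec a) + c • central n) -
        F (mul (mul ξ v) (w a • hvec a)) + (F (mul (mul ξ v) (w a • hvec a)) - F (mul ξ v)) +
        (F (mul ξ v) - F ξ) = F (mul (mul ξ v) (w a • hvec a) + c • central n) - F ξ by ring] at t
      linarith
  obtain ⟨C, hC, H⟩ := key Finset.univ
  refine ⟨C, hC, fun ξ v hv => ?_⟩
  have := H ξ (fun a => v (Sum.map id Sum.inl a)) ‖v‖ (fun a => PiLp.norm_apply_le v _)
  convert this using 6
  have e := (EuclideanSpace.basisFun (Fin n ⊕ Fin n ⊕ Unit) ℝ).sum_repr v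
  conv_lhs => rw [← e]
  rw [Fintype.sum_sum_type, Fintype.sum_sum_type, Fintype.sum_sum_type]
  simp only [tc] at hv
  simp [hv, hvec, coordVec]

/-! ### Local Euclidean estimates and cutoffs -/

/-- Local Hölder continuity, with constants uniform on balls. -/
def LocHolder (γ : ℝ) (F : Heis n → ℝ) : Prop :=
  ∀ R : ℝ, ∃ C : ℝ, 0 ≤ C ∧ ∀ ξ h, ‖ξ‖ ≤ R → ‖h‖ ≤ 1 → |F (ξ + h) - F ξ| ≤ C * ‖h‖ ^ γ

/-- The local Zygmund condition, with constants uniform on balls. -/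
def LocZygmund (F : Heis n → ℝ) : Prop :=
  ∀ R : ℝ, ∃ C : ℝ, 0 ≤ C ∧ ∀ ξ h, ‖ξ‖ ≤ R → ‖h‖ ≤ 1 →
    |F (ξ + h) + F (ξ - h) - 2 * F ξ| ≤ C * ‖h‖

lemma abs_skew_le_of_norm_le {ξ : Heis n} {R : ℝ} (h : ‖ξ‖ ≤ R) (η : Heis n) :
    |skew ξ η| ≤ 2 * R * ‖η‖ :=
  (abs_skew_le ξ η).trans (by gcongr)

/-- A Euclidean increment at `ξ` is a group increment whose Euclidean size is larger by a factor
growing with `‖ξ‖`; this is where uniformity is lost outside balls. -/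
lemma GammaBase.locHolder {b : ℝ} (hb0 : 0 < b) (hb : b ≤ 1) {F : Heis n → ℝ}
    (h : GammaBase b F) : LocHolder (b / 2) F := by
  obtain ⟨C, hC, H⟩ := (h.symmHolder hb).first_diff hb0 hb
  intro R
  refine ⟨C * (1 + 2 * |R|) ^ (b / 2), by positivity, fun ξ h hξ _ => ?_⟩
  have e : ξ + h = mul ξ (h - skew ξ h • central n) := by
    rw [sub_eq_add_neg, ← neg_smul, mul_eq, skew_add_right, skew_smul_right, skew_central_right]
    module
  have h1 : ‖h - skew ξ h • central n‖ ≤ (1 + 2 * |R|) * ‖h‖ := by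
    refine (norm_sub_le _ _).trans ?_
    rw [norm_smul, norm_central, mul_one]
    have := abs_skew_le_of_norm_le (hξ.trans (le_abs_self R)) h
    rw [Real.norm_eq_abs]; linarith
  rw [e]
  refine (H _ _).trans ?_
  rw [mul_assoc, ← Real.mul_rpow (by positivity) (norm_nonneg _)]
  gcongr

/-- A Euclidean increment becomes a central shift followed by a group increment without central
component, so central and horizontal regularity can be applied separately. -/
lemma add_eq_mul (ξ h : Heis n) :
    ξ + h = mul (ξ + (tc h - skew ξ h) • central n) (h - tc h • central n) := by
  rw [sub_eq_add_neg h, ← neg_smul, mul_eq, skew_add_right, skew_smul_right, skew_central_right,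
    skew_add_left, skew_smul_left, skew_central_left]
  module

lemma sub_eq_mul (ξ h : Heis n) :
    ξ - h = mul (ξ - (tc h - skew ξ h) • central n) (-(h - tc h • central n)) := by
  have := add_eq_mul ξ (-h)
  rw [← sub_eq_add_neg] at this
  rw [this, skew_neg_right, ← neg_one_smul ℝ h, tc_smul]
  congr 1 <;> module

lemma tc_sub_central (h : Heis n) : tc (h - tc h • central n) = 0 := by
  rw [sub_eq_add_neg, ← neg_smul, tc_add, tc_smul, tc_central]; ring

lemma norm_sub_central_le (h : Heis n) : ‖h - tc h • central n‖ ≤ 2 * ‖h‖ := by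
  refine (norm_sub_le _ _).trans ?_
  rw [norm_smul, norm_central, mul_one, Real.norm_eq_abs]
  linarith [abs_tc_le_norm h]

lemma abs_tc_sub_skew_le {ξ : Heis n} {R : ℝ} (hξ : ‖ξ‖ ≤ R) (h : Heis n) :
    |tc h - skew ξ h| ≤ (1 + 2 * |R|) * ‖h‖ := by
  have h1 := abs_sub (tc h) (skew ξ h)
  have h2 := abs_tc_le_norm h
  have h3 := abs_skew_le_of_norm_le (hξ.trans (le_abs_self R)) h
  linarith

lemma rpow_le_of_exponent_ge {x : ℝ} (hx0 : 0 ≤ x) (hx1 : x ≤ 1) {y z : ℝ} (hz : 0 < z) (h : z ≤ y) :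
    x ^ y ≤ x ^ z := by
  rcases hx0.eq_or_lt with rfl | h0
  · rw [Real.zero_rpow (hz.trans_le h).ne', Real.zero_rpow hz.ne']
  · exact Real.rpow_le_rpow_of_exponent_ge h0 hx1 h

lemma le_rpow_of_le_one {x : ℝ} (hx0 : 0 ≤ x) (hx1 : x ≤ 1) {z : ℝ} (hz : 0 < z) (h : z ≤ 1) :
    x ≤ x ^ z := by
  simpa using rpow_le_of_exponent_ge hx0 hx1 hz h

/-- The central shift is controlled with exponent `(1+b)/2` and the horizontal increment is
Lipschitz. The exponent `1/2` needed by `horizontal_lipschitz` follows from `(1+b)/2 ≥ 1/2` for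
small shifts and from boundedness for large ones. -/
lemma GammaIter.locHolder (hn : 1 ≤ n) {b : ℝ} (hb0 : 0 < b) (hb : b < 1) {F : Heis n → ℝ}
    (hF : GammaIter b 1 F) : LocHolder ((1 + b) / 2) F := by
  obtain ⟨C, hC, H⟩ := central_first_diff hn hb0 hb hF
  obtain ⟨M, hM⟩ := hF.1.1.2
  have hM0 : 0 ≤ M := (abs_nonneg _).trans (hM 0)
  obtain ⟨L, hL, HL⟩ := horizontal_lipschitz (fun a => (hF.2 a).1) (fun a => (hF.2 a).2.1.2)
    ⟨C + 2 * M, by positivity, fun ξ τ => by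
      rcases le_total |τ| 1 with h | h
      · refine (H ξ τ).trans ?_
        have := rpow_le_of_exponent_ge (abs_nonneg τ) h (y := (1 + b) / 2) (z := 1 / 2)
          (by norm_num) (by linarith)
        have h0 : 0 ≤ |τ| ^ (1 / 2 : ℝ) := by positivity
        nlinarith
      · have h1 : 1 ≤ |τ| ^ (1 / 2 : ℝ) := Real.one_le_rpow h (by norm_num)
        have := abs_sub (F (ξ + τ • central n)) (F ξ)
        have h2 := hM (ξ + τ • central n)
        have h3 := hM ξ
        nlinarith⟩
  intro R
  refine ⟨L * 2 + C * (1 + 2 * |R|) ^ ((1 + b) / 2), by positivity, fun ξ h hξ hh => ?_⟩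
  have h1 := HL (ξ + (tc h - skew ξ h) • central n) _ (tc_sub_central h)
  rw [← add_eq_mul] at h1
  have h2 := H ξ (tc h - skew ξ h)
  have h3 : L * ‖h - tc h • central n‖ ≤ L * (2 * ‖h‖ ^ ((1 + b) / 2)) := by
    gcongr
    refine (norm_sub_central_le h).trans ?_
    gcongr
    exact le_rpow_of_le_one (norm_nonneg _) hh (by linarith) (by linarith)
  have h4 : C * |tc h - skew ξ h| ^ ((1 + b) / 2) ≤
      C * ((1 + 2 * |R|) ^ ((1 + b) / 2) * ‖h‖ ^ ((1 + b) / 2)) := by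
    rw [← Real.mul_rpow (by positivity) (norm_nonneg _)]
    gcongr
    exact abs_tc_sub_skew_le hξ h
  have := abs_add_le (F (ξ + h) - F (ξ + (tc h - skew ξ h) • central n))
    (F (ξ + (tc h - skew ξ h) • central n) - F ξ)
  rw [sub_add_sub_cancel] at this
  calc _ ≤ L * (2 * ‖h‖ ^ ((1 + b) / 2)) +
      C * ((1 + 2 * |R|) ^ ((1 + b) / 2) * ‖h‖ ^ ((1 + b) / 2)) := by linarith
    _ = _ := by ring

/-- Only the central shift needs a symmetric difference; the horizontal increments on the two sides
are Lipschitz and are estimated separately. -/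
lemma GammaIter.locZygmund (hn : 1 ≤ n) {F : Heis n → ℝ}
    (hF : GammaIter 1 1 F) : LocZygmund F := by
  obtain ⟨C, hC, H⟩ := central_symm_diff hn one_pos le_rfl hF
  obtain ⟨C', hC', H'⟩ := (hF.1.symmHolder le_rfl).first_diff one_pos le_rfl
  obtain ⟨L, hL, HL⟩ := horizontal_lipschitz (fun a => (hF.2 a).1) (fun a => (hF.2 a).2.1.2)
    ⟨C', hC', fun ξ τ => by
      have := H' ξ (τ • central n)
      rwa [mul_smul_central, norm_smul, norm_central, mul_one] at this⟩
  intro R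
  refine ⟨L * 4 + C * (1 + 2 * |R|), by positivity, fun ξ h hξ hh => ?_⟩
  have h1 := HL (ξ + (tc h - skew ξ h) • central n) _ (tc_sub_central h)
  have h2 := HL (ξ - (tc h - skew ξ h) • central n) (-(h - tc h • central n))
    (by rw [← neg_one_smul ℝ, tc_smul, tc_sub_central, mul_zero])
  rw [← add_eq_mul] at h1
  rw [← sub_eq_mul, norm_neg] at h2
  have h3 := H ξ (tc h - skew ξ h)
  norm_num at h3
  have h4 : L * ‖h - tc h • central n‖ ≤ L * (2 * ‖h‖) := by
    gcongr
    exact norm_sub_central_le h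
  have h5 : C * |tc h - skew ξ h| ≤ C * ((1 + 2 * |R|) * ‖h‖) := by
    gcongr
    exact abs_tc_sub_skew_le hξ h
  have := abs_add_three (F (ξ + h) - F (ξ + (tc h - skew ξ h) • central n))
    (F (ξ - h) - F (ξ - (tc h - skew ξ h) • central n))
    (F (ξ + (tc h - skew ξ h) • central n) + F (ξ - (tc h - skew ξ h) • central n) - 2 * F ξ)
  rw [show ∀ A B C D E : ℝ, A - B + (C - D) + (B + D - E) = A + C - E by intros; ring] at this
  linarith

/-- The margin of one around the support of `χ` makes all terms vanish for `‖x‖ > R + 1` and `‖h‖ ≤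
1`, and boundedness handles `‖h‖ > 1`. In the product rules every difference falling on `χ` is first
order, so it costs only the Lipschitz constant of `χ`. -/
lemma LipBase.of_local {γ : ℝ} (hγ : 0 < γ) {F χ : Heis n → ℝ} (hF : BoundedCont F)
    (hχ : ContDiff ℝ (⊤ : ℕ∞) χ) (hχc : HasCompactSupport χ)
    (h1 : γ < 1 → LocHolder γ F) (h2 : γ = 1 → LocZygmund F) :
    LipBase γ (fun x => χ x * F x) := by
  obtain ⟨M, hM⟩ := hF.2
  have hM0 : 0 ≤ M := (abs_nonneg _).trans (hM 0)
  obtain ⟨N, hN⟩ := hχc.exists_bound_of_continuous hχ.continuous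
  have hN0 : 0 ≤ N := (norm_nonneg _).trans (hN 0)
  obtain ⟨L, hL⟩ := ContDiff.lipschitzWith_of_hasCompactSupport hχc hχ (by simp)
  have hL : ∀ x h, |χ (x + h) - χ x| ≤ L * ‖h‖ := fun x h => by
    simpa [dist_eq_norm] using hL.dist_le_mul (x + h) x
  have hb : ∀ x, |χ x * F x| ≤ N * M := fun x => by
    rw [abs_mul]; exact mul_le_mul (hN x) (hM x) (abs_nonneg _) hN0
  obtain ⟨R, hR⟩ := hχc.isCompact.isBounded.subset_closedBall 0
  have hz : ∀ x, R < ‖x‖ → χ x = 0 := fun x hx => by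
    by_contra h
    have := hR (subset_tsupport χ h)
    simp at this; linarith
  refine ⟨⟨hχ.continuous.mul hF.1, N * M, hb⟩, fun hγ1 => ?_, fun hγ1 => ?_⟩
  · obtain ⟨C, hC, H⟩ := h1 hγ1 (R + 1)
    refine ⟨2 * (N * M) + N * C + L * M, fun x h => ?_⟩
    have hp : 0 ≤ ‖h‖ ^ γ := by positivity
    rcases le_or_gt ‖h‖ 1 with hh | hh
    · have hh' := le_rpow_of_le_one (norm_nonneg h) hh hγ hγ1.le
      have hr : 0 ≤ 2 * (N * M) := by positivity
      rcases le_or_gt ‖x‖ (R + 1) with hx | hx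
      · have e : χ (x + h) * F (x + h) - χ x * F x =
          χ (x + h) * (F (x + h) - F x) + (χ (x + h) - χ x) * F x := by ring
        have t1 : |χ (x + h) * (F (x + h) - F x)| ≤ N * (C * ‖h‖ ^ γ) := by
          rw [abs_mul]; exact mul_le_mul (hN _) (H x h hx hh) (abs_nonneg _) hN0
        have t2 : |(χ (x + h) - χ x) * F x| ≤ (L * ‖h‖ ^ γ) * M := by
          rw [abs_mul]
          refine mul_le_mul ((hL x h).trans ?_) (hM x) (abs_nonneg _) (by positivity)
          gcongr
        rw [e]
        refine (abs_add_le _ _).trans ?_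
        nlinarith
      · have : R < ‖x + h‖ := by
          have := norm_sub_norm_le x (-h)
          rw [norm_neg, sub_neg_eq_add] at this; linarith
        simp only [hz _ this, hz x (by linarith)]
        simp; positivity
    · have : 1 ≤ ‖h‖ ^ γ := Real.one_le_rpow hh.le hγ.le
      refine (abs_sub _ _).trans ?_
      have t1 := hb (x + h)
      have t2 := hb x
      have t3 : 0 ≤ N * C + L * M := by positivity
      have t4 : 0 ≤ N * M := by positivity
      nlinarith
  · subst hγ1
    obtain ⟨C, hC, H⟩ := h2 rfl (R + 1)
    refine ⟨4 * (N * M) + N * C + 2 * (L * M), fun x h => ?_⟩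
    have hp := norm_nonneg h
    have t4 : 0 ≤ N * M := by positivity
    have t5 : 0 ≤ N * C := by positivity
    have t6 : 0 ≤ L * M := by positivity
    rcases le_or_gt ‖h‖ 1 with hh | hh
    · rcases le_or_gt ‖x‖ (R + 1) with hx | hx
      · have e : χ (x + h) * F (x + h) + χ (x - h) * F (x - h) - 2 * (χ x * F x) =
          χ x * (F (x + h) + F (x - h) - 2 * F x) + (χ (x + h) - χ x) * F (x + h)
            + (χ (x - h) - χ x) * F (x - h) := by ring
        have t1 : |χ x * (F (x + h) + F (x - h) - 2 * F x)| ≤ N * (C * ‖h‖) := by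
          rw [abs_mul]; exact mul_le_mul (hN _) (H x h hx hh) (abs_nonneg _) hN0
        have t2 : |(χ (x + h) - χ x) * F (x + h)| ≤ (L * ‖h‖) * M := by
          rw [abs_mul]
          exact mul_le_mul (hL x h) (hM _) (abs_nonneg _) (by positivity)
        have t3 : |(χ (x - h) - χ x) * F (x - h)| ≤ (L * ‖h‖) * M := by
          rw [abs_mul]
          have := hL x (-h)
          rw [norm_neg, ← sub_eq_add_neg] at this
          exact mul_le_mul this (hM _) (abs_nonneg _) (by positivity)
        rw [e]
        refine (abs_add_three _ _ _).trans ?_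
        nlinarith
      · have e1 : R < ‖x + h‖ := by
          have := norm_sub_norm_le x (-h)
          rw [norm_neg, sub_neg_eq_add] at this; linarith
        have e2 : R < ‖x - h‖ := by
          have := norm_sub_norm_le x h; linarith
        simp only [hz _ e1, hz _ e2, hz x (by linarith)]
        simp; positivity
    · have t1 := hb (x + h)
      have t2 := hb x
      have t3 := hb (x - h)
      have : |χ (x + h) * F (x + h) + χ (x - h) * F (x - h) - 2 * (χ x * F x)| ≤ 4 * (N * M) := by
        rw [abs_le] at *; constructor <;> linarith
      nlinarith

/-! ### The central field as a commutator -/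

/-- First order expansion along a one-parameter subgroup, uniformly in the base point. -/
lemma flow_taylor {w : Heis n} {G D : Heis n → ℝ} {ξ : Heis n}
    (hG : ∀ p s, HasDerivAt (fun u : ℝ => G (mul p (u • w))) (D (mul p (s • w))) s)
    (hD : ContinuousAt D ξ) {ε : ℝ} (hε : 0 < ε) :
    ∃ δ > 0, ∀ p s, ‖p - ξ‖ < δ → |s| < δ →
      |G (mul p (s • w)) - G p - s * D ξ| ≤ ε * |s| := by
  obtain ⟨δ₁, hδ₁, h₁⟩ := Metric.continuousAt_iff.1 hD ε hε
  have hc : Continuous fun x : Heis n × ℝ => mul x.1 (x.2 • w) :=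
    continuous_mul.comp (continuous_fst.prodMk (continuous_snd.smul continuous_const))
  obtain ⟨δ, hδ, h₂⟩ := Metric.continuousAt_iff.1 (hc.continuousAt (x := (ξ, 0))) δ₁ hδ₁
  refine ⟨δ, hδ, fun p s hp hs => ?_⟩
  have hd : ∀ u, HasDerivAt (fun u : ℝ => G (mul p ((s * u) • w)) - u * (s * D ξ))
      (s * D (mul p ((s * u) • w)) - s * D ξ) u := fun u => by
    have h3 := (hG p (s * u)).comp u ((hasDerivAt_id u).const_mul s)
    have h4 := h3.fun_sub ((hasDerivAt_id u).mul_const (s * D ξ))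
    simpa [mul_comm, Function.comp_def] using h4
  have := abs_sub_le_of_deriv (K := ε * |s|) hd fun u hu => by
    rw [← mul_sub, abs_mul, mul_comm]
    gcongr
    have hsu : |s * u| < δ := by
      rw [abs_mul, abs_of_nonneg hu.1]; nlinarith [abs_nonneg s, hu.2]
    have := h₂ (x := (p, s * u)) (by
      rw [Prod.dist_eq, max_lt_iff]
      exact ⟨by simpa [dist_eq_norm] using hp, by simpa using hsu⟩)
    simp only [zero_smul, mul_zero'] at this
    exact (h₁ this).le
  simpa [sub_right_comm] using this

/-- Four applications of `flow_taylor` telescope. Its uniformity in the base point is essential,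
since the later legs start away from `ξ`. -/
lemma chain_taylor {i j : Fin n ⊕ Fin n} {G : Heis n → ℝ} (ξ : Heis n)
    (hi : FieldDifferentiable (horiz i) G) (hj : FieldDifferentiable (horiz j) G)
    (hic : Continuous (fieldDeriv (horiz i) G)) (hjc : Continuous (fieldDeriv (horiz j) G))
    {ε : ℝ} (hε : 0 < ε) :
    ∃ δ > 0, ∀ p q p' q' s, s < δ → |p| ≤ s → |q| ≤ s → |p'| ≤ s → |q'| ≤ s →
      |G (mul (mul (mul (mul ξ (p • hvec i)) (q • hvec j)) (p' • hvec i)) (q' • hvec j)) - G ξ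
        - (p + p') * fieldDeriv (horiz i) G ξ - (q + q') * fieldDeriv (horiz j) G ξ|
        ≤ 4 * ε * s := by
  obtain ⟨δ₁, hδ₁, h₁⟩ := flow_taylor (hasDerivAt_horiz hi) (hic.continuousAt (x := ξ)) hε
  obtain ⟨δ₂, hδ₂, h₂⟩ := flow_taylor (hasDerivAt_horiz hj) (hjc.continuousAt (x := ξ)) hε
  have hc : Continuous fun x : ℝ × ℝ × ℝ =>
      mul (mul (mul ξ (x.1 • hvec i)) (x.2.1 • hvec j)) (x.2.2 • hvec i) := by
    refine continuous_mul.comp (Continuous.prodMk (continuous_mul.comp (Continuous.prodMk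
      (continuous_mul.comp (Continuous.prodMk continuous_const ?_)) ?_)) ?_) <;> fun_prop
  obtain ⟨δ, hδ, h₃⟩ := Metric.continuousAt_iff.1 (hc.continuousAt (x := 0)) (min δ₁ δ₂)
    (lt_min hδ₁ hδ₂)
  have h₃ : ∀ p q p' : ℝ, |p| < δ → |q| < δ → |p'| < δ →
      ‖mul (mul (mul ξ (p • hvec i)) (q • hvec j)) (p' • hvec i) - ξ‖ < min δ₁ δ₂ := by
    intro p q p' hp hq hp'
    have := h₃ (x := (p, q, p')) (by
      rw [Prod.dist_eq, max_lt_iff, Prod.dist_eq, max_lt_iff]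
      refine ⟨?_, ?_, ?_⟩ <;> simpa)
    simpa [dist_eq_norm] using this
  refine ⟨min δ (min δ₁ δ₂), by positivity, fun p q p' q' s hs hp hq hp' hq' => ?_⟩
  have hsδ : s < δ := hs.trans_le (min_le_left _ _)
  have hs1 : s < δ₁ := hs.trans_le ((min_le_right _ _).trans (min_le_left _ _))
  have hs2 : s < δ₂ := hs.trans_le ((min_le_right _ _).trans (min_le_right _ _))
  have h0 : |(0 : ℝ)| < δ := by simpa using hδ
  have b1 := h₁ ξ p (by simpa using hδ₁) (hp.trans_lt hs1)
  have b2 := h₂ (mul ξ (p • hvec i)) q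
    (by simpa using (h₃ p 0 0 (hp.trans_lt hsδ) h0 h0).trans_le (min_le_right _ _))
    (hq.trans_lt hs2)
  have b3 := h₁ (mul (mul ξ (p • hvec i)) (q • hvec j)) p'
    (by simpa using (h₃ p q 0 (hp.trans_lt hsδ) (hq.trans_lt hsδ) h0).trans_le (min_le_left _ _))
    (hp'.trans_lt hs1)
  have b4 := h₂ _ q' ((h₃ p q p' (hp.trans_lt hsδ) (hq.trans_lt hsδ)
    (hp'.trans_lt hsδ)).trans_le (min_le_right _ _)) (hq'.trans_lt hs2)
  have c1 := mul_le_mul_of_nonneg_left hp hε.le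
  have c2 := mul_le_mul_of_nonneg_left hq hε.le
  have c3 := mul_le_mul_of_nonneg_left hp' hε.le
  have c4 := mul_le_mul_of_nonneg_left hq' hε.le
  replace b1 := abs_le.1 (b1.trans c1)
  replace b2 := abs_le.1 (b2.trans c2)
  replace b3 := abs_le.1 (b3.trans c3)
  replace b4 := abs_le.1 (b4.trans c4)
  rw [abs_le]
  constructor <;> nlinarith

/-- Second order expansion around a commutator loop. -/
lemma loop_taylor {i j : Fin n ⊕ Fin n} {F : Heis n → ℝ} (hF : ∀ a, FieldDifferentiable (horiz a) F)
    (hF2 : ∀ a c, FieldDifferentiable (horiz c) (fieldDeriv (horiz a) F) ∧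
      Continuous (fieldDeriv (horiz c) (fieldDeriv (horiz a) F))) (ξ : Heis n)
    {ε : ℝ} (hε : 0 < ε) :
    ∃ δ > 0, ∀ s, 0 ≤ s → s < δ →
      |F (ξ + (2 * skew (hvec i) (hvec j) * s ^ 2) • central n) - F ξ
        - s ^ 2 * (fieldDeriv (horiz i) (fieldDeriv (horiz j) F) ξ -
          fieldDeriv (horiz j) (fieldDeriv (horiz i) F) ξ)| ≤ ε * s ^ 2 := by
  set G := fieldDeriv (horiz i) F with hG
  set H := fieldDeriv (horiz j) F with hH
  obtain ⟨δ₁, hδ₁, H₁⟩ := chain_taylor ξ (hF2 i i).1 (hF2 i j).1 (hF2 i i).2 (hF2 i j).2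
    -- The loop has four legs, each with error at most `4 · (ε/16) · s`.
    (show 0 < ε / 16 by positivity)
  obtain ⟨δ₂, hδ₂, H₂⟩ := chain_taylor ξ (hF2 j i).1 (hF2 j j).1 (hF2 j i).2 (hF2 j j).2
    (show 0 < ε / 16 by positivity)
  rw [← hG] at H₁
  rw [← hH] at H₂
  set XG := fieldDeriv (horiz i) G ξ
  set YG := fieldDeriv (horiz j) G ξ
  set XH := fieldDeriv (horiz i) H ξ
  set YH := fieldDeriv (horiz j) H ξ
  refine ⟨min δ₁ δ₂, lt_min hδ₁ hδ₂, fun s hs hsδ => ?_⟩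
  -- The subtracted polynomial has derivative `s²((2u-1)(XG+YH) + (XH-YG))`, the first order
  -- expansion of the four legs. Its part `u² - u` vanishes at both ends, so only the commutator `XH
  -- - YG` survives.
  have D := fun u => (((((hasDerivAt_horiz_mul (hF i) ξ s u).add
    (hasDerivAt_horiz_mul (hF i) (mul (mul ξ (s • hvec i)) (s • hvec j)) (-s) u)).add
    (hasDerivAt_horiz_mul (hF j) (mul ξ (s • hvec i)) s u)).add
    (hasDerivAt_horiz_mul (hF j) (mul (mul (mul ξ (s • hvec i)) (s • hvec j)) ((-s) • hvec i))
      (-s) u)).sub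
    (((((hasDerivAt_pow 2 u).sub (hasDerivAt_id u)).mul_const (XG + YH)).add
      ((hasDerivAt_id u).mul_const (XH - YG))).const_mul (s ^ 2)))
  have key := abs_sub_le_of_deriv (K := ε * s ^ 2) D ?_
  · have hloop : mul (mul (mul (mul ξ (s • hvec i)) (s • hvec j)) ((-s) • hvec i)) ((-s) • hvec j)
        = ξ + (2 * skew (hvec i) (hvec j) * s ^ 2) • central n := by
      have : s • hvec i = pt i j s 0 0 := by simp [pt]
      rw [mul_assoc', mul_assoc', mul_assoc', ← mul_assoc' (s • hvec j), ← mul_assoc' (s • hvec i),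
        ← mul_assoc' (s • hvec i), this, pt_mul_right, pt_mul_left, pt_mul_right,
        ← mul_smul_central]
      congr 1
      simp only [pt]
      module
    refine le_of_eq_of_le ?_ key
    congr 1
    simp only [Pi.add_apply, Pi.sub_apply, mul_one, mul_zero, zero_smul, mul_zero', hloop]
    simp only [neg_smul, id]
    ring
  · intro u hu
    have hu1 : |s * u| ≤ s := by
      rw [abs_mul, abs_of_nonneg hu.1, abs_of_nonneg hs]; nlinarith [hu.2]
    have hu2 : |-s * u| ≤ s := by rw [neg_mul, abs_neg]; exact hu1
    have hs' : |s| ≤ s := (abs_of_nonneg hs).le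
    have hs'' : |-s| ≤ s := by rwa [abs_neg]
    have h0 : |(0 : ℝ)| ≤ s := by simpa using hs
    have b1 := abs_le.1 (H₁ (s * u) 0 0 0 s (hsδ.trans_le (min_le_left _ _)) hu1 h0 h0 h0)
    have b2 := abs_le.1 (H₁ s s (-s * u) 0 s (hsδ.trans_le (min_le_left _ _)) hs' hs' hu2 h0)
    have b3 := abs_le.1 (H₂ s (s * u) 0 0 s (hsδ.trans_le (min_le_right _ _)) hs' hu1 h0 h0)
    have b4 := abs_le.1 (H₂ s s (-s) (-s * u) s (hsδ.trans_le (min_le_right _ _)) hs' hs' hs'' hu2)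
    simp only [zero_smul, mul_zero'] at b1 b2 b3 b4
    set A := G (mul ξ ((s * u) • hvec i))
    set B := G (mul (mul (mul ξ (s • hvec i)) (s • hvec j)) ((-s * u) • hvec i))
    set A' := H (mul (mul ξ (s • hvec i)) ((s * u) • hvec j))
    set B' := H (mul (mul (mul (mul ξ (s • hvec i)) (s • hvec j)) ((-s) • hvec i))
      ((-s * u) • hvec j))
    have e : |s * (A - B + A' - B' - s * ((2 * u - 1) * (XG + YH) + (XH - YG)))| ≤
        s * (ε * s) := by
      rw [abs_mul, abs_of_nonneg hs]
      refine mul_le_mul_of_nonneg_left ?_ hs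
      rw [abs_le]
      constructor <;> nlinarith
    refine le_of_eq_of_le ?_ (e.trans (le_of_eq (by ring)))
    congr 1
    simp only [Nat.cast_ofNat]
    ring

/-- The central derivative is a commutator of horizontal derivatives. -/
lemma hasDerivAt_central (j : Fin n) {F : Heis n → ℝ} (hF : ∀ a, FieldDifferentiable (horiz a) F)
    (hF2 : ∀ a c, FieldDifferentiable (horiz c) (fieldDeriv (horiz a) F) ∧
      Continuous (fieldDeriv (horiz c) (fieldDeriv (horiz a) F))) (ξ : Heis n) :
    HasDerivAt (fun τ : ℝ => F (ξ + τ • central n))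
      ((1 / 4) * (fieldDeriv (horiz (Sum.inr j)) (fieldDeriv (horiz (Sum.inl j)) F) ξ -
          fieldDeriv (horiz (Sum.inl j)) (fieldDeriv (horiz (Sum.inr j)) F) ξ)) 0 := by
  rw [hasDerivAt_iff_isLittleO, Asymptotics.isLittleO_iff]
  intro ε hε
  obtain ⟨δ₁, hδ₁, H₁⟩ := loop_taylor (i := Sum.inl j) (j := Sum.inr j) hF hF2 ξ hε
  obtain ⟨δ₂, hδ₂, H₂⟩ := loop_taylor (i := Sum.inr j) (j := Sum.inl j) hF hF2 ξ hε
  have hs : ∀ᶠ τ : ℝ in nhds 0, Real.sqrt |τ| / 2 < min δ₁ δ₂ := by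
    have : Continuous fun τ : ℝ => Real.sqrt |τ| / 2 := by fun_prop
    exact this.continuousAt.eventually_lt continuousAt_const (by simpa using ⟨hδ₁, hδ₂⟩)
  filter_upwards [hs] with τ hτ
  have h0 : 0 ≤ Real.sqrt |τ| / 2 := by positivity
  have b1 := H₁ _ h0 (hτ.trans_le (min_le_left _ _))
  have b2 := H₂ _ h0 (hτ.trans_le (min_le_right _ _))
  rw [skew_hvec, div_pow, Real.sq_sqrt (abs_nonneg _)] at b1
  rw [skew_swap, skew_hvec, div_pow, Real.sq_sqrt (abs_nonneg _)] at b2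
  simp only [zero_smul, add_zero, sub_zero, smul_eq_mul, Real.norm_eq_abs]
  -- The order `X_j, Y_j` reaches only negative central shifts, since `skew_hvec` is negative;
  -- positive ones use the opposite order.
  rcases le_total 0 τ with h | h
  · rw [abs_of_nonneg h] at b2 ⊢
    rw [show 2 * - -2 * (τ / 2 ^ 2) = τ by ring] at b2
    refine le_trans (le_of_eq ?_) (b2.trans ?_)
    · congr 1; ring
    · nlinarith
  · rw [abs_of_nonpos h] at b1 ⊢
    rw [show 2 * -2 * (-τ / 2 ^ 2) = τ by ring] at b1
    refine le_trans (le_of_eq ?_) (b1.trans ?_)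
    · congr 1; ring
    · nlinarith

/-- The coordinate field is the horizontal one minus a multiple of the central field. As Fréchet
differentiability is not available, linearity is replaced by a central expansion uniform in the base
point together with continuity of `D`. -/
lemma hasDerivAt_coord {F D : Heis n → ℝ} (a : Fin n ⊕ Fin n)
    (hF : FieldDifferentiable (horiz a) F)
    (hD : ∀ ξ, HasDerivAt (fun τ : ℝ => F (ξ + τ • central n)) (D ξ) 0) (hDc : Continuous D)
    (ξ : Heis n) :
    HasDerivAt (fun s : ℝ => F (ξ + s • hvec a))
      (fieldDeriv (horiz a) F ξ - skew ξ (hvec a) * D ξ) 0 := by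
  have hflow : ∀ p s, HasDerivAt (fun u : ℝ => F (mul p (u • central n)))
      (D (mul p (s • central n))) s := fun p s => by
    have h1 := hD (mul p (s • central n))
    have h3 : HasDerivAt (fun t : ℝ => F (mul p (s • central n) + t • central n))
      (D (mul p (s • central n))) (s - s) := by rwa [sub_self]
    have h4 := HasDerivAt.comp (h := fun u : ℝ => u - s) s h3 ((hasDerivAt_id s).sub_const s)
    simp only [mul_smul_central, add_assoc, ← add_smul, Function.comp_def, mul_one,
      add_sub_cancel] at h4 ⊢
    exact h4
  set c := -skew ξ (hvec a) with hc
  have e : ∀ s : ℝ, ξ + s • hvec a = mul (mul ξ (s • hvec a)) ((s * c) • central n) := fun s => by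
    rw [mul_smul_central, mul_eq, skew_smul_right, hc]; module
  have h1 : HasDerivAt (fun s : ℝ => F (mul ξ (s • hvec a))) (fieldDeriv (horiz a) F ξ) 0 := by
    simpa using hasDerivAt_horiz hF ξ 0
  have h2 : HasDerivAt (fun s : ℝ => F (ξ + s • hvec a) - F (mul ξ (s • hvec a))) (c * D ξ) 0 := by
    rw [hasDerivAt_iff_isLittleO, Asymptotics.isLittleO_iff]
    intro ε hε
    obtain ⟨δ, hδ, H⟩ := flow_taylor hflow (hDc.continuousAt (x := ξ))
      (show 0 < ε / (1 + |c|) by positivity)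
    have hc1 : ∀ᶠ s : ℝ in nhds 0, ‖mul ξ (s • hvec a) - ξ‖ < δ := by
      have : Continuous fun s : ℝ => ‖mul ξ (s • hvec a) - ξ‖ :=
        ((continuous_mul.comp (continuous_const.prodMk (by fun_prop))).sub continuous_const).norm
      exact this.continuousAt.eventually_lt continuousAt_const (by simpa using hδ)
    have hc2 : ∀ᶠ s : ℝ in nhds 0, |s * c| < δ := by
      have : Continuous fun s : ℝ => |s * c| := by fun_prop
      exact this.continuousAt.eventually_lt continuousAt_const (by simpa using hδ)
    filter_upwards [hc1, hc2] with s h3 h4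
    have := H _ _ h3 h4
    rw [← e] at this
    simp only [zero_smul, mul_zero', add_zero, sub_self, sub_zero, smul_eq_mul, Real.norm_eq_abs]
    rw [← mul_assoc]
    refine this.trans ?_
    rw [abs_mul, div_mul_eq_mul_div, div_le_iff₀ (by positivity)]
    have : 0 ≤ ε * |s| := by positivity
    nlinarith [abs_nonneg c]
  have h3 := h2.fun_add h1
  have h4 : HasDerivAt (fun s : ℝ => F (ξ + s • hvec a)) (c * D ξ + fieldDeriv (horiz a) F ξ) 0 := by
    simpa using h3
  convert h4 using 1
  rw [hc]; ring

/-! ### Algebra of the Lipschitz scales and the inclusion in the classical space -/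

lemma GammaBase.add {b : ℝ} {F G : Heis n → ℝ} (hF : GammaBase b F) (hG : GammaBase b G) :
    GammaBase b (fun x => F x + G x) := by
  obtain ⟨⟨hFc, M, hM⟩, hF1, hF2⟩ := hF
  obtain ⟨⟨hGc, N, hN⟩, hG1, hG2⟩ := hG
  refine ⟨⟨hFc.add hGc, M + N, fun ξ => (abs_add_le _ _).trans (add_le_add (hM ξ) (hN ξ))⟩,
    fun h => ?_, fun h => ?_⟩
  · obtain ⟨C, hC⟩ := hF1 h
    obtain ⟨C', hC'⟩ := hG1 h
    refine ⟨C + C', fun ξ η => ?_⟩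
    rw [add_sub_add_comm, add_mul]
    exact (abs_add_le _ _).trans (add_le_add (hC ξ η) (hC' ξ η))
  · obtain ⟨C, hC⟩ := hF2 h
    obtain ⟨C', hC'⟩ := hG2 h
    refine ⟨C + C', fun ξ η => ?_⟩
    rw [mul_add 2, add_add_add_comm, add_sub_add_comm, add_mul]
    exact (abs_add_le _ _).trans (add_le_add (hC ξ η) (hC' ξ η))

lemma LipBase.add {b : ℝ} {F G : Heis n → ℝ} (hF : LipBase b F) (hG : LipBase b G) :
    LipBase b (fun x => F x + G x) := by
  obtain ⟨⟨hFc, M, hM⟩, hF1, hF2⟩ := hF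
  obtain ⟨⟨hGc, N, hN⟩, hG1, hG2⟩ := hG
  refine ⟨⟨hFc.add hGc, M + N, fun ξ => (abs_add_le _ _).trans (add_le_add (hM ξ) (hN ξ))⟩,
    fun h => ?_, fun h => ?_⟩
  · obtain ⟨C, hC⟩ := hF1 h
    obtain ⟨C', hC'⟩ := hG1 h
    refine ⟨C + C', fun ξ η => ?_⟩
    rw [add_sub_add_comm, add_mul]
    exact (abs_add_le _ _).trans (add_le_add (hC ξ η) (hC' ξ η))
  · obtain ⟨C, hC⟩ := hF2 h
    obtain ⟨C', hC'⟩ := hG2 h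
    refine ⟨C + C', fun ξ η => ?_⟩
    rw [mul_add 2, add_add_add_comm, add_sub_add_comm, add_mul]
    exact (abs_add_le _ _).trans (add_le_add (hC ξ η) (hC' ξ η))

lemma GammaBase.const_mul {b : ℝ} (c : ℝ) {F : Heis n → ℝ} (hF : GammaBase b F) :
    GammaBase b (fun x => c * F x) := by
  obtain ⟨⟨hFc, M, hM⟩, hF1, hF2⟩ := hF
  refine ⟨⟨continuous_const.mul hFc, |c| * M, fun ξ => ?_⟩, fun h => ?_, fun h => ?_⟩
  · rw [abs_mul]; gcongr; exact hM ξ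
  · obtain ⟨C, hC⟩ := hF1 h
    refine ⟨|c| * C, fun ξ η => ?_⟩
    rw [← mul_sub, abs_mul, mul_assoc]; gcongr; exact hC ξ η
  · obtain ⟨C, hC⟩ := hF2 h
    refine ⟨|c| * C, fun ξ η => ?_⟩
    rw [← mul_add, mul_left_comm 2, ← mul_sub, abs_mul, mul_assoc]; gcongr; exact hC ξ η

lemma fieldDeriv_add {V : Heis n → Heis n} {F G : Heis n → ℝ} (hF : FieldDifferentiable V F)
    (hG : FieldDifferentiable V G) :
    FieldDifferentiable V (fun x => F x + G x) ∧
      fieldDeriv V (fun x => F x + G x) = fun x => fieldDeriv V F x + fieldDeriv V G x :=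
  ⟨fun ξ => DifferentiableAt.add (hF ξ) (hG ξ),
    funext fun ξ => ((hF ξ).hasDerivAt.add (hG ξ).hasDerivAt).deriv⟩

lemma fieldDeriv_const_mul {V : Heis n → Heis n} (c : ℝ) {F : Heis n → ℝ}
    (hF : FieldDifferentiable V F) :
    FieldDifferentiable V (fun x => c * F x) ∧
      fieldDeriv V (fun x => c * F x) = fun x => c * fieldDeriv V F x :=
  ⟨fun ξ => DifferentiableAt.const_mul (hF ξ) c,
    funext fun ξ => ((hF ξ).hasDerivAt.const_mul c).deriv⟩

lemma GammaIter.add {b : ℝ} {k : ℕ} : ∀ {F G : Heis n → ℝ}, GammaIter b k F → GammaIter b k G →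
    GammaIter b k (fun x => F x + G x) := by
  induction k with
  | zero => exact fun hF hG => GammaBase.add hF hG
  | succ k ih =>
    refine fun hF hG => ⟨hF.1.add hG.1, fun a => ?_⟩
    obtain ⟨h1, h2⟩ := fieldDeriv_add (hF.2 a).1 (hG.2 a).1
    exact ⟨h1, h2 ▸ ih (hF.2 a).2 (hG.2 a).2⟩

lemma GammaIter.const_mul {b : ℝ} {k : ℕ} (c : ℝ) : ∀ {F : Heis n → ℝ}, GammaIter b k F →
    GammaIter b k (fun x => c * F x) := by
  induction k with
  | zero => exact fun hF => GammaBase.const_mul c hF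
  | succ k ih =>
    refine fun hF => ⟨hF.1.const_mul c, fun a => ?_⟩
    obtain ⟨h1, h2⟩ := fieldDeriv_const_mul c (hF.2 a).1
    exact ⟨h1, h2 ▸ ih (hF.2 a).2⟩

lemma LipIter.add {b : ℝ} {k : ℕ} : ∀ {F G : Heis n → ℝ}, LipIter b k F → LipIter b k G →
    LipIter b k (fun x => F x + G x) := by
  induction k with
  | zero => exact fun hF hG => LipBase.add hF hG
  | succ k ih =>
    refine fun hF hG => ⟨hF.1.add hG.1, fun a => ?_⟩
    obtain ⟨h1, h2⟩ := fieldDeriv_add (hF.2 a).1 (hG.2 a).1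
    exact ⟨h1, h2 ▸ ih (hF.2 a).2 (hG.2 a).2⟩

lemma GammaIter.of_succ {b : ℝ} {k : ℕ} : ∀ {F : Heis n → ℝ}, GammaIter b (k + 1) F →
    GammaIter b k F := by
  induction k with
  | zero => exact fun hF => hF.1
  | succ k ih => exact fun hF => ⟨hF.1, fun a => ⟨(hF.2 a).1, ih (hF.2 a).2⟩⟩

lemma GammaIter.of_add {b : ℝ} {k m : ℕ} {F : Heis n → ℝ} (h : GammaIter b (k + m) F) :
    GammaIter b k F := by
  induction m with
  | zero => exact h
  | succ m ih => exact ih h.of_succ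

lemma hasDerivAt_cutoff {χ F : Heis n → ℝ} (hχ : ContDiff ℝ (⊤ : ℕ∞) χ) {ξ v : Heis n} {d : ℝ}
    (hF : HasDerivAt (fun s : ℝ => F (ξ + s • v)) d 0) :
    HasDerivAt (fun s : ℝ => χ (ξ + s • v) * F (ξ + s • v)) (fderiv ℝ χ ξ v * F ξ + χ ξ * d) 0 := by
  have h1 : HasLineDerivAt ℝ χ (fderiv ℝ χ ξ v) ξ v :=
    ((hχ.differentiable (by simp)) ξ).hasFDerivAt.hasLineDerivAt v
  simpa using HasDerivAt.fun_mul h1 hF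

/-- Cutting off an element of `Γ_{k₀ + 2m + b}` gives a classical Lipschitz function. -/
lemma GammaIter.lipIter_cutoff (hn : 1 ≤ n) {b γ : ℝ} (hγ : 0 < γ) {k₀ : ℕ}
    (hbase : ∀ F : Heis n → ℝ, GammaIter b k₀ F →
      (γ < 1 → LocHolder γ F) ∧ (γ = 1 → LocZygmund F)) (m : ℕ) :
    ∀ F χ : Heis n → ℝ, GammaIter b (k₀ + 2 * m) F → ContDiff ℝ (⊤ : ℕ∞) χ → HasCompactSupport χ →
      LipIter γ m (fun x => χ x * F x) := by
  have hb : ∀ F χ : Heis n → ℝ, ∀ m, GammaIter b (k₀ + 2 * m) F → ContDiff ℝ (⊤ : ℕ∞) χ →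
      HasCompactSupport χ → LipBase γ (fun x => χ x * F x) := fun F χ m hF hχ hχc =>
    have h := hbase F hF.of_add
    LipBase.of_local hγ hF.base.1 hχ hχc h.1 h.2
  induction m with
  | zero => exact fun F χ hF hχ hχc => hb F χ 0 hF hχ hχc
  | succ m ih =>
    intro F χ hF hχ hχc
    refine ⟨hb F χ (m + 1) hF hχ hχc, ?_⟩
    have hF' : GammaIter b (k₀ + 2 * m + 1 + 1) F := hF
    have hF0 : GammaIter b (k₀ + 2 * m) F := hF'.of_succ.of_succ
    have hd : ∀ a, FieldDifferentiable (horiz a) F := fun a => (hF'.2 a).1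
    have hX : ∀ a, GammaIter b (k₀ + 2 * m) (fieldDeriv (horiz a) F) :=
      fun a => (hF'.2 a).2.of_succ
    have hd2 : ∀ a c, FieldDifferentiable (horiz c) (fieldDeriv (horiz a) F) ∧
        Continuous (fieldDeriv (horiz c) (fieldDeriv (horiz a) F)) :=
      fun a c => ⟨((hF'.2 a).2.2 c).1, ((hF'.2 a).2.2 c).2.base.1.1⟩
    let j : Fin n := ⟨0, hn⟩
    -- The central derivative uses up two horizontal ones, hence the step of two in `k₀ + 2 * m`.
    set D : Heis n → ℝ := fun ξ => (1 / 4) *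
      (fieldDeriv (horiz (Sum.inr j)) (fieldDeriv (horiz (Sum.inl j)) F) ξ +
          -1 * fieldDeriv (horiz (Sum.inl j)) (fieldDeriv (horiz (Sum.inr j)) F) ξ) with hDdef
    have hDG : GammaIter b (k₀ + 2 * m) D :=
      (((hF'.2 (Sum.inl j)).2.2 (Sum.inr j)).2.add
        (((hF'.2 (Sum.inr j)).2.2 (Sum.inl j)).2.const_mul (-1))).const_mul (1 / 4)
    have hD : ∀ ξ, HasDerivAt (fun τ : ℝ => F (ξ + τ • central n)) (D ξ) 0 := fun ξ => by
      convert hasDerivAt_central j hd hd2 ξ using 1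
      simp only [hDdef]; ring
    have hχ' : ∀ v, ContDiff ℝ (⊤ : ℕ∞) (fun x => fderiv ℝ χ x v) := fun v =>
      (hχ.fderiv_right (m := (⊤ : ℕ∞)) (by simp)).clm_apply contDiff_const
    have hχc' : ∀ v, HasCompactSupport (fun x => fderiv ℝ χ x v) := fun v =>
      hχc.fderiv_apply (𝕜 := ℝ) v
    have hor : ∀ a, FieldDifferentiable (fun _ => hvec a) (fun x => χ x * F x) ∧
        LipIter γ m (fieldDeriv (fun _ => hvec a) (fun x => χ x * F x)) := fun a => by
      have h1 := fun ξ => hasDerivAt_cutoff hχ (hasDerivAt_coord a (hd a) hD hDG.base.1.1 ξ)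
      refine ⟨fun ξ => (h1 ξ).differentiableAt, ?_⟩
      -- The unbounded coefficient `skew ξ (hvec a)` is absorbed into the cutoff. Each summand is
      -- again a cutoff times a function with `k₀ + 2m` horizontal derivatives, so the induction
      -- must range over all `F` and `χ`.
      have e : fieldDeriv (fun _ => hvec a) (fun x => χ x * F x) = fun ξ =>
          fderiv ℝ χ ξ (hvec a) * F ξ + χ ξ * fieldDeriv (horiz a) F ξ
            + (χ ξ * -skew ξ (hvec a)) * D ξ := by
        funext ξ
        refine (h1 ξ).deriv.trans ?_
        ring
      rw [e]
      refine ((ih _ _ hF0 (hχ' _) (hχc' _)).add (ih _ _ (hX a) hχ hχc)).add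
        (ih D (fun ξ => χ ξ * -skew ξ (hvec a)) hDG (hχ.mul ?_) hχc.mul_right)
      unfold skew; fun_prop
    intro i
    rcases i with i | i | i
    · exact hor (Sum.inl i)
    · exact hor (Sum.inr i)
    · have h1 := fun ξ => hasDerivAt_cutoff hχ (hD ξ)
      refine ⟨fun ξ => (h1 ξ).differentiableAt, ?_⟩
      have e : fieldDeriv (fun _ => central n) (fun x => χ x * F x) = fun ξ =>
          fderiv ℝ χ ξ (central n) * F ξ + χ ξ * D ξ := funext fun ξ => (h1 ξ).deriv
      change LipIter γ m (fieldDeriv (fun _ => central n) (fun x => χ x * F x))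
      rw [e]
      exact (ih _ _ hF0 (hχ' _) (hχc' _)).add (ih _ _ hDG hχ hχc)

/-- On bounded sets `Γ^α` is contained in the classical space `C^{α/2}`. -/
theorem gammaOn_subset_lipOn (hn : 1 ≤ n) {α : ℝ} {S : Set (Heis n)}
    (hS : Bornology.IsBounded S) : GammaOn α S ⊆ LipOn (α / 2) S := by
  rintro f ⟨F, ⟨k, b, hb0, hb1, rfl, hF⟩, hfF⟩
  obtain ⟨R, hR0, hR⟩ := hS.subset_closedBall_lt 0 0
  let φ : ContDiffBump (0 : Heis n) := ⟨R, R + 1, hR0, by linarith⟩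
  refine ⟨fun x => φ x * F x, ?_, fun x hx => ?_⟩
  -- Half of `k + b` is `m + b/2` or `m + (1+b)/2` according to parity. The Zygmund endpoint occurs
  -- only for odd `k` and `b = 1`.
  · rcases Nat.even_or_odd' k with ⟨m, rfl | rfl⟩
    · refine ⟨m, b / 2, by linarith, by linarith, by push_cast; ring, ?_⟩
      refine GammaIter.lipIter_cutoff hn (k₀ := 0) (by linarith)
        (fun F hF => ⟨fun _ => GammaBase.locHolder hb0 hb1 hF, fun h => by linarith⟩) m F φ
        (by rwa [zero_add]) φ.contDiff φ.hasCompactSupport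
    · refine ⟨m, (1 + b) / 2, by linarith, by linarith, by push_cast; ring, ?_⟩
      refine GammaIter.lipIter_cutoff hn (b := b) (k₀ := 1) (by linarith)
        (fun F hF => ⟨fun h => GammaIter.locHolder hn hb0 (by linarith) hF, fun h => ?_⟩) m F φ
        (by rwa [add_comm]) φ.contDiff φ.hasCompactSupport
      obtain rfl : b = 1 := by linarith
      exact GammaIter.locZygmund hn hF
  · rw [hfF hx]
    simp only
    rw [φ.one_of_mem_closedBall (hR hx), one_mul]

/-! ### Volumes of balls and integrals of powers of the distance -/

lemma homDim_pos (n : ℕ) : 0 < homDim n := by unfold homDim; positivity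

/-- The left invariant distance `|η⁻¹ξ|`. -/
def gdist (ξ η : Heis n) : ℝ := gauge (mul (-η) ξ)

lemma gdist_nonneg (ξ η : Heis n) : 0 ≤ gdist ξ η := gauge_nonneg _

lemma gdist_comm (ξ η : Heis n) : gdist ξ η = gdist η ξ := by
  rw [gdist, gdist, ← gauge_neg, neg_mul', neg_neg]

lemma continuous_neg_mul : Continuous fun p : Heis n × Heis n => mul (-p.2) p.1 :=
  continuous_mul.comp (continuous_snd.neg.prodMk continuous_fst)

lemma continuous_gdist : Continuous fun p : Heis n × Heis n => gdist p.1 p.2 :=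
  continuous_gauge.comp continuous_neg_mul

lemma measurable_gdist (ξ : Heis n) : Measurable (gdist ξ) :=
  (continuous_gdist.comp (continuous_const.prodMk continuous_id)).measurable

/-- The ball lies in a box with `2n` sides of length `2r` and one of length `2r²`. -/
lemma volume_gauge_le {r : ℝ} (hr : 0 < r) :
    volume {ξ : Heis n | gauge ξ ≤ r} ≤ ENNReal.ofReal (2 ^ (2 * n + 1) * r ^ homDim n) := by
  let ρ : Fin n ⊕ Fin n ⊕ Unit → ℝ := Sum.elim (fun _ => r) (Sum.elim (fun _ => r) fun _ => r ^ 2)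
  have hρ : ∀ i, 0 ≤ ρ i := by
    rintro (i | i | i) <;> simp [ρ] <;> positivity
  have hsub : {ξ : Heis n | gauge ξ ≤ r} ⊆
      WithLp.ofLp ⁻¹' (Set.pi Set.univ fun i => Icc (-ρ i) (ρ i)) := by
    intro ξ hξ
    simp only [mem_ofPred_eq] at hξ
    have hz : zsq ξ ≤ r ^ 2 := (zsq_le ξ).trans (by gcongr; exact gauge_nonneg _)
    have hterm : ∀ j : Fin n, ξ (Sum.inl j) ^ 2 + ξ (Sum.inr (Sum.inl j)) ^ 2 ≤ r ^ 2 := fun j =>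
      (Finset.single_le_sum (f := fun j : Fin n => ξ (Sum.inl j) ^ 2 + ξ (Sum.inr (Sum.inl j)) ^ 2)
        (fun j _ => by positivity) (Finset.mem_univ j)).trans hz
    simp only [mem_preimage, mem_pi, mem_univ, forall_true_left, mem_Icc, ← abs_le]
    rintro (j | j | u)
    · exact abs_le_of_sq_le_sq (by
        have := hterm j
        simp only [ρ, Sum.elim_inl]
        nlinarith [sq_nonneg (ξ (Sum.inr (Sum.inl j)))]) hr.le
    · exact abs_le_of_sq_le_sq (by
        have := hterm j
        simp only [ρ, Sum.elim_inl, Sum.elim_inr]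
        nlinarith [sq_nonneg (ξ (Sum.inl j))]) hr.le
    · refine (abs_tc_le ξ).trans ?_
      simp only [ρ, Sum.elim_inr]
      gcongr; exact gauge_nonneg _
  refine (measure_mono hsub).trans ?_
  rw [(PiLp.volume_preserving_ofLp _).measure_preimage
    (MeasurableSet.univ_pi fun i => measurableSet_Icc).nullMeasurableSet, Set.pi_univ_Icc, Real.volume_Icc_pi,
    ← ENNReal.ofReal_prod_of_nonneg (fun i _ => by have := hρ i; linarith)]
  refine ENNReal.ofReal_le_ofReal (le_of_eq ?_)
  simp only [Fintype.prod_sum_type, ρ, Sum.elim_inl, Sum.elim_inr, sub_neg_eq_add]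
  have : r ^ homDim n = r ^ (2 * n + 2) := by
    rw [← Real.rpow_natCast, homDim]; push_cast; rfl
  rw [this]
  simp
  ring

/-- Left translation is a Euclidean translation composed with a transvection of determinant one, so
it preserves Lebesgue measure. -/
lemma volume_gdist_le (ξ : Heis n) {r : ℝ} (hr : 0 < r) :
    volume {η : Heis n | gdist ξ η ≤ r} ≤ ENNReal.ofReal (2 ^ (2 * n + 1) * r ^ homDim n) := by
  let f : Module.Dual ℝ (Heis n) :=
    { toFun := fun η => -skew ξ η
      map_add' := fun x y => by rw [skew_add_right]; ring
      map_smul' := fun c x => by rw [skew_smul_right]; simp }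
  have hdet : LinearMap.det (LinearMap.transvection f (central n)) = 1 := by
    rw [LinearMap.transvection.det]
    change 1 + -skew ξ (central n) = 1
    simp
  have e : {η : Heis n | gdist ξ η ≤ r} = LinearMap.transvection f (central n) ⁻¹'
      ((fun x => -ξ + x) ⁻¹' {ζ : Heis n | gauge ζ ≤ r}) := by
    ext η
    simp only [mem_ofPred_eq, mem_preimage, LinearMap.transvection.apply]
    rw [gdist_comm, gdist, mul_eq, skew_neg_left, add_assoc]
    rfl
  rw [e, Measure.addHaar_preimage_linearMap _ (by rw [hdet]; exact one_ne_zero), hdet,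
    measure_preimage_add]
  simpa using volume_gauge_le hr

lemma shell_lintegral_le (c : ℝ) (hc : c < homDim n) (ξ : Heis n) {t : ℝ} (ht : 0 < t) :
    ∫⁻ η in {η | t ≤ gdist ξ η ∧ gdist ξ η ≤ 2 * t},
      ENNReal.ofReal (gdist ξ η ^ (c - homDim n)) ≤
      ENNReal.ofReal (2 ^ (2 * n + 1) * 2 ^ homDim n * t ^ c) := by
  calc _ ≤ ∫⁻ η in {η | t ≤ gdist ξ η ∧ gdist ξ η ≤ 2 * t},
        ENNReal.ofReal (t ^ (c - homDim n)) := by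
        refine setLIntegral_mono measurable_const fun η hη => ENNReal.ofReal_le_ofReal ?_
        exact Real.rpow_le_rpow_of_nonpos ht hη.1 (by linarith)
    _ = ENNReal.ofReal (t ^ (c - homDim n)) * volume {η | t ≤ gdist ξ η ∧ gdist ξ η ≤ 2 * t} := by
        rw [setLIntegral_const]
    _ ≤ ENNReal.ofReal (t ^ (c - homDim n)) *
        ENNReal.ofReal (2 ^ (2 * n + 1) * (2 * t) ^ homDim n) := by
        gcongr
        exact (measure_mono fun η hη => hη.2).trans (volume_gdist_le ξ (by positivity))
    _ = _ := by
        rw [← ENNReal.ofReal_mul (by positivity), Real.mul_rpow zero_le_two ht.le,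
          Real.rpow_sub ht]
        congr 1
        field_simp

lemma pow_rpow_comm {x : ℝ} (hx : 0 ≤ x) (k : ℕ) (c : ℝ) : (x ^ k) ^ c = (x ^ c) ^ k := by
  rw [← Real.rpow_natCast, ← Real.rpow_mul hx, ← Real.rpow_natCast, ← Real.rpow_mul hx, mul_comm]

lemma tsum_ofReal_geometric {K x : ℝ} (hK : 0 ≤ K) (hx0 : 0 ≤ x) (hx1 : x < 1) :
    ∑' k : ℕ, ENNReal.ofReal (K * x ^ k) = ENNReal.ofReal (K * (1 - x)⁻¹) := by
  rw [← ENNReal.ofReal_tsum_of_nonneg (fun k => by positivity)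
    ((summable_geometric_of_lt_one hx0 hx1).mul_left K), tsum_mul_left,
    tsum_geometric_of_lt_one hx0 hx1]

/-- On the shell at distance about `ρ 2^{-k}` the integral is of order `(ρ 2^{-k})^c`, a geometric
series because `c > 0`. -/
lemma near_lintegral_le {c : ℝ} (hc0 : 0 < c) (hc : c < homDim n) :
    ∃ C : ℝ, 0 ≤ C ∧ ∀ (ξ : Heis n) (ρ : ℝ), 0 < ρ →
      ∫⁻ η in {η | gdist ξ η < ρ}, ENNReal.ofReal (gdist ξ η ^ (c - homDim n))
        ≤ ENNReal.ofReal (C * ρ ^ c) := by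
  set A : ℝ := 2 ^ (2 * n + 1) * 2 ^ homDim n
  have hx1 : (1 / 2 : ℝ) ^ c < 1 := Real.rpow_lt_one (by norm_num) (by norm_num) hc0
  have hx2 : 0 < 1 - (1 / 2 : ℝ) ^ c := by linarith
  refine ⟨A * (1 / 2) ^ c * (1 - (1 / 2) ^ c)⁻¹, by positivity, fun ξ ρ hρ => ?_⟩
  let S : ℕ → Set (Heis n) := fun k =>
    {η | ρ * (1 / 2) ^ (k + 1) ≤ gdist ξ η ∧ gdist ξ η ≤ 2 * (ρ * (1 / 2) ^ (k + 1))}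
  have hcov : {η | gdist ξ η < ρ} ⊆ {η | gdist ξ η = 0} ∪ ⋃ k, S k := by
    intro η hη
    rcases (gdist_nonneg ξ η).eq_or_lt with h | h
    · exact Or.inl h.symm
    · right
      obtain ⟨k, hk1, hk2⟩ := exists_nat_pow_near_of_lt_one (div_pos h hρ)
        ((div_le_one hρ).2 (le_of_lt hη)) (by norm_num : (0 : ℝ) < 1 / 2) (by norm_num)
      rw [lt_div_iff₀ hρ] at hk1
      rw [div_le_iff₀ hρ] at hk2
      refine mem_iUnion.2 ⟨k, by linarith, ?_⟩
      rw [pow_succ]; linarith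
  -- At distance zero the integrand is `0`, since `0` to a nonzero real power is `0` in `Real.rpow`.
  have hz : ∫⁻ η in {η | gdist ξ η = 0}, ENNReal.ofReal (gdist ξ η ^ (c - homDim n)) = 0 := by
    have hm : MeasurableSet {η | gdist ξ η = 0} :=
      measurable_gdist ξ (measurableSet_singleton 0)
    rw [setLIntegral_congr_fun (g := fun _ => 0) hm]
    · simp
    · intro η hη
      simp only [mem_ofPred_eq] at hη
      simp only [hη, Real.zero_rpow (by linarith : c - homDim n ≠ 0), ENNReal.ofReal_zero]
  calc _ ≤ ∫⁻ η in {η | gdist ξ η = 0} ∪ ⋃ k, S k, ENNReal.ofReal (gdist ξ η ^ (c - homDim n)) :=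
        lintegral_mono_set hcov
    _ ≤ 0 + ∑' k, ∫⁻ η in S k, ENNReal.ofReal (gdist ξ η ^ (c - homDim n)) := by
        refine (lintegral_union_le _ _ _).trans ?_
        rw [hz]
        gcongr
        exact lintegral_iUnion_le _ _
    _ ≤ ∑' k : ℕ, ENNReal.ofReal (A * (1 / 2) ^ c * ρ ^ c * ((1 / 2) ^ c) ^ k) := by
        rw [zero_add]
        refine ENNReal.tsum_le_tsum fun k => ?_
        refine (shell_lintegral_le c hc ξ (by positivity)).trans
          (ENNReal.ofReal_le_ofReal (le_of_eq ?_))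
        rw [Real.mul_rpow hρ.le (by positivity), pow_rpow_comm (by norm_num), pow_succ]
        ring
    _ = _ := by
        rw [tsum_ofReal_geometric (by positivity) (by positivity) hx1]
        congr 1; ring

/-- The same shells, now growing; the series converges because `c < 0`. -/
lemma far_lintegral_le {c : ℝ} (hc0 : c < 0) :
    ∃ C : ℝ, 0 ≤ C ∧ ∀ (ξ : Heis n) (ρ : ℝ), 0 < ρ →
      ∫⁻ η in {η | ρ ≤ gdist ξ η}, ENNReal.ofReal (gdist ξ η ^ (c - homDim n))
        ≤ ENNReal.ofReal (C * ρ ^ c) := by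
  set A : ℝ := 2 ^ (2 * n + 1) * 2 ^ homDim n
  have hx1 : (2 : ℝ) ^ c < 1 := Real.rpow_lt_one_of_one_lt_of_neg one_lt_two hc0
  have hx2 : 0 < 1 - (2 : ℝ) ^ c := by linarith
  refine ⟨A * (1 - 2 ^ c)⁻¹, by positivity, fun ξ ρ hρ => ?_⟩
  let S : ℕ → Set (Heis n) := fun k =>
    {η | ρ * 2 ^ k ≤ gdist ξ η ∧ gdist ξ η ≤ 2 * (ρ * 2 ^ k)}
  have hcov : {η | ρ ≤ gdist ξ η} ⊆ ⋃ k, S k := by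
    intro η hη
    obtain ⟨k, hk1, hk2⟩ := exists_nat_pow_near ((one_le_div hρ).2 hη) (one_lt_two : (1 : ℝ) < 2)
    rw [le_div_iff₀ hρ] at hk1
    rw [div_lt_iff₀ hρ] at hk2
    refine mem_iUnion.2 ⟨k, by linarith, ?_⟩
    rw [pow_succ] at hk2; linarith
  calc _ ≤ ∫⁻ η in ⋃ k, S k, ENNReal.ofReal (gdist ξ η ^ (c - homDim n)) :=
        lintegral_mono_set hcov
    _ ≤ ∑' k, ∫⁻ η in S k, ENNReal.ofReal (gdist ξ η ^ (c - homDim n)) :=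
        lintegral_iUnion_le _ _
    _ ≤ ∑' k : ℕ, ENNReal.ofReal (A * ρ ^ c * (2 ^ c) ^ k) := by
        refine ENNReal.tsum_le_tsum fun k => ?_
        refine (shell_lintegral_le c (hc0.trans (homDim_pos n)) ξ (by positivity)).trans
          (ENNReal.ofReal_le_ofReal (le_of_eq ?_))
        rw [Real.mul_rpow hρ.le (by positivity), pow_rpow_comm (by norm_num)]
        ring
    _ = _ := by
        rw [tsum_ofReal_geometric (by positivity) (by positivity) hx1]
        congr 1; ring

/-! ### Integrable majorants -/

/-- `Φ` has an integrable majorant on `Ω` with integral at most `B`. -/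
def Dominated (Ω : Set (Heis n)) (Φ : Heis n → ℝ) (B : ℝ) : Prop :=
  ∃ E : Heis n → ℝ, IntegrableOn E Ω ∧ (∀ᵐ η ∂volume.restrict Ω, |Φ η| ≤ E η) ∧ ∫ η in Ω, E η ≤ B

lemma Dominated.abs_integral_le {Ω : Set (Heis n)} {Φ : Heis n → ℝ} {B : ℝ}
    (h : Dominated Ω Φ B) : |∫ η in Ω, Φ η| ≤ B := by
  obtain ⟨E, hE, hΦ, hB⟩ := h
  exact (norm_integral_le_of_norm_le (f := Φ) hE hΦ).trans hB

lemma Dominated.integrableOn {Ω : Set (Heis n)} {Φ : Heis n → ℝ} {B : ℝ}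
    (h : Dominated Ω Φ B) (hm : AEStronglyMeasurable Φ (volume.restrict Ω)) :
    IntegrableOn Φ Ω := by
  obtain ⟨E, hE, hΦ, hB⟩ := h
  exact Integrable.mono' hE hm hΦ

lemma Dominated.mono {Ω : Set (Heis n)} {Φ Ψ : Heis n → ℝ} {B B' : ℝ}
    (h : Dominated Ω Φ B) (hΨ : ∀ᵐ η ∂volume.restrict Ω, |Ψ η| ≤ |Φ η|) (hB : B ≤ B') :
    Dominated Ω Ψ B' := by
  obtain ⟨E, hE, hΦ, hB1⟩ := h
  refine ⟨E, hE, ?_, hB1.trans hB⟩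
  filter_upwards [hΦ, hΨ] with η h1 h2 using h2.trans h1

lemma Dominated.add {Ω : Set (Heis n)} {Φ Ψ : Heis n → ℝ} {B B' : ℝ}
    (h : Dominated Ω Φ B) (h' : Dominated Ω Ψ B') :
    Dominated Ω (fun η => Φ η + Ψ η) (B + B') := by
  obtain ⟨E, hE, hΦ, hB⟩ := h
  obtain ⟨E', hE', hΦ', hB'⟩ := h'
  refine ⟨fun η => E η + E' η, Integrable.add hE hE', ?_, ?_⟩
  · filter_upwards [hΦ, hΦ'] with η h1 h2 using (abs_add_le _ _).trans (add_le_add h1 h2)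
  · rw [integral_add hE hE']; exact add_le_add hB hB'

lemma Dominated.const_mul {Ω : Set (Heis n)} {Φ : Heis n → ℝ} {B : ℝ} {c : ℝ} (hc : 0 ≤ c)
    (h : Dominated Ω Φ B) : Dominated Ω (fun η => c * Φ η) (c * B) := by
  obtain ⟨E, hE, hΦ, hB⟩ := h
  refine ⟨fun η => c * E η, Integrable.const_mul hE c, ?_, ?_⟩
  · filter_upwards [hΦ] with η h1
    rw [abs_mul, abs_of_nonneg hc]; gcongr
  · rw [integral_const_mul]; gcongr

lemma dominated_indicator {Ω S : Set (Heis n)} (hS : MeasurableSet S)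
    {f : Heis n → ℝ} (hf : Measurable f) (hf0 : ∀ η, 0 ≤ f η) {B : ℝ} (hB : 0 ≤ B)
    (h : ∫⁻ η in S, ENNReal.ofReal (f η) ≤ ENNReal.ofReal B) :
    Dominated Ω (S.indicator f) B := by
  have hint : IntegrableOn f S := by
    refine ⟨hf.aestronglyMeasurable, ?_⟩
    rw [hasFiniteIntegral_iff_ofReal (Filter.Eventually.of_forall hf0)]
    exact h.trans_lt ENNReal.ofReal_lt_top
  have hint' : Integrable (S.indicator f) := (integrable_indicator_iff hS).2 hint
  refine ⟨S.indicator f, hint'.integrableOn, Filter.Eventually.of_forall fun η => ?_, ?_⟩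
  · rw [abs_of_nonneg (indicator_nonneg (fun x _ => hf0 x) η)]
  · refine (setIntegral_le_integral hint' (Filter.Eventually.of_forall fun η =>
      indicator_nonneg (fun x _ => hf0 x) η)).trans ?_
    rw [integral_indicator hS, integral_eq_lintegral_of_nonneg_ae
      (Filter.Eventually.of_forall hf0) hf.aestronglyMeasurable]
    exact ENNReal.toReal_le_of_le_ofReal hB h

lemma measurable_gdist_rpow (ξ : Heis n) (d : ℝ) : Measurable fun η => gdist ξ η ^ d :=
  (measurable_gdist ξ).pow_const d

lemma dominated_near {c : ℝ} (hc0 : 0 < c) (hc : c < homDim n) :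
    ∃ C : ℝ, 0 ≤ C ∧ ∀ (Ω : Set (Heis n)) (ξ : Heis n) (ρ : ℝ), 0 < ρ →
      Dominated Ω ({η | gdist ξ η < ρ}.indicator fun η => gdist ξ η ^ (c - homDim n))
        (C * ρ ^ c) := by
  obtain ⟨C, hC, H⟩ := near_lintegral_le hc0 hc
  exact ⟨C, hC, fun Ω ξ ρ hρ => dominated_indicator
    (measurable_gdist ξ measurableSet_Iio) (measurable_gdist_rpow ξ _)
    (fun η => Real.rpow_nonneg (gdist_nonneg _ _) _) (by positivity) (H ξ ρ hρ)⟩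

lemma dominated_far {c : ℝ} (hc0 : c < 0) :
    ∃ C : ℝ, 0 ≤ C ∧ ∀ (Ω : Set (Heis n)) (ξ : Heis n) (ρ : ℝ), 0 < ρ →
      Dominated Ω ({η | ρ ≤ gdist ξ η}.indicator fun η => gdist ξ η ^ (c - homDim n))
        (C * ρ ^ c) := by
  obtain ⟨C, hC, H⟩ := far_lintegral_le (n := n) hc0
  exact ⟨C, hC, fun Ω ξ ρ hρ => dominated_indicator
    (measurable_gdist ξ measurableSet_Ici) (measurable_gdist_rpow ξ _)
    (fun η => Real.rpow_nonneg (gdist_nonneg _ _) _) (by positivity) (H ξ ρ hρ)⟩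

/-- Beyond distance one the power is at most one, which the finite volume of `Ω` absorbs; this makes
the bound uniform in `ξ`. -/
lemma dominated_gdist {c : ℝ} (hc0 : 0 < c) (hc : c < homDim n) {Ω : Set (Heis n)}
    (hΩv : volume Ω < ⊤) :
    ∃ C : ℝ, 0 ≤ C ∧ ∀ ξ : Heis n, Dominated Ω (fun η => gdist ξ η ^ (c - homDim n)) C := by
  obtain ⟨C, hC, H⟩ := dominated_near hc0 hc
  have h1 : Dominated Ω (fun _ => (1 : ℝ)) (volume.real Ω) :=
    ⟨fun _ => 1, integrableOn_const hΩv.ne, Filter.Eventually.of_forall fun _ => by simp, by simp⟩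
  refine ⟨C * 1 ^ c + volume.real Ω, by positivity, fun ξ => ?_⟩
  refine ((H Ω ξ 1 one_pos).add h1).mono (Filter.Eventually.of_forall fun η => ?_) le_rfl
  have h0 : 0 ≤ gdist ξ η ^ (c - homDim n) := Real.rpow_nonneg (gdist_nonneg _ _) _
  have h2 : 0 ≤ {η | gdist ξ η < 1}.indicator (fun η => gdist ξ η ^ (c - homDim n)) η :=
    indicator_nonneg (fun x _ => Real.rpow_nonneg (gdist_nonneg _ _) _) η
  rw [abs_of_nonneg h0, abs_of_nonneg (by linarith)]
  by_cases h : gdist ξ η < 1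
  · rw [indicator_of_mem (by exact h)]; linarith
  · have : gdist ξ η ^ (c - homDim n) ≤ 1 :=
      Real.rpow_le_one_of_one_le_of_nonpos (not_lt.1 h) (by linarith)
    linarith

/-- The far part of a weakly singular difference. -/
lemma dominated_far_diff {b c N : ℝ} (hb : 0 < b) (hbc : b ≤ c) (hbN : b ≤ N)
    (h : b < c ∨ b < N) (hc : c < homDim n) {Ω : Set (Heis n)}
    (hΩv : volume Ω < ⊤) :
    ∃ C : ℝ, 0 ≤ C ∧ ∀ (ξ : Heis n) (r : ℝ), 0 < r →
      Dominated Ω ({η | 2 * r ≤ gdist ξ η}.indicator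
        fun η => r ^ N * gdist ξ η ^ (c - N - homDim n)) (C * r ^ b) := by
  -- If `b < c`, then `r^{N-b}` is absorbed by `gdist^{N-b}` and the power `c - b - Q` is still
  -- locally integrable. If `b = c`, the degree `b - N < 0` makes the tail converge at infinity.
  -- With `b = c = N` a logarithm would appear.
  rcases hbc.lt_or_eq with h1 | rfl
  · obtain ⟨C, hC, H⟩ := dominated_gdist (c := c - b) (by linarith) (by linarith) hΩv
    refine ⟨C, hC, fun ξ r hr => ?_⟩
    rw [mul_comm C]
    refine ((H ξ).const_mul (c := r ^ b) (by positivity)).mono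
      (Filter.Eventually.of_forall fun η => ?_) le_rfl
    by_cases hη : 2 * r ≤ gdist ξ η
    · rw [indicator_of_mem (by exact hη)]
      have hg : 0 < gdist ξ η := by linarith
      rw [abs_of_nonneg (by positivity), abs_of_nonneg (by positivity)]
      have e1 : r ^ N = r ^ b * r ^ (N - b) := by rw [← Real.rpow_add hr]; congr 1; ring
      have e2 : gdist ξ η ^ (c - b - homDim n) =
          gdist ξ η ^ (N - b) * gdist ξ η ^ (c - N - homDim n) := by
        rw [← Real.rpow_add hg]; congr 1; ring
      rw [e1, e2, mul_assoc]
      gcongr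
      linarith
    · rw [indicator_of_notMem (by exact hη)]; simp; positivity
  · have hN : b < N := h.resolve_left (lt_irrefl b)
    obtain ⟨C, hC, H⟩ := dominated_far (n := n) (c := b - N) (by linarith)
    refine ⟨C * 2 ^ (b - N), by positivity, fun ξ r hr => ?_⟩
    refine ((H Ω ξ (2 * r) (by positivity)).const_mul (c := r ^ N) (by positivity)).mono
      (Filter.Eventually.of_forall fun η => ?_) (le_of_eq ?_)
    · refine le_of_eq ?_
      congr 1
      by_cases hη : 2 * r ≤ gdist ξ η
      · rw [indicator_of_mem (by exact hη), indicator_of_mem (by exact hη)]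
      · rw [indicator_of_notMem (by exact hη), indicator_of_notMem (by exact hη), mul_zero]
    · rw [Real.mul_rpow zero_le_two hr.le, Real.rpow_sub hr]
      field_simp

/-! ### Homogeneous kernels -/

/-- Functions smooth away from the origin and homogeneous of degree `d`. -/
def IsKernel (d : ℝ) (K : Heis n → ℝ) : Prop :=
  ContDiffOn ℝ (⊤ : ℕ∞) K {0}ᶜ ∧ ∀ r : ℝ, 0 < r → ∀ ξ, ξ ≠ 0 → K (dil r ξ) = r ^ d * K ξ

/-- The left invariant differential of `K` at `ζ` in the direction `η`. -/
def leftDiff (K : Heis n → ℝ) (ζ η : Heis n) : ℝ :=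
  fderiv ℝ K ζ (η + skew ζ η • central n)

lemma isOpen_compl_zero : IsOpen ({0}ᶜ : Set (Heis n)) := isOpen_compl_singleton

lemma IsKernel.contDiffAt {d : ℝ} {K : Heis n → ℝ} (hK : IsKernel d K) {ζ : Heis n} (hζ : ζ ≠ 0) :
    ContDiffAt ℝ (⊤ : ℕ∞) K ζ :=
  hK.1.contDiffAt (isOpen_compl_zero.mem_nhds hζ)

lemma IsKernel.differentiableAt {d : ℝ} {K : Heis n → ℝ} (hK : IsKernel d K) {ζ : Heis n}
    (hζ : ζ ≠ 0) : DifferentiableAt ℝ K ζ :=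
  (hK.contDiffAt hζ).differentiableAt (by simp)

lemma IsKernel.contDiffOn_fderiv {d : ℝ} {K : Heis n → ℝ} (hK : IsKernel d K) :
    ContDiffOn ℝ (⊤ : ℕ∞) (fderiv ℝ K) {0}ᶜ :=
  hK.1.fderiv_of_isOpen isOpen_compl_zero (by simp)

lemma IsKernel.measurable {d : ℝ} {K : Heis n → ℝ} (hK : IsKernel d K) : Measurable K :=
  measurable_of_continuousOn_compl_singleton 0 hK.1.continuousOn

lemma mul_smul_eq (ζ η : Heis n) (s : ℝ) :
    mul ζ (s • η) = ζ + s • (η + skew ζ η • central n) := by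
  rw [mul_eq, skew_smul_right]; module

lemma hasDerivAt_mul_smul {K : Heis n → ℝ} {ζ : Heis n} (hK : DifferentiableAt ℝ K ζ)
    (η : Heis n) : HasDerivAt (fun s : ℝ => K (mul ζ (s • η))) (leftDiff K ζ η) 0 := by
  have := hK.hasFDerivAt.hasLineDerivAt (η + skew ζ η • central n)
  simp only [mul_smul_eq]
  exact this

/-- Dilations are automorphisms, so this is the derivative at `s = 0` of homogeneity along `ζ ·
(sη)`. -/
lemma IsKernel.leftDiff_dil {d : ℝ} {K : Heis n → ℝ} (hK : IsKernel d K) {r : ℝ} (hr : 0 < r)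
    {ζ : Heis n} (hζ : ζ ≠ 0) (η : Heis n) :
    leftDiff K (dil r ζ) (dil r η) = r ^ d * leftDiff K ζ η := by
  have h1 := hasDerivAt_mul_smul (hK.differentiableAt (dil_ne_zero hr hζ)) (dil r η)
  have h2 := (hasDerivAt_mul_smul (hK.differentiableAt hζ) η).const_mul (r ^ d)
  refine h1.unique (h2.congr_of_eventuallyEq ?_)
  have hc : Continuous fun s : ℝ => mul ζ (s • η) :=
    continuous_mul.comp (continuous_const.prodMk (continuous_id.smul continuous_const))
  have : ∀ᶠ s : ℝ in nhds 0, mul ζ (s • η) ≠ 0 :=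
    hc.continuousAt.eventually_ne (by simpa using hζ)
  filter_upwards [this] with s hs
  rw [← dil_smul, ← dil_mul, hK.2 r hr _ hs]

lemma fieldDeriv_horiz_eq {K : Heis n → ℝ} {ζ : Heis n} (hK : DifferentiableAt ℝ K ζ)
    (a : Fin n ⊕ Fin n) : fieldDeriv (horiz a) K ζ = fderiv ℝ K ζ (horiz a ζ) :=
  hK.lineDeriv_eq_fderiv

lemma leftDiff_smul_hvec {K : Heis n → ℝ} {ζ : Heis n} (hK : DifferentiableAt ℝ K ζ)
    (a : Fin n ⊕ Fin n) (s : ℝ) :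
    leftDiff K ζ (s • hvec a) = s * fieldDeriv (horiz a) K ζ := by
  rw [fieldDeriv_horiz_eq hK, horiz_eq, leftDiff, skew_smul_right, ← smul_eq_mul, ← smul_eq_mul,
    ← map_smul, smul_assoc, ← smul_add]

lemma IsKernel.fieldDeriv {d : ℝ} {K : Heis n → ℝ} (hK : IsKernel d K) (a : Fin n ⊕ Fin n) :
    IsKernel (d - 1) (fieldDeriv (horiz a) K) := by
  constructor
  · have h1 : ContDiffOn ℝ (⊤ : ℕ∞) (fun ζ => fderiv ℝ K ζ (horiz a ζ)) {0}ᶜ := by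
      refine hK.contDiffOn_fderiv.clm_apply (ContDiff.contDiffOn ?_)
      have : (horiz a : Heis n → Heis n) = fun ζ => hvec a + skew ζ (hvec a) • central n :=
        funext (horiz_eq a)
      rw [this]
      unfold skew; fun_prop
    exact h1.congr fun ζ hζ => fieldDeriv_horiz_eq (hK.differentiableAt hζ) a
  · intro r hr ζ hζ
    have h := hK.leftDiff_dil hr hζ (hvec a)
    rw [dil_hvec, leftDiff_smul_hvec (hK.differentiableAt (dil_ne_zero hr hζ)),
      ← one_smul ℝ (hvec a), leftDiff_smul_hvec (hK.differentiableAt hζ), one_mul] at h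
    rw [Real.rpow_sub_one hr.ne', div_mul_eq_mul_div, ← h]
    field_simp

lemma isKernel_gauge_rpow (d : ℝ) : IsKernel d (fun ξ : Heis n => gauge ξ ^ d) := by
  constructor
  · have e : ∀ ξ : Heis n, gauge ξ ^ d = (zsq ξ ^ 2 + tc ξ ^ 2) ^ (d / 4) := fun ξ => by
      rw [gauge_eq, ← Real.rpow_mul (by positivity)]; congr 1; ring
    simp only [e]
    have hc : ContDiff ℝ (⊤ : ℕ∞) fun ξ : Heis n => zsq ξ ^ 2 + tc ξ ^ 2 := by
      unfold zsq tc; fun_prop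
    refine hc.contDiffOn.rpow_const_of_ne fun ξ hξ => ?_
    rw [← gauge_pow_four]
    exact (pow_pos (gauge_pos hξ) 4).ne'
  · intro r hr ξ _
    simp only
    rw [gauge_dil hr.le, Real.mul_rpow hr.le (gauge_nonneg _)]

/-- The compact shell `1/2 ≤ |ζ| ≤ 3/2`. -/
def shell (n : ℕ) : Set (Heis n) := {ζ | 1 / 2 ≤ gauge ζ ∧ gauge ζ ≤ 3 / 2}

lemma isCompact_shell : IsCompact (shell n) := by
  refine Metric.isCompact_of_isClosed_isBounded ?_ ?_
  · exact (isClosed_le continuous_const continuous_gauge).inter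
      (isClosed_le continuous_gauge continuous_const)
  · refine (Metric.isBounded_closedBall (x := (0 : Heis n)) (r := 4)).subset fun ζ hζ => ?_
    have h := norm_le_gauge ζ
    rw [mem_closedBall_zero_iff]
    nlinarith [hζ.2, gauge_nonneg ζ]

lemma shell_subset : shell n ⊆ {0}ᶜ := by
  rintro ζ hζ rfl
  have := hζ.1
  norm_num at this

lemma dil_inv_gauge {ζ : Heis n} (hζ : ζ ≠ 0) :
    gauge (dil (gauge ζ)⁻¹ ζ) = 1 ∧ dil (gauge ζ) (dil (gauge ζ)⁻¹ ζ) = ζ := by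
  have h := gauge_pos hζ
  rw [gauge_dil (by positivity), dil_dil, mul_inv_cancel₀ h.ne', inv_mul_cancel₀ h.ne', dil_one]
  simp

/-- By homogeneity it suffices to bound `K` where the gauge is one, inside a compact shell on which
it is continuous. -/
lemma IsKernel.bound {d : ℝ} {K : Heis n → ℝ} (hK : IsKernel d K) :
    ∃ C : ℝ, 0 ≤ C ∧ ∀ ζ, ζ ≠ 0 → |K ζ| ≤ C * gauge ζ ^ d := by
  obtain ⟨C, hC⟩ := isCompact_shell.exists_bound_of_continuousOn
    (hK.1.continuousOn.mono shell_subset)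
  refine ⟨|C|, abs_nonneg C, fun ζ hζ => ?_⟩
  obtain ⟨h1, h2⟩ := dil_inv_gauge hζ
  have h3 := hC (dil (gauge ζ)⁻¹ ζ) ⟨by rw [h1]; norm_num, by rw [h1]; norm_num⟩
  have hg := gauge_pos hζ
  conv_lhs => rw [← h2]
  rw [hK.2 _ hg _ (dil_ne_zero (by positivity) hζ), abs_mul, mul_comm,
    abs_of_nonneg (Real.rpow_nonneg hg.le _)]
  exact mul_le_mul_of_nonneg_right (h3.trans (le_abs_self C)) (Real.rpow_nonneg hg.le _)

lemma norm_direction_le {ζ η : Heis n} (hζ : gauge ζ = 1) (hη : gauge η ≤ 1 / 2) :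
    ‖η + skew ζ η • central n‖ ≤ 10 * gauge η := by
  have h1 := norm_le_gauge ζ
  have h2 := norm_le_gauge η
  have h3 := abs_skew_le ζ η
  have h4 := gauge_nonneg η
  rw [hζ] at h1
  refine (norm_add_le _ _).trans ?_
  rw [norm_smul, norm_central, mul_one, Real.norm_eq_abs]
  have h5 : ‖η‖ ≤ 2 * gauge η := by nlinarith
  have h6 : 2 * ‖ζ‖ * ‖η‖ ≤ 4 * ‖η‖ := by nlinarith [norm_nonneg η]
  linarith

lemma abs_sub_le_of_deriv_Icc {m m' : ℝ → ℝ} {K t : ℝ} (ht : t ∈ Icc (0 : ℝ) 1)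
    (h : ∀ u ∈ Icc (0 : ℝ) 1, HasDerivAt m (m' u) u)
    (hK : ∀ u ∈ Icc (0 : ℝ) 1, |m' u| ≤ K) : |m t - m 0| ≤ K := by
  have := Convex.norm_image_sub_le_of_norm_hasDerivWithin_le (f := m) (f' := m') (C := K)
    (s := Icc (0 : ℝ) 1) (x := 0) (y := t) (fun x hx => (h x hx).hasDerivWithinAt)
    (fun x hx => by simpa using hK x hx) (convex_Icc 0 1) (by simp) ht
  have hK0 : 0 ≤ K := (abs_nonneg _).trans (hK 0 (by simp))
  rw [Real.norm_eq_abs, Real.norm_eq_abs, sub_zero, abs_of_nonneg ht.1] at this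
  nlinarith [ht.2]

/-- The curve `u ↦ ζ · (uη)` is a straight segment with direction of norm at most `10|η|`, and `|η|
≤ 1/2` keeps it in the compact shell. The Euclidean Taylor formula with bounded first and second
derivatives then applies. -/
lemma IsKernel.taylor_unit {d : ℝ} {K : Heis n → ℝ} (hK : IsKernel d K) :
    ∃ C : ℝ, 0 ≤ C ∧ ∀ ζ η, gauge ζ = 1 → gauge η ≤ 1 / 2 →
      |K (mul ζ η) - K ζ| ≤ C * gauge η ∧
      |K (mul ζ η) - K ζ - leftDiff K ζ η| ≤ C * gauge η ^ 2 := by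
  obtain ⟨C₁, hC₁⟩ := isCompact_shell.exists_bound_of_continuousOn
    (hK.contDiffOn_fderiv.continuousOn.mono shell_subset)
  have hD2 : ContDiffOn ℝ (⊤ : ℕ∞) (fderiv ℝ (fderiv ℝ K)) {0}ᶜ :=
    hK.contDiffOn_fderiv.fderiv_of_isOpen isOpen_compl_zero (by simp)
  obtain ⟨C₂, hC₂⟩ := isCompact_shell.exists_bound_of_continuousOn
    (f := fderiv ℝ (fderiv ℝ K)) (hD2.continuousOn.mono shell_subset)
  refine ⟨|C₁| * 10 + |C₂| * 100, by positivity, fun ζ η hζ hη => ?_⟩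
  have hL := norm_direction_le hζ hη
  have hη0 := gauge_nonneg η
  set L := η + skew ζ η • central n with hLdef
  have hmem : ∀ u ∈ Icc (0 : ℝ) 1, ζ + u • L ∈ shell n := fun u hu => by
    rw [hLdef, ← mul_smul_eq]
    have hu' : |u| ≤ 1 := by rw [abs_of_nonneg hu.1]; exact hu.2
    have h1 := gauge_smul_le η hu'
    have h2 := gauge_mul_le ζ (u • η)
    have h3 := gauge_le_mul_add ζ (u • η)
    constructor <;> linarith
  have hφ : ∀ u ∈ Icc (0 : ℝ) 1, HasDerivAt (fun u : ℝ => K (ζ + u • L))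
      (fderiv ℝ K (ζ + u • L) L) u := fun u hu => by
    have h1 := (hK.differentiableAt (shell_subset (hmem u hu))).hasFDerivAt
    have h2 : HasDerivAt (fun u : ℝ => ζ + u • L) L u := by
      simpa using ((hasDerivAt_id u).smul_const L).const_add ζ
    exact h1.comp_hasDerivAt u h2
  have hψ : ∀ u ∈ Icc (0 : ℝ) 1, HasDerivAt (fun u : ℝ => fderiv ℝ K (ζ + u • L) L)
      (fderiv ℝ (fderiv ℝ K) (ζ + u • L) L L) u := fun u hu => by
    have h1 := ((hK.contDiffOn_fderiv.contDiffAt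
      (isOpen_compl_zero.mem_nhds (shell_subset (hmem u hu)))).differentiableAt (by simp)).hasFDerivAt
    have h2 : HasDerivAt (fun u : ℝ => ζ + u • L) L u := by
      simpa using ((hasDerivAt_id u).smul_const L).const_add ζ
    have h3 := h1.comp_hasDerivAt u h2
    exact (ContinuousLinearMap.apply ℝ ℝ L).hasFDerivAt.comp_hasDerivAt u h3
  have e1 : mul ζ η = ζ + (1 : ℝ) • L := by rw [hLdef, ← mul_smul_eq, one_smul]
  have b1 : ∀ u ∈ Icc (0 : ℝ) 1, |fderiv ℝ K (ζ + u • L) L| ≤ |C₁| * (10 * gauge η) :=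
    fun u hu => by
      rw [← Real.norm_eq_abs]
      refine (ContinuousLinearMap.le_opNorm _ _).trans ?_
      gcongr
      exact (hC₁ _ (hmem u hu)).trans (le_abs_self _)
  have b2 : ∀ u ∈ Icc (0 : ℝ) 1, |fderiv ℝ (fderiv ℝ K) (ζ + u • L) L L| ≤
      |C₂| * (10 * gauge η) * (10 * gauge η) := fun u hu => by
    rw [← Real.norm_eq_abs]
    refine (ContinuousLinearMap.le_opNorm₂ _ _ _).trans ?_
    gcongr
    exact (hC₂ _ (hmem u hu)).trans (le_abs_self _)
  constructor
  · have := abs_sub_le_of_deriv_Icc (t := 1) (by simp) hφ b1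
    rw [e1]
    simp only [zero_smul, add_zero] at this
    refine this.trans ?_
    have : 0 ≤ |C₂| * 100 * gauge η := by positivity
    linarith
  · have h3 := fun u hu => abs_sub_le_of_deriv_Icc (t := u) hu hψ b2
    simp only [zero_smul, add_zero] at h3
    have h4 := abs_sub_le_of_deriv_Icc (t := 1) (by simp)
      (m := fun u => K (ζ + u • L) - u * fderiv ℝ K ζ L)
      (m' := fun u => fderiv ℝ K (ζ + u • L) L - fderiv ℝ K ζ L)
      (fun u hu => by simpa using (hφ u hu).fun_sub ((hasDerivAt_id u).mul_const (fderiv ℝ K ζ L))) h3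
    simp only [zero_smul, add_zero, one_mul, zero_mul, sub_zero] at h4
    rw [e1, leftDiff, ← hLdef, sub_right_comm]
    refine h4.trans ?_
    have : 0 ≤ |C₁| * 10 * gauge η ^ 2 := by positivity
    nlinarith

/-- Difference and Taylor estimates for homogeneous kernels. -/
lemma IsKernel.taylor {d : ℝ} {K : Heis n → ℝ} (hK : IsKernel d K) :
    ∃ C : ℝ, 0 ≤ C ∧ ∀ ζ η, ζ ≠ 0 → 2 * gauge η ≤ gauge ζ →
      |K (mul ζ η) - K ζ| ≤ C * (gauge η ^ (1 : ℝ) * gauge ζ ^ (d - 1)) ∧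
      |K (mul ζ η) - K ζ - leftDiff K ζ η| ≤ C * (gauge η ^ (2 : ℝ) * gauge ζ ^ (d - 2)) := by
  obtain ⟨C, hC, H⟩ := hK.taylor_unit
  refine ⟨C, hC, fun ζ η hζ hη => ?_⟩
  have hg := gauge_pos hζ
  obtain ⟨h1, h2⟩ := dil_inv_gauge hζ
  set r := gauge ζ with hr
  set ζ' := dil r⁻¹ ζ with hζ'
  set η' := dil r⁻¹ η with hη'
  have hη2 : dil r η' = η := by rw [hη', dil_dil, mul_inv_cancel₀ hg.ne', dil_one]
  have hgη : gauge η' = gauge η / r := by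
    rw [hη', gauge_dil (by positivity), div_eq_inv_mul]
  have hgη2 : gauge η' ≤ 1 / 2 := by
    rw [hgη, div_le_iff₀ hg]; linarith
  have hζ0 : ζ' ≠ 0 := dil_ne_zero (by positivity) hζ
  have hm0 : mul ζ' η' ≠ 0 := fun h => by
    have := gauge_le_mul_add ζ' η'
    rw [h, gauge_zero, h1] at this; linarith
  obtain ⟨b1, b2⟩ := H ζ' η' h1 hgη2
  have e1 : K (mul ζ η) = r ^ d * K (mul ζ' η') := by
    rw [← hK.2 r hg _ hm0, dil_mul, h2, hη2]
  have e2 : K ζ = r ^ d * K ζ' := by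
    rw [← hK.2 r hg _ hζ0, h2]
  have e3 : leftDiff K ζ η = r ^ d * leftDiff K ζ' η' := by
    rw [← hK.leftDiff_dil hg hζ0, h2, hη2]
  have hrd : 0 ≤ r ^ d := by positivity
  rw [e1, e2, e3, ← mul_sub, ← mul_sub, abs_mul, abs_mul, abs_of_nonneg hrd, Real.rpow_one,
    Real.rpow_two, Real.rpow_sub_one hg.ne', Real.rpow_sub hg, Real.rpow_two]
  rw [hgη] at b1 b2
  constructor
  · refine (mul_le_mul_of_nonneg_left b1 hrd).trans (le_of_eq ?_)
    field_simp
  · refine (mul_le_mul_of_nonneg_left b2 hrd).trans (le_of_eq ?_)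
    field_simp

/-! ### Smoothing by convolution with a homogeneous kernel -/

/-- The group convolution `∫_Ω h(η) K(η⁻¹ξ) dη`. -/
def conv (Ω : Set (Heis n)) (h K : Heis n → ℝ) (ξ : Heis n) : ℝ :=
  ∫ η in Ω, h η * K (mul (-η) ξ)

/-- A bounded measurable density on a measurable set of finite measure. -/
structure IsDensity (Ω : Set (Heis n)) (h : Heis n → ℝ) (M : ℝ) : Prop where
  meas : MeasurableSet Ω
  finite : volume Ω < ⊤
  aesm : AEStronglyMeasurable h (volume.restrict Ω)
  nonneg : 0 ≤ M
  bound : ∀ η ∈ Ω, |h η| ≤ M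

lemma mul_neg_ne_zero {ξ η : Heis n} (h : η ≠ ξ) : mul (-η) ξ ≠ 0 := fun e => by
  apply h
  have := congrArg (mul η) e
  rw [← mul_assoc', mul_neg_self, zero_mul', mul_zero'] at this
  exact this.symm

lemma ae_ne_point (Ω : Set (Heis n)) (ξ : Heis n) :
    ∀ᵐ η ∂volume.restrict Ω, mul (-η) ξ ≠ 0 := by
  have : ∀ᵐ η ∂volume.restrict Ω, η ≠ ξ := by
    have := (measure_singleton ξ : (volume : Measure (Heis n)) {ξ} = 0)
    exact ae_restrict_of_ae (compl_mem_ae_iff.2 this)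
  filter_upwards [this] with η h using mul_neg_ne_zero h

/-- The singular kernel `|η⁻¹ξ|^{c-Q}` cut off to `|η⁻¹ξ| < ρ`. -/
def nearKernel (c : ℝ) (ξ : Heis n) (ρ : ℝ) : Heis n → ℝ :=
  {η | gdist ξ η < ρ}.indicator fun η => gdist ξ η ^ (c - homDim n)

lemma nearKernel_nonneg (c : ℝ) (ξ : Heis n) (ρ : ℝ) (η : Heis n) : 0 ≤ nearKernel c ξ ρ η :=
  indicator_nonneg (fun _ _ => Real.rpow_nonneg (gdist_nonneg _ _) _) η

lemma IsKernel.abs_le_near {c : ℝ} {K : Heis n → ℝ} {C : ℝ}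
    (H : ∀ ζ, ζ ≠ 0 → |K ζ| ≤ C * gauge ζ ^ (c - homDim n)) {ξ η : Heis n} {ρ : ℝ}
    (h0 : mul (-η) ξ ≠ 0) (h : gdist ξ η < ρ) :
    |K (mul (-η) ξ)| ≤ C * nearKernel c ξ ρ η := by
  rw [nearKernel, indicator_of_mem (by exact h)]
  exact H _ h0

section Estimates

variable {Ω : Set (Heis n)} {h : Heis n → ℝ} {M : ℝ}

lemma conv_dominated (hh : IsDensity Ω h M) {c : ℝ} (hc0 : 0 < c) (hc : c < homDim n)
    {K : Heis n → ℝ} (hK : IsKernel (c - homDim n) K) :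
    ∃ C : ℝ, 0 ≤ C ∧ ∀ ξ, Dominated Ω (fun η => h η * K (mul (-η) ξ)) C := by
  obtain ⟨C, hC, H⟩ := dominated_gdist hc0 hc hh.finite
  obtain ⟨C', hC', H'⟩ := hK.bound
  have hM := hh.nonneg
  refine ⟨M * C' * C, by positivity, fun ξ => ?_⟩
  refine ((H ξ).const_mul (c := M * C') (by positivity)).mono ?_ le_rfl
  filter_upwards [ae_ne_point Ω ξ, ae_restrict_mem hh.meas] with η h1 h2
  have h0 : 0 ≤ gdist ξ η ^ (c - homDim n) := Real.rpow_nonneg (gdist_nonneg _ _) _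
  rw [abs_mul, abs_of_nonneg (a := _ * _) (by positivity), mul_assoc]
  exact mul_le_mul (hh.bound η h2) (H' _ h1) (abs_nonneg _) hM

lemma measurable_neg_mul (ξ : Heis n) : Measurable fun η : Heis n => mul (-η) ξ :=
  (continuous_neg_mul.comp (continuous_const.prodMk continuous_id)).measurable

lemma conv_integrable (hh : IsDensity Ω h M) {c : ℝ} (hc0 : 0 < c) (hc : c < homDim n)
    {K : Heis n → ℝ} (hK : IsKernel (c - homDim n) K) (ξ : Heis n) :
    IntegrableOn (fun η => h η * K (mul (-η) ξ)) Ω := by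
  obtain ⟨C, -, H⟩ := conv_dominated hh hc0 hc hK
  exact (H ξ).integrableOn
    (hh.aesm.mul (hK.measurable.comp (measurable_neg_mul ξ)).aestronglyMeasurable)

lemma conv_bounded (hh : IsDensity Ω h M) {c : ℝ} (hc0 : 0 < c) (hc : c < homDim n)
    {K : Heis n → ℝ} (hK : IsKernel (c - homDim n) K) :
    ∃ C : ℝ, 0 ≤ C ∧ ∀ ξ, |conv Ω h K ξ| ≤ C := by
  obtain ⟨C, hC, H⟩ := conv_dominated hh hc0 hc hK
  exact ⟨C, hC, fun ξ => (H ξ).abs_integral_le⟩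

/-- The common frame of the difference estimates: a Taylor remainder of order `N` at distance at
least `2r`, and a termwise majorant `Ψ` inside. The factor two is the one required by
`IsKernel.taylor`. -/
lemma abs_integral_le_far_near {b c N : ℝ} (hb : 0 < b) (hbc : b ≤ c) (hbN : b ≤ N)
    (hlt : b < c ∨ b < N) (hc : c < homDim n) (hΩv : volume Ω < ⊤) :
    ∃ C : ℝ, 0 ≤ C ∧ ∀ (Φ Ψ : Heis n → ℝ) (ξ : Heis n) (r A B : ℝ), 0 < r → 0 ≤ A →
      Dominated Ω Ψ (B * r ^ b) → (∀ η, 0 ≤ Ψ η) →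
      (∀ᵐ η ∂volume.restrict Ω,
        (2 * r ≤ gdist ξ η → |Φ η| ≤ A * (r ^ N * gdist ξ η ^ (c - N - homDim n))) ∧
        (gdist ξ η < 2 * r → |Φ η| ≤ Ψ η)) →
      |∫ η in Ω, Φ η| ≤ (A * C + B) * r ^ b := by
  obtain ⟨C, hC, H⟩ := dominated_far_diff hb hbc hbN hlt hc hΩv
  refine ⟨C, hC, fun Φ Ψ ξ r A B hr hA hΨ hΨ0 hΦ => ?_⟩
  refine Dominated.abs_integral_le
    ((((H ξ r hr).const_mul hA).add hΨ).mono ?_ (le_of_eq (by ring)))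
  filter_upwards [hΦ] with η hη
  rcases le_or_gt (2 * r) (gdist ξ η) with h1 | h1
  · rw [indicator_of_mem (by exact h1)]
    have h2 := hη.1 h1
    exact (h2.trans (le_add_of_nonneg_right (hΨ0 η))).trans (le_abs_self _)
  · rw [indicator_of_notMem (by exact not_le.2 h1), mul_zero, zero_add]
    exact (hη.2 h1).trans (le_abs_self _)

/-- The radius is `3r` because a point within `2r` of `ξ` is within `3r` of `ξ · v` when `|v| ≤ r`.
-/
lemma dominated_nearKernel {b c : ℝ} (hc0 : 0 < c) (hc : c < homDim n) (hbc : b ≤ c) :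
    ∃ C : ℝ, 0 ≤ C ∧ ∀ (Ω : Set (Heis n)) (ξ : Heis n) (r : ℝ), 0 < r → r ≤ 1 →
      Dominated Ω (nearKernel c ξ (3 * r)) (C * r ^ b) := by
  obtain ⟨C, hC, H⟩ := dominated_near hc0 hc
  refine ⟨C * 3 ^ c, by positivity, fun Ω ξ r hr hr1 => ?_⟩
  refine (H Ω ξ (3 * r) (by positivity)).mono (Filter.Eventually.of_forall fun η => le_rfl) ?_
  rw [Real.mul_rpow (by norm_num) hr.le, ← mul_assoc]
  gcongr ?_ * ?_
  exact Real.rpow_le_rpow_of_exponent_ge hr hr1 hbc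

lemma gdist_mul_le (ξ v η : Heis n) : gdist (mul ξ v) η ≤ gdist ξ η + gauge v := by
  rw [gdist, ← mul_assoc']; exact gauge_mul_le _ _

/-- Far and near are separated with remainder order `N = 1`. The condition `hlt` excludes `b = c =
1`, where the far part would produce a logarithm. -/
lemma conv_first_diff (hh : IsDensity Ω h M) {b c : ℝ} (hb : 0 < b) (hbc : b ≤ c) (hb1 : b ≤ 1)
    (hlt : b < c ∨ b < 1) (hc : c < homDim n) {K : Heis n → ℝ}
    (hK : IsKernel (c - homDim n) K) :
    ∃ C : ℝ, 0 ≤ C ∧ ∀ ξ v, |conv Ω h K (mul ξ v) - conv Ω h K ξ| ≤ C * gauge v ^ b := by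
  have hc0 : 0 < c := hb.trans_le hbc
  obtain ⟨C₁, hC₁, H₁⟩ := abs_integral_le_far_near hb hbc hb1 hlt hc hh.finite
  obtain ⟨C₂, hC₂, H₂⟩ := dominated_nearKernel hc0 hc hbc
  obtain ⟨C₃, hC₃, H₃⟩ := hK.bound
  obtain ⟨C₄, hC₄, H₄⟩ := hK.taylor
  obtain ⟨C₅, hC₅, H₅⟩ := conv_bounded hh hc0 hc hK
  have hM := hh.nonneg
  refine ⟨M * C₄ * C₁ + M * C₃ * (C₂ + C₂) + 2 * C₅, by positivity, fun ξ v => ?_⟩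
  have hmain : 0 ≤ M * C₄ * C₁ + M * C₃ * (C₂ + C₂) := by positivity
  rcases (gauge_nonneg v).eq_or_lt with h0 | h0
  · rw [gauge_eq_zero.1 h0.symm, mul_zero', sub_self, abs_zero]
    rw [gauge_zero, Real.zero_rpow hb.ne', mul_zero]
  have hp : 0 ≤ gauge v ^ b := by positivity
  rcases le_or_gt (gauge v) 1 with h1 | h1
  · have hI := (integral_sub (conv_integrable hh hc0 hc hK (mul ξ v))
      (conv_integrable hh hc0 hc hK ξ))
    have := H₁ (fun η => h η * K (mul (-η) (mul ξ v)) - h η * K (mul (-η) ξ))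
      (fun η => M * C₃ * (nearKernel c (mul ξ v) (3 * gauge v) η + nearKernel c ξ (3 * gauge v) η))
      ξ (gauge v) (M * C₄) (M * C₃ * (C₂ + C₂)) h0 (by positivity)
      ((((H₂ Ω (mul ξ v) _ h0 h1).add (H₂ Ω ξ _ h0 h1)).const_mul (c := M * C₃)
        (by positivity)).mono (Filter.Eventually.of_forall fun _ => le_rfl) (le_of_eq (by ring)))
      (fun η => mul_nonneg (by positivity)
        (add_nonneg (nearKernel_nonneg _ _ _ _) (nearKernel_nonneg _ _ _ _))) ?_
    · rw [hI] at this
      refine this.trans ?_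
      have : 0 ≤ 2 * C₅ * gauge v ^ b := by positivity
      rw [add_mul _ (2 * C₅)]; linarith
    · filter_upwards [ae_ne_point Ω ξ, ae_ne_point Ω (mul ξ v), ae_restrict_mem hh.meas]
        with η e1 e2 e3
      rw [← mul_sub, abs_mul]
      constructor
      · intro h2
        rw [mul_assoc]
        refine mul_le_mul (hh.bound η e3) ?_ (abs_nonneg _) hM
        have := (H₄ _ v e1 h2).1
        rwa [mul_assoc', sub_right_comm] at this
      · intro h2
        rw [mul_assoc]
        refine mul_le_mul (hh.bound η e3) ?_ (abs_nonneg _) hM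
        refine (abs_sub _ _).trans ?_
        rw [mul_add]
        have := gdist_mul_le ξ v η
        exact add_le_add (IsKernel.abs_le_near H₃ e2 (by linarith))
          (IsKernel.abs_le_near H₃ e1 (by linarith))
  · have : 1 ≤ gauge v ^ b := Real.one_le_rpow h1.le hb.le
    have h2 := abs_sub (conv Ω h K (mul ξ v)) (conv Ω h K ξ)
    have h3 := H₅ (mul ξ v)
    have h4 := H₅ ξ
    nlinarith

/-- The linear Taylor term is odd in `v` and cancels, so the far remainder has order `N = 2` and the
critical case `b = c = 1` needs no logarithm. -/
lemma conv_second_diff (hh : IsDensity Ω h M) (hc : 1 < homDim n) {K : Heis n → ℝ}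
    (hK : IsKernel (1 - homDim n) K) :
    ∃ C : ℝ, 0 ≤ C ∧ ∀ ξ v,
      |conv Ω h K (mul ξ v) + conv Ω h K (mul ξ (-v)) - 2 * conv Ω h K ξ| ≤ C * gauge v := by
  obtain ⟨C₁, hC₁, H₁⟩ := abs_integral_le_far_near (N := 2) one_pos le_rfl (by norm_num)
    (by norm_num) hc hh.finite
  obtain ⟨C₂, hC₂, H₂⟩ := dominated_nearKernel one_pos hc (b := 1) le_rfl
  obtain ⟨C₃, hC₃, H₃⟩ := hK.bound
  obtain ⟨C₄, hC₄, H₄⟩ := hK.taylor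
  obtain ⟨C₅, hC₅, H₅⟩ := conv_bounded hh one_pos hc hK
  have hM := hh.nonneg
  refine ⟨M * (C₄ + C₄) * C₁ + M * C₃ * (C₂ + C₂ + (C₂ + C₂)) + 4 * C₅, by positivity,
    fun ξ v => ?_⟩
  have hmain : 0 ≤ M * (C₄ + C₄) * C₁ + M * C₃ * (C₂ + C₂ + (C₂ + C₂)) := by positivity
  rcases (gauge_nonneg v).eq_or_lt with h0 | h0
  · rw [gauge_eq_zero.1 h0.symm]
    simp
    ring_nf
  rcases le_or_gt (gauge v) 1 with h1 | h1
  · have I1 := conv_integrable hh one_pos hc hK (mul ξ v)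
    have I2 := conv_integrable hh one_pos hc hK (mul ξ (-v))
    have I3 := conv_integrable hh one_pos hc hK ξ
    have hI : ∫ η in Ω, (h η * K (mul (-η) (mul ξ v)) + h η * K (mul (-η) (mul ξ (-v)))
        - 2 * (h η * K (mul (-η) ξ))) =
        conv Ω h K (mul ξ v) + conv Ω h K (mul ξ (-v)) - 2 * conv Ω h K ξ := by
      rw [integral_sub (Integrable.fun_add I1 I2) (Integrable.const_mul I3 2), integral_add I1 I2, integral_const_mul]
      rfl
    have D := fun ζ => H₂ Ω ζ _ h0 h1
    have := H₁ (fun η => h η * K (mul (-η) (mul ξ v)) + h η * K (mul (-η) (mul ξ (-v)))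
        - 2 * (h η * K (mul (-η) ξ)))
      (fun η => M * C₃ * (nearKernel 1 (mul ξ v) (3 * gauge v) η +
        nearKernel 1 (mul ξ (-v)) (3 * gauge v) η +
        (nearKernel 1 ξ (3 * gauge v) η + nearKernel 1 ξ (3 * gauge v) η)))
      ξ (gauge v) (M * (C₄ + C₄)) (M * C₃ * (C₂ + C₂ + (C₂ + C₂))) h0 (by positivity)
      (((((D (mul ξ v)).add (D (mul ξ (-v)))).add ((D ξ).add (D ξ))).const_mul (c := M * C₃)
        (by positivity)).mono (Filter.Eventually.of_forall fun _ => le_rfl) (le_of_eq (by ring)))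
      (fun η => mul_nonneg (by positivity)
        (add_nonneg (add_nonneg (nearKernel_nonneg _ _ _ _) (nearKernel_nonneg _ _ _ _))
          (add_nonneg (nearKernel_nonneg _ _ _ _) (nearKernel_nonneg _ _ _ _)))) ?_
    · rw [hI, Real.rpow_one] at this
      refine this.trans ?_
      have : 0 ≤ 4 * C₅ * gauge v := by positivity
      rw [add_mul _ (4 * C₅)]; linarith
    · filter_upwards [ae_ne_point Ω ξ, ae_ne_point Ω (mul ξ v), ae_ne_point Ω (mul ξ (-v)),
        ae_restrict_mem hh.meas] with η e1 e2 e4 e3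
      rw [mul_left_comm 2, ← mul_add, ← mul_sub, abs_mul]
      constructor
      · intro h2
        rw [mul_assoc]
        refine mul_le_mul (hh.bound η e3) ?_ (abs_nonneg _) hM
        have t1 := (H₄ _ v e1 h2).2
        have t2 := (H₄ _ (-v) e1 (by rwa [gauge_neg])).2
        have t3 : leftDiff K (mul (-η) ξ) (-v) = -leftDiff K (mul (-η) ξ) v := by
          rw [leftDiff, leftDiff, ← map_neg, skew_neg_right, neg_smul, neg_add]
        rw [mul_assoc', sub_right_comm 1] at t1
        rw [mul_assoc', sub_right_comm 1, gauge_neg, t3] at t2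
        rw [add_mul]
        refine le_trans (le_of_eq ?_) ((abs_add_le _ _).trans (add_le_add t1 t2))
        congr 1; ring
      · intro h2
        rw [mul_assoc]
        refine mul_le_mul (hh.bound η e3) ?_ (abs_nonneg _) hM
        have g1 := gdist_mul_le ξ v η
        have g2 := gdist_mul_le ξ (-v) η
        rw [gauge_neg] at g2
        have k1 := IsKernel.abs_le_near H₃ e2 (ρ := 3 * gauge v) (by linarith)
        have k2 := IsKernel.abs_le_near H₃ e4 (ρ := 3 * gauge v) (by linarith)
        have k3 := IsKernel.abs_le_near H₃ e1 (ρ := 3 * gauge v) (by linarith)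
        rw [abs_le] at *
        constructor <;> linarith
  · have h3 := H₅ (mul ξ v)
    have h4 := H₅ ξ
    have h5 := H₅ (mul ξ (-v))
    have : |conv Ω h K (mul ξ v) + conv Ω h K (mul ξ (-v)) - 2 * conv Ω h K ξ| ≤ 4 * C₅ := by
      rw [abs_le] at *; constructor <;> linarith
    nlinarith

/-- The differentiated kernel has degree `c - 1 - Q`, still locally integrable because `c > 1`. Its
near part carries an extra factor `|s|`, which turns the exponent `b - 1` into `b`. -/
lemma conv_horiz_taylor (hh : IsDensity Ω h M) {b c : ℝ} (hc1 : 1 < c) (hc : c < homDim n)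
    (hb0 : 0 < b) (hbc : b ≤ c) (hb : b < 2) {K : Heis n → ℝ} (hK : IsKernel (c - homDim n) K)
    (a : Fin n ⊕ Fin n) (ξ : Heis n) :
    ∃ C : ℝ, 0 ≤ C ∧ ∀ s : ℝ, |s| ≤ 1 → |conv Ω h K (mul ξ (s • hvec a)) - conv Ω h K ξ -
      s * conv Ω h (fieldDeriv (horiz a) K) ξ| ≤ C * |s| ^ b := by
  have hc0 : 0 < c := by linarith
  have hX : IsKernel (c - 1 - homDim n) (fieldDeriv (horiz a) K) := by
    have := hK.fieldDeriv a; rwa [sub_right_comm] at this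
  obtain ⟨C₁, hC₁, H₁⟩ := abs_integral_le_far_near (N := 2) hb0 hbc hb.le (Or.inr hb) hc hh.finite
  obtain ⟨C₂, hC₂, H₂⟩ := dominated_nearKernel hc0 hc hbc
  obtain ⟨C₆, hC₆, H₆⟩ := dominated_nearKernel (c := c - 1) (b := b - 1) (by linarith) (by linarith)
    (by linarith)
  obtain ⟨C₃, hC₃, H₃⟩ := hK.bound
  obtain ⟨C₇, hC₇, H₇⟩ := hX.bound
  obtain ⟨C₄, hC₄, H₄⟩ := hK.taylor
  have hM := hh.nonneg
  refine ⟨M * C₄ * C₁ + M * (C₃ * (C₂ + C₂) + C₇ * C₆), by positivity, fun s hs => ?_⟩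
  rcases eq_or_ne s 0 with rfl | hs0
  · simp [hb0.ne']
  have h0 : 0 < |s| := abs_pos.2 hs0
  have I1 := conv_integrable hh hc0 hc hK (mul ξ (s • hvec a))
  have I2 := conv_integrable hh hc0 hc hK ξ
  have I3 := conv_integrable hh (c := c - 1) (by linarith) (by linarith) hX ξ
  have hI : ∫ η in Ω, (h η * K (mul (-η) (mul ξ (s • hvec a))) - h η * K (mul (-η) ξ)
      - s * (h η * fieldDeriv (horiz a) K (mul (-η) ξ))) =
      conv Ω h K (mul ξ (s • hvec a)) - conv Ω h K ξ -
        s * conv Ω h (fieldDeriv (horiz a) K) ξ := by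
    have I12 : IntegrableOn (fun η => h η * K (mul (-η) (mul ξ (s • hvec a))) -
        h η * K (mul (-η) ξ)) Ω := Integrable.sub I1 I2
    rw [integral_sub I12 (Integrable.const_mul I3 s), integral_sub I1 I2, integral_const_mul]
    rfl
  have hpow : |s| * |s| ^ (b - 1) = |s| ^ b := by
    rw [Real.rpow_sub_one h0.ne']; field_simp
  have := H₁ (fun η => h η * K (mul (-η) (mul ξ (s • hvec a))) - h η * K (mul (-η) ξ)
      - s * (h η * fieldDeriv (horiz a) K (mul (-η) ξ)))
    (fun η => M * (C₃ * (nearKernel c (mul ξ (s • hvec a)) (3 * |s|) η + nearKernel c ξ (3 * |s|) η)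
      + C₇ * (|s| * nearKernel (c - 1) ξ (3 * |s|) η)))
    ξ |s| (M * C₄) (M * (C₃ * (C₂ + C₂) + C₇ * C₆)) h0 (by positivity) ?_
    (fun η => by
      have := nearKernel_nonneg c (mul ξ (s • hvec a)) (3 * |s|) η
      have := nearKernel_nonneg c ξ (3 * |s|) η
      have := nearKernel_nonneg (c - 1) ξ (3 * |s|) η
      positivity) ?_
  · rwa [hI] at this
  · refine Dominated.mono (((((H₂ Ω (mul ξ (s • hvec a)) _ h0 hs).add (H₂ Ω ξ _ h0 hs)).const_mul
      hC₃).add ((((H₆ Ω ξ _ h0 hs).const_mul h0.le)).const_mul hC₇)).const_mul hM)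
      (Filter.Eventually.of_forall fun _ => le_rfl) (le_of_eq ?_)
    rw [← hpow]; ring
  · filter_upwards [ae_ne_point Ω ξ, ae_ne_point Ω (mul ξ (s • hvec a)), ae_restrict_mem hh.meas]
      with η e1 e2 e3
    rw [mul_left_comm s, ← mul_sub, ← mul_sub, abs_mul]
    constructor
    · intro h2
      rw [mul_assoc]
      refine mul_le_mul (hh.bound η e3) ?_ (abs_nonneg _) hM
      have := (H₄ _ (s • hvec a) e1 (by rw [gauge_smul_hvec]; exact h2)).2
      rwa [mul_assoc', sub_right_comm c, gauge_smul_hvec,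
        leftDiff_smul_hvec (hK.differentiableAt e1)] at this
    · intro h2
      refine mul_le_mul (hh.bound η e3) ?_ (abs_nonneg _) hM
      have g1 := gdist_mul_le ξ (s • hvec a) η
      rw [gauge_smul_hvec] at g1
      have k1 := IsKernel.abs_le_near H₃ e2 (ρ := 3 * |s|) (by linarith)
      have k2 := IsKernel.abs_le_near H₃ e1 (ρ := 3 * |s|) (by linarith)
      have k3 := IsKernel.abs_le_near H₇ e1 (ρ := 3 * |s|) (by linarith)
      have k4 := abs_sub (K (mul (-η) (mul ξ (s • hvec a))) - K (mul (-η) ξ))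
        (s * fieldDeriv (horiz a) K (mul (-η) ξ))
      have k5 := abs_sub (K (mul (-η) (mul ξ (s • hvec a)))) (K (mul (-η) ξ))
      rw [abs_mul] at k4
      have k6 := mul_le_mul_of_nonneg_left k3 h0.le
      linarith

lemma hasDerivAt_of_abs_le_rpow {φ : ℝ → ℝ} {L C b : ℝ} (hb : 1 < b)
    (H : ∀ s : ℝ, |s| ≤ 1 → |φ s - φ 0 - s * L| ≤ C * |s| ^ b) : HasDerivAt φ L 0 := by
  rw [hasDerivAt_iff_isLittleO, Asymptotics.isLittleO_iff]
  intro ε hε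
  have hc : Continuous fun s : ℝ => |C| * |s| ^ (b - 1) :=
    continuous_const.mul (continuous_abs.rpow_const fun _ => Or.inr (by linarith))
  have h1 : ∀ᶠ s : ℝ in nhds 0, |C| * |s| ^ (b - 1) < ε :=
    hc.continuousAt.eventually_lt continuousAt_const
      (by simpa [Real.zero_rpow (by linarith : b - 1 ≠ 0)] using hε)
  have h2 : ∀ᶠ s : ℝ in nhds 0, |s| < 1 :=
    continuous_abs.continuousAt.eventually_lt continuousAt_const (by simp)
  filter_upwards [h1, h2] with s h3 h4
  rw [sub_zero, smul_eq_mul, Real.norm_eq_abs, Real.norm_eq_abs]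
  refine (H s h4.le).trans ?_
  rcases eq_or_ne s 0 with rfl | hs
  · simp [(by linarith : b ≠ 0)]
  have e : |s| ^ b = |s| ^ (b - 1) * |s| := by
    rw [Real.rpow_sub_one (abs_pos.2 hs).ne']; field_simp
  rw [e, ← mul_assoc]
  refine mul_le_mul_of_nonneg_right (le_trans ?_ h3.le) (abs_nonneg _)
  gcongr
  exact le_abs_self C

lemma conv_hasDerivAt (hh : IsDensity Ω h M) {c : ℝ} (hc1 : 1 < c) (hc : c < homDim n)
    {K : Heis n → ℝ} (hK : IsKernel (c - homDim n) K) (a : Fin n ⊕ Fin n) (ξ : Heis n) :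
    HasDerivAt (fun s : ℝ => conv Ω h K (ξ + s • horiz a ξ))
      (conv Ω h (fieldDeriv (horiz a) K) ξ) 0 := by
  -- The exponent must exceed `1` to give differentiability, while being at most `c` and below `2`.
  obtain ⟨C, hC, H⟩ := conv_horiz_taylor hh hc1 hc (b := min c (3 / 2)) (by positivity)
    (min_le_left _ _) ((min_le_right _ _).trans_lt (by norm_num)) hK a ξ
  refine hasDerivAt_of_abs_le_rpow (C := C) (b := min c (3 / 2))
    (lt_min hc1 (by norm_num)) fun s hs => ?_
  simpa only [add_smul_horiz, zero_smul, mul_zero', add_zero] using H s hs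

lemma conv_continuous (hh : IsDensity Ω h M) {c : ℝ} (hc0 : 0 < c) (hc : c < homDim n)
    {K : Heis n → ℝ} (hK : IsKernel (c - homDim n) K) : Continuous (conv Ω h K) := by
  have hb : 0 < min c 1 / 2 := by positivity
  have hb1 : min c 1 / 2 < c := by have := min_le_left c 1; linarith
  have hb2 : min c 1 / 2 ≤ 1 := by have := min_le_right c 1; linarith
  obtain ⟨C, hC, H⟩ := conv_first_diff hh hb hb1.le hb2 (Or.inl hb1) hc hK
  refine continuous_iff_continuousAt.2 fun ξ => ?_
  have hc : Continuous fun ξ' : Heis n => C * gauge (mul (-ξ) ξ') ^ (min c 1 / 2) :=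
    continuous_const.mul ((continuous_gauge.comp (continuous_mul.comp
      (continuous_const.prodMk continuous_id))).rpow_const fun _ => Or.inr hb.le)
  have h0 := hc.tendsto ξ
  simp only [neg_mul_self, gauge_zero, Real.zero_rpow hb.ne', mul_zero] at h0
  refine tendsto_iff_norm_sub_tendsto_zero.2
    (squeeze_zero (fun _ => norm_nonneg _) (fun ξ' => ?_) h0)
  have := H ξ (mul (-ξ) ξ')
  rwa [← mul_assoc', mul_neg_self, zero_mul'] at this

/-- Kernels of degree higher than `b - Q` are included because the undifferentiated function must
lie in the base class too. For `b = 1` the genuine second difference estimate is needed only when `m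
= 0`; otherwise the convolution is Lipschitz. -/
lemma conv_gammaBase (hh : IsDensity Ω h M) {b : ℝ} (hb0 : 0 < b) (hb1 : b ≤ 1) (m : ℕ)
    (hc : m + b < homDim n) {K : Heis n → ℝ} (hK : IsKernel (m + b - homDim n) K) :
    GammaBase b (conv Ω h K) := by
  have hm : (0 : ℝ) ≤ m := Nat.cast_nonneg m
  have hc0 : 0 < m + b := by linarith
  obtain ⟨C, -, hC⟩ := conv_bounded hh hc0 hc hK
  refine ⟨⟨conv_continuous hh hc0 hc hK, C, hC⟩, fun h1 => ?_, fun h1 => ?_⟩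
  · obtain ⟨C, -, H⟩ := conv_first_diff hh hb0 (by linarith) hb1 (Or.inr h1) hc hK
    exact ⟨C, H⟩
  · subst h1
    simp only [inv_eq]
    rcases Nat.eq_zero_or_pos m with rfl | hm1
    · simp only [Nat.cast_zero, zero_add] at hc hK
      obtain ⟨C, -, H⟩ := conv_second_diff hh hc hK
      exact ⟨C, H⟩
    · have hm1' : (1 : ℝ) ≤ m := by exact_mod_cast hm1
      obtain ⟨C, -, H⟩ := conv_first_diff hh hb0 (c := m + 1) (by linarith) hb1
        (Or.inl (by linarith)) hc hK
      refine ⟨2 * C, fun ξ η => ?_⟩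
      have e1 := H ξ η
      have e2 := H ξ (-η)
      rw [gauge_neg] at e2
      rw [Real.rpow_one] at e1 e2
      rw [abs_le] at *
      constructor <;> linarith

/-- Convolution of a bounded density with a kernel of degree `m + b - Q` gains `m + b`
derivatives in the Folland–Stein scale. -/
theorem conv_gammaIter (hh : IsDensity Ω h M) {b : ℝ} (hb0 : 0 < b) (hb1 : b ≤ 1) (m : ℕ) :
    m + b < homDim n → ∀ K : Heis n → ℝ, IsKernel (m + b - homDim n) K →
      GammaIter b m (conv Ω h K) := by
  induction m with
  | zero => exact fun hc K hK => conv_gammaBase hh hb0 hb1 0 hc hK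
  | succ m ih =>
    intro hc K hK
    refine ⟨conv_gammaBase hh hb0 hb1 (m + 1) hc hK, fun a => ?_⟩
    have hm : (0 : ℝ) ≤ m := Nat.cast_nonneg m
    push_cast at hc hK
    have hd := conv_hasDerivAt hh (c := m + 1 + b) (by linarith) hc hK a
    refine ⟨fun ξ => (hd ξ).differentiableAt, ?_⟩
    have e : fieldDeriv (horiz a) (conv Ω h K) = conv Ω h (fieldDeriv (horiz a) K) :=
      funext fun ξ => (hd ξ).deriv
    rw [e]
    refine ih (by linarith) _ ?_
    have := hK.fieldDeriv a
    rwa [show (m : ℝ) + 1 + b - homDim n - 1 = m + b - homDim n by ring] at this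

end Estimates

/-! ### Young's inequality and the subcritical bootstrap -/

open scoped ENNReal in
/-- A form of Young's inequality for integral operators. -/
lemma lintegral_kernel_rpow_lt_top {X : Type*} [MeasurableSpace X] {μ : Measure X} [SFinite μ]
    {k : X → X → ℝ≥0∞} (hk : Measurable (Function.uncurry k)) {H : X → ℝ≥0∞}
    (hH : AEMeasurable H μ) {p s u v w : ℝ} (hp : 0 ≤ p) (hs : 0 ≤ s) (hu : 0 < u) (hv : 0 ≤ v)
    (hw : 0 ≤ w) (hsum : u + v + w = 1) (hpu : p * (u + v) = 1) (hsu : s * (u + w) = 1)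
    {A : ℝ≥0∞} (hA : A < ⊤) (h1 : ∀ y, ∫⁻ x, k x y ^ s ∂μ ≤ A) (h2 : ∀ x, ∫⁻ y, k x y ^ s ∂μ ≤ A)
    (hI : ∫⁻ x, H x ^ p ∂μ < ⊤) :
    ∫⁻ y, (∫⁻ x, H x * k x y ∂μ) ^ u⁻¹ ∂μ < ⊤ := by
  set I := ∫⁻ x, H x ^ p ∂μ with hIdef
  have hks : ∀ y, Measurable fun x => k x y ^ s := fun y =>
    (hk.comp (measurable_id.prodMk measurable_const)).pow_const s
  have hpt : ∀ y, (∫⁻ x, H x * k x y ∂μ) ≤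
      (∫⁻ x, H x ^ p * k x y ^ s ∂μ) ^ u * I ^ v * A ^ w := fun y => by
    -- Three-factor Hölder for `H k = (H^p k^s)^u (H^p)^v (k^s)^w`. Only the first factor still
    -- needs integration in `y`, after raising to the power `1/u`, and Tonelli does that.
    have hol := ENNReal.lintegral_prod_norm_pow_le (μ := μ) (Finset.univ : Finset (Fin 3))
      (f := ![fun x => H x ^ p * k x y ^ s, fun x => H x ^ p, fun x => k x y ^ s])
      (p := ![u, v, w])
      (fun i _ => by
        fin_cases i
        · exact (hH.pow_const p).mul (hks y).aemeasurable
        · exact hH.pow_const p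
        · exact (hks y).aemeasurable)
      (by simpa [Fin.sum_univ_three] using hsum)
      (fun i _ => by fin_cases i <;> simp [hu.le, hv, hw])
    simp only [Fin.prod_univ_three, Matrix.cons_val_zero, Matrix.cons_val_one,
      Matrix.cons_val] at hol
    refine le_trans (le_of_eq (lintegral_congr fun x => ?_)) (hol.trans ?_)
    · rw [ENNReal.mul_rpow_of_nonneg _ _ hu.le]
      simp only [← ENNReal.rpow_mul]
      calc H x * k x y = H x ^ (p * u + p * v) * k x y ^ (s * u + s * w) := by
            rw [← mul_add, ← mul_add, hpu, hsu, ENNReal.rpow_one, ENNReal.rpow_one]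
        _ = _ := by
            rw [ENNReal.rpow_add_of_nonneg _ _ (by positivity) (by positivity),
              ENNReal.rpow_add_of_nonneg _ _ (by positivity) (by positivity)]
            ring
    · gcongr
      exact h1 y
  have hswap : ∫⁻ y, ∫⁻ x, H x ^ p * k x y ^ s ∂μ ∂μ ≤ I * A := by
    rw [lintegral_lintegral_swap]
    · calc _ = ∫⁻ x, H x ^ p * ∫⁻ y, k x y ^ s ∂μ ∂μ := lintegral_congr fun x =>
            lintegral_const_mul _ ((hk.comp (measurable_const.prodMk measurable_id)).pow_const s)
        _ ≤ ∫⁻ x, H x ^ p * A ∂μ := lintegral_mono fun x => by gcongr; exact h2 x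
        _ = I * A := by rw [lintegral_mul_const' _ _ hA.ne]
    · exact ((hH.comp_snd).pow_const p).mul
        (((hk.comp measurable_swap).pow_const s).aemeasurable)
  calc ∫⁻ y, (∫⁻ x, H x * k x y ∂μ) ^ u⁻¹ ∂μ
      ≤ ∫⁻ y, (∫⁻ x, H x ^ p * k x y ^ s ∂μ) * ((I ^ v * A ^ w) ^ u⁻¹) ∂μ := by
        refine lintegral_mono fun y => ?_
        refine (ENNReal.rpow_le_rpow (hpt y) (by positivity)).trans (le_of_eq ?_)
        rw [mul_assoc, ENNReal.mul_rpow_of_nonneg _ _ (by positivity), ← ENNReal.rpow_mul,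
          mul_inv_cancel₀ hu.ne', ENNReal.rpow_one]
    _ = (∫⁻ y, ∫⁻ x, H x ^ p * k x y ^ s ∂μ ∂μ) * ((I ^ v * A ^ w) ^ u⁻¹) := by
        refine lintegral_mul_const' _ _ (ENNReal.rpow_lt_top_of_nonneg (by positivity) ?_).ne
        exact (ENNReal.mul_lt_top (ENNReal.rpow_lt_top_of_nonneg hv hI.ne)
          (ENNReal.rpow_lt_top_of_nonneg hw hA.ne)).ne
    _ < ⊤ := by
        refine ENNReal.mul_lt_top (hswap.trans_lt (ENNReal.mul_lt_top hI hA))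
          (ENNReal.rpow_lt_top_of_nonneg (by positivity) ?_)
        exact (ENNReal.mul_lt_top (ENNReal.rpow_lt_top_of_nonneg hv hI.ne)
          (ENNReal.rpow_lt_top_of_nonneg hw hA.ne)).ne

lemma Dominated.lintegral_le {Ω : Set (Heis n)} {Φ : Heis n → ℝ} {B : ℝ}
    (h : Dominated Ω Φ B) : ∫⁻ η in Ω, ENNReal.ofReal (Φ η) ≤ ENNReal.ofReal B := by
  obtain ⟨E, hE, hΦ, hB⟩ := h
  calc ∫⁻ η in Ω, ENNReal.ofReal (Φ η) ≤ ∫⁻ η in Ω, ENNReal.ofReal (E η) := by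
        refine lintegral_mono_ae ?_
        filter_upwards [hΦ] with η h1
        exact ENNReal.ofReal_le_ofReal ((le_abs_self _).trans h1)
    _ = ENNReal.ofReal (∫ η in Ω, E η) := by
        rw [ofReal_integral_eq_lintegral_ofReal hE]
        filter_upwards [hΦ] with η h1 using (abs_nonneg _).trans h1
    _ ≤ _ := ENNReal.ofReal_le_ofReal hB

/-- The potential kernel `|η⁻¹ξ|^{α-Q}` with values in `[0, ∞]`. -/
def potKernel (α : ℝ) (η ξ : Heis n) : ENNReal := ENNReal.ofReal (gdist ξ η ^ (α - homDim n))

lemma measurable_potKernel (α : ℝ) :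
    Measurable (Function.uncurry (potKernel (n := n) α)) :=
  (((continuous_gdist.comp continuous_swap).measurable).pow_const _).ennreal_ofReal

lemma potKernel_comm (α : ℝ) (η ξ : Heis n) : potKernel α η ξ = potKernel α ξ η := by
  rw [potKernel, potKernel, gdist_comm]

/-- Local integrability of the power requires `(Q - α)/(1 - θ) < Q`, which is `θ < α/Q`. -/
lemma potKernel_bound {α θ : ℝ} (hαQ : α < homDim n) (hθ : θ < α / homDim n)
    {Ω : Set (Heis n)} (hΩv : volume Ω < ⊤) :
    ∃ A : ENNReal, A < ⊤ ∧ ∀ ξ : Heis n, ∫⁻ η in Ω, potKernel α η ξ ^ (1 - θ)⁻¹ ≤ A := by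
  have hQ := homDim_pos n
  rw [lt_div_iff₀ hQ] at hθ
  have hθ1 : 0 < 1 - θ := by nlinarith
  have hc : 0 < homDim n - (homDim n - α) * (1 - θ)⁻¹ := by
    rw [sub_pos, ← div_eq_mul_inv, div_lt_iff₀ hθ1]; nlinarith
  have hc' : homDim n - (homDim n - α) * (1 - θ)⁻¹ < homDim n := by
    have : 0 < (homDim n - α) * (1 - θ)⁻¹ := mul_pos (by linarith) (by positivity)
    linarith
  obtain ⟨C, -, H⟩ := dominated_gdist hc hc' hΩv
  refine ⟨ENNReal.ofReal C, ENNReal.ofReal_lt_top, fun ξ => ?_⟩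
  refine le_trans (le_of_eq (lintegral_congr fun η => ?_)) (H ξ).lintegral_le
  rw [potKernel, ENNReal.ofReal_rpow_of_nonneg (Real.rpow_nonneg (gdist_nonneg _ _) _)
    (by positivity), ← Real.rpow_mul (gdist_nonneg _ _)]
  congr 2; ring

open scoped ENNReal in
/-- Subcritical bootstrap: solutions of `G = ∫ G^{p-1} k` in `L^p` are bounded. -/
lemma bootstrap_bounded {α p : ℝ} (hα : 0 < α) (hαQ : α < homDim n) {Ω S : Set (Heis n)}
    (hΩ : MeasurableSet Ω) (hΩv : volume Ω < ⊤) (hΩS : Ω ⊆ S) (hp1 : 1 < p)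
    (hp : p < 2 * homDim n / (homDim n - α)) {G : Heis n → ℝ≥0∞}
    (hG : AEMeasurable G (volume.restrict Ω))
    (hGp : ∫⁻ η in Ω, G η ^ p < ⊤)
    (hsol : ∀ ξ ∈ S, G ξ = ∫⁻ η in Ω, G η ^ (p - 1) * potKernel α η ξ) :
    ∃ B : ℝ≥0∞, B < ⊤ ∧ ∀ ξ ∈ S, G ξ ≤ B := by
  have hQ := homDim_pos n
  have hp0 : 0 < p := by linarith
  -- The interval is nonempty precisely because `p` is subcritical. The lower bound yields a gain at
  -- each step, the upper one integrability of the kernel.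
  obtain ⟨θ, hθ1, hθ2⟩ : ∃ θ, max 0 (1 - 2 / p) < θ ∧ θ < α / homDim n := by
    refine exists_between (max_lt (by positivity) ?_)
    rw [lt_div_iff₀ (by linarith)] at hp
    rw [lt_div_iff₀ hQ, sub_mul, div_mul_eq_mul_div, one_mul, sub_lt_comm, lt_div_iff₀ hp0]
    linarith
  have hθ0 : 0 < θ := (le_max_left _ _).trans_lt hθ1
  have hθ3 : θ < 1 := hθ2.trans ((div_lt_one hQ).2 hαQ)
  obtain ⟨A, hA, HA⟩ := potKernel_bound hαQ hθ2 hΩv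
  set δ := θ - max 0 (1 - 2 / p) with hδ
  have hδ0 : 0 < δ := by rw [hδ]; linarith
  have hH : AEMeasurable (fun η => G η ^ (p - 1)) (volume.restrict Ω) := hG.pow_const _
  -- Either a uniform bound has been reached or `1/r` has dropped by `Nδ`. The latter fails for
  -- large `N` since `1/r > 0`.
  have main : ∀ N : ℕ, (∃ B : ℝ≥0∞, B < ⊤ ∧ ∀ ξ ∈ S, G ξ ≤ B) ∨
      ∃ r : ℝ, p ≤ r ∧ ∫⁻ η in Ω, G η ^ r < ⊤ ∧ r⁻¹ ≤ p⁻¹ - N * δ := by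
    intro N
    induction N with
    | zero => exact Or.inr ⟨p, le_rfl, hGp, by simp⟩
    | succ N ih =>
      refine ih.elim Or.inl ?_
      rintro ⟨r, hpr, hr, hrN⟩
      have hr0 : 0 < r := by linarith
      -- If `(p-1)/θ ≤ r`, then `G^{p-1} ∈ L^{1/θ}` by finite volume, and Hölder against the kernel
      -- in `L^{1/(1-θ)}` gives a pointwise bound. Otherwise Young's inequality improves `r`.
      rcases le_or_gt (p - 1) (θ * r) with hcase | hcase
      · left
        have hI : ∫⁻ η in Ω, (G η ^ (p - 1)) ^ θ⁻¹ < ⊤ := by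
          refine lt_of_le_of_lt (lintegral_mono (g := fun η => 1 + G η ^ r) fun η => ?_) ?_
          · rw [← ENNReal.rpow_mul]
            have he : (p - 1) * θ⁻¹ ≤ r := by
              rw [← div_eq_mul_inv, div_le_iff₀ hθ0]; linarith
            have he0 : 0 ≤ (p - 1) * θ⁻¹ := mul_nonneg (by linarith) (by positivity)
            rcases le_total (G η) 1 with h1 | h1
            · exact (ENNReal.rpow_le_one h1 he0).trans le_self_add
            · exact (ENNReal.rpow_le_rpow_of_exponent_le h1 he).trans le_add_self
          · rw [lintegral_add_left measurable_const]
            simpa using ⟨hΩv, hr⟩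
        have hconj : (θ⁻¹).HolderConjugate (1 - θ)⁻¹ := by
          refine Real.holderConjugate_iff.2 ⟨(one_lt_inv₀ hθ0).2 hθ3, ?_⟩
          rw [inv_inv, inv_inv]; ring
        refine ⟨(∫⁻ η in Ω, (G η ^ (p - 1)) ^ θ⁻¹) ^ (1 / θ⁻¹) * A ^ (1 / (1 - θ)⁻¹),
          ENNReal.mul_lt_top (ENNReal.rpow_lt_top_of_nonneg (by positivity) hI.ne)
            (ENNReal.rpow_lt_top_of_nonneg (by rw [one_div, inv_inv]; linarith) hA.ne),
          fun ξ hξ => ?_⟩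
        rw [hsol ξ hξ]
        refine (ENNReal.lintegral_mul_le_Lp_mul_Lq _ hconj hH
          ((measurable_potKernel α).comp
            (measurable_id.prodMk measurable_const)).aemeasurable).trans ?_
        gcongr
        exact HA ξ
      · right
        have hu : 0 < (p - 1) * r⁻¹ - θ := by
          rw [← div_eq_mul_inv, sub_pos, lt_div_iff₀ hr0]; exact hcase
        have hw : 0 ≤ 1 - (p - 1) * r⁻¹ := by
          rw [← div_eq_mul_inv, sub_nonneg, div_le_one hr0]; linarith
        have hp1' : p - 1 ≠ 0 := by linarith
        have hθ4 : 1 - θ ≠ 0 := by linarith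
        have hI : ∫⁻ η in Ω, (G η ^ (p - 1)) ^ (r / (p - 1)) < ⊤ := by
          simp only [← ENNReal.rpow_mul, mul_div_cancel₀ r hp1']
          exact hr
        have key := lintegral_kernel_rpow_lt_top (μ := volume.restrict Ω)
          (measurable_potKernel (n := n) α) hH (p := r / (p - 1)) (s := (1 - θ)⁻¹)
          (u := (p - 1) * r⁻¹ - θ) (v := θ) (w := 1 - (p - 1) * r⁻¹)
          (div_nonneg hr0.le (by linarith)) (inv_nonneg.2 (by linarith)) hu hθ0.le hw (by ring)
          (by field_simp; ring) (by field_simp; ring) hA HA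
          (fun x => by simpa only [potKernel_comm α x] using HA x) hI
        -- Write `(p-1)/r - θ = 1/r + (p-2)/r - θ`. Since `r ≥ p`, the middle term is at most `max 0
        -- (1 - 2/p) = θ - δ`.
        have hle : (p - 1) * r⁻¹ - θ ≤ r⁻¹ - δ := by
          have h2 : (p - 2) * r⁻¹ ≤ max 0 (1 - 2 / p) := by
            rcases le_total p 2 with h3 | h3
            · exact (mul_nonpos_of_nonpos_of_nonneg (by linarith) (by positivity)).trans
                (le_max_left _ _)
            · refine le_trans ?_ (le_max_right _ _)
              calc (p - 2) * r⁻¹ ≤ (p - 2) * p⁻¹ :=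
                    mul_le_mul_of_nonneg_left (inv_anti₀ hp0 hpr) (by linarith)
                _ = 1 - 2 / p := by field_simp
          rw [hδ]; linarith
        refine ⟨((p - 1) * r⁻¹ - θ)⁻¹, ?_, ?_, ?_⟩
        · refine hpr.trans ?_
          rw [le_inv_comm₀ hr0 hu]; linarith
        · refine lt_of_eq_of_lt (setLIntegral_congr_fun hΩ fun η hη => ?_) key
          simp only [← hsol η (hΩS hη)]
        · rw [inv_inv]; push_cast; linarith
  obtain ⟨N, hN⟩ := exists_nat_gt (p⁻¹ / δ)
  refine (main N).resolve_right ?_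
  rintro ⟨r, hpr, -, hr⟩
  rw [div_lt_iff₀ hδ0] at hN
  have : 0 < r⁻¹ := inv_pos.2 (by linarith)
  linarith

/-! ### Positive solutions -/

lemma IsPositiveSolution.bounded {α q : ℝ} (hα : 0 < α) (hαQ : α < homDim n) {Ω : Set (Heis n)}
    (hΩo : IsOpen Ω) (hΩb : Bornology.IsBounded Ω) (hq1 : 1 < q)
    (hq : q < 2 * homDim n / (homDim n - α)) {g : Heis n → ℝ}
    (hg : MemLp g (ENNReal.ofReal q) (volume.restrict Ω)) (hs : IsPositiveSolution Ω α q g) :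
    ∃ M : ℝ, ∀ ξ ∈ closure Ω, |g ξ| ≤ M := by
  have hΩ := hΩo.measurableSet
  have hnn : ∀ ξ η, η ∈ Ω →
      0 ≤ g η ^ (q - 1) * gauge (mul (inv η) ξ) ^ (α - homDim n) := fun ξ η hη =>
    mul_nonneg (Real.rpow_nonneg (hs.1 η hη).le _) (Real.rpow_nonneg (gauge_nonneg _) _)
  have hae : ∀ ξ, 0 ≤ᵐ[volume.restrict Ω]
      fun η => g η ^ (q - 1) * gauge (mul (inv η) ξ) ^ (α - homDim n) := fun ξ => by
    filter_upwards [ae_restrict_mem hΩ] with η hη using hnn ξ η hη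
  have hGp : ∫⁻ η in Ω, ENNReal.ofReal (g η) ^ q < ⊤ := by
    have h1 := lintegral_rpow_enorm_lt_top_of_eLpNorm_lt_top (by simp; linarith)
      ENNReal.ofReal_ne_top hg.2
    rw [ENNReal.toReal_ofReal (by linarith)] at h1
    refine lt_of_eq_of_lt (setLIntegral_congr_fun hΩ fun η hη => ?_) h1
    simp only [Real.enorm_of_nonneg (hs.1 η hη).le]
  obtain ⟨B, hB, H⟩ := bootstrap_bounded hα hαQ hΩ hΩb.measure_lt_top subset_closure hq1 hq
    hg.1.aemeasurable.ennreal_ofReal hGp (fun ξ hξ => by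
      obtain ⟨h1, h2⟩ := hs.2 ξ hξ
      -- Integrability is part of the notion of solution, so the Bochner integral here is a genuine
      -- `[0, ∞]`-valued integral and not the default value `0`.
      rw [h2, ofReal_integral_eq_lintegral_ofReal h1 (hae ξ)]
      refine setLIntegral_congr_fun hΩ fun η hη => ?_
      simp only [potKernel, gdist]
      rw [ENNReal.ofReal_mul (Real.rpow_nonneg (hs.1 η hη).le _),
        ENNReal.ofReal_rpow_of_nonneg (hs.1 η hη).le (by linarith), inv_eq])
  refine ⟨B.toReal, fun ξ hξ => ?_⟩
  have h0 : 0 ≤ g ξ := by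
    rw [(hs.2 ξ hξ).2]
    exact integral_nonneg_of_ae (hae ξ)
  rw [abs_of_nonneg h0]
  exact (ENNReal.ofReal_le_iff_le_toReal hB.ne).1 (H ξ hξ)

/-- The convolution integral makes sense at every point of the group, so it serves as the global
extension of `g`; boundedness of `g` makes `g^{q-1}` an admissible density. -/
lemma IsPositiveSolution.mem_gammaOn {α q : ℝ} (hα : 0 < α) (hαQ : α < homDim n)
    {Ω : Set (Heis n)} (hΩo : IsOpen Ω) (hΩb : Bornology.IsBounded Ω) (hq1 : 1 < q)
    {g : Heis n → ℝ} (hg : AEStronglyMeasurable g (volume.restrict Ω))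
    (hs : IsPositiveSolution Ω α q g) (hM : ∃ M : ℝ, ∀ ξ ∈ closure Ω, |g ξ| ≤ M) :
    g ∈ GammaOn α (closure Ω) := by
  obtain ⟨M, hM⟩ := hM
  have hd : IsDensity Ω (fun η => g η ^ (q - 1)) (|M| ^ (q - 1)) :=
    { meas := hΩo.measurableSet
      finite := hΩb.measure_lt_top
      aesm := (hg.aemeasurable.pow_const _).aestronglyMeasurable
      nonneg := by positivity
      bound := fun η hη => by
        have h0 := (hs.1 η hη).le
        rw [abs_of_nonneg (Real.rpow_nonneg h0 _)]
        refine Real.rpow_le_rpow h0 ?_ (by linarith)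
        exact (le_abs_self _).trans ((hM η (subset_closure hη)).trans (le_abs_self M)) }
  have hc : 0 < ⌈α⌉₊ := Nat.ceil_pos.2 hα
  have hc1 : ((⌈α⌉₊ - 1 : ℕ) : ℝ) = ⌈α⌉₊ - 1 := by
    rw [Nat.cast_sub hc]; simp
  have hk1 : ((⌈α⌉₊ - 1 : ℕ) : ℝ) < α := by
    rw [hc1]; linarith [Nat.ceil_lt_add_one hα.le]
  have hk2 : α ≤ ((⌈α⌉₊ - 1 : ℕ) : ℝ) + 1 := by
    rw [hc1]; linarith [Nat.le_ceil α]
  -- Taking the ceiling minus one, not the floor, puts `α - k` in `(0, 1]`: an integer `α` is split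
  -- as `(α - 1) + 1`.
  set k := ⌈α⌉₊ - 1
  have e : (k : ℝ) + (α - k) = α := by ring
  refine ⟨conv Ω (fun η => g η ^ (q - 1)) (fun ζ => gauge ζ ^ (α - homDim n)),
    ⟨k, α - k, by linarith, by linarith, e.symm, ?_⟩, fun ξ hξ => ?_⟩
  · exact conv_gammaIter hd (by linarith) (by linarith) k (by rwa [e]) _
      (by rw [e]; exact isKernel_gauge_rpow _)
  · rw [(hs.2 ξ hξ).2, conv]
    simp only [inv_eq]

end Heisenberg

end

theorem mainTheorem7 (n : ℕ) (hn : 1 ≤ n) (α : ℝ) (hα : 0 < α) (hαQ : α < Heisenberg.homDim n)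
    (Ω : Set (Heisenberg.Heis n)) (hΩo : IsOpen Ω) (hΩb : Bornology.IsBounded Ω)
    (q' : ℝ) (hq1 : 1 < q')
    (hq : q' < 2 * Heisenberg.homDim n / (Heisenberg.homDim n - α)) :
    (∀ g : Heisenberg.Heis n → ℝ,
      MemLp g (ENNReal.ofReal q') (volume.restrict Ω) →
      Heisenberg.IsPositiveSolution Ω α q' g →
        (∃ M : ℝ, ∀ ξ ∈ closure Ω, |g ξ| ≤ M) ∧
        g ∈ Heisenberg.GammaOn α (closure Ω)) ∧
    Heisenberg.GammaOn α (closure Ω) ⊆ Heisenberg.LipOn (α / 2) (closure Ω) := by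
  refine ⟨fun g hg hs => ?_, Heisenberg.gammaOn_subset_lipOn hn hΩb.closure⟩
  have hM := hs.bounded hα hαQ hΩo hΩb hq1 hq hg
  exact ⟨hM, hs.mem_gammaOn hα hαQ hΩo hΩb hq1 hg.1 hM⟩
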